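/- **Setting.** A nearest neighbour contingency table (NNCT) for two classes records the number $N_{ij}$ of (base, NN) pairs whose base point has class $i$ and whose nearest neighbour (NN) has class $j$, $i,j\in\{1,2\}$. Put $n_i=N_{i1}+N_{i2}$, $C_j=N_{1j}+N_{2j}$, $n=n_1+n_2$, $$T_n=\frac{N_{11}}{n_1}-\frac{N_{21}}{n_2},\qquad Z_n=\Big(\frac{N_{11}}{n_1}-\frac{N_{21}}{n_2}\Big)\sqrt{\frac{n_1n_2n}{C_1C_2}},\qquad \widetilde Z_n=\Big(N_{11}-\frac{n_1C_1}{n}\Big)\sqrt{\frac{n^3}{n_1n_2C_1C_2}}$$ (a statistic whose denominator vanishes is read as $0$, i.e. the test does not reject), and let $z(\beta)$ be the $\beta$-quantile of $N(0,1)$. For $0<\alpha<1$ and $S\in\{Z_n,\widetilde Z_n\}$ the one-sided test against segregation rejects when $S>z(1-\alpha)$, the one-sided test against spatial association when $S<z(\alpha)$. **(I) Random sample of (base, NN) pairs.** (a) *Row-wise binomial framework.* Let $n_1,n_2$ be fixed, and let $N_{11}\sim\mathrm{Bin}(n_1,\pi_{11})$ and $N_{21}\sim \mathrm{Bin}(n_2,\pi_{21})$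 be independent (the NN labels of the $n_1+n_2$ pairs are independent). If $\pi_{11}=\pi_{21}\in(0,1)$, the rejection probability of each of the two tests based on $Z_n$ converges to $\alpha$ as $n_1,n_2\to\infty$. If $\pi_{11}>\pi_{21}$, the power of the test against segregation converges to $1$; if $\pi_{11}<\pi_{21}$, the power of the test against association converges to $1$. (b) *Overall multinomial framework.* Let the table be that of $n$ i.i.d. pairs of labels with cell probabilities $\pi_{ij}$, and let $\nu_1=\pi_{11}+\pi_{12}$, $\kappa_1=\pi_{11}+\pi_{21}$, so that $\mathbf E[N_{11}/n]=\pi_{11}$. If $\pi_{11}=\nu_1\kappa_1$ with $\nu_1,\kappa_1\in(0,1)$, the rejection probability of each of the two tests based on $\widetilde Z_n$ converges to $\alpha$ as $n\to\infty$. If $\pi_{11}>\nu_1\kappa_1$ (resp. $<$), the power of the test against segregation (resp. association) converges to $1$. **(II) Spatial null patterns in the plane.** The NNCT is now built from $n=n_1+n_2$ labelled points of $\mathbb R^2$, each point being paired with one nearest neighbour; $R$ denotes twice the number of reflexive pairs (pairs of points that are NNs of each other). Consider * *random labelling (RL)*: fixed distinct locations, of which a uniformly random subset of size $n_1$ gets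 class 1 and the others class 2; ties among nearest neighbours are broken in any fixed way, and reflexive pairs are a non-vanishing fraction, i.e. $\liminf R/n>0$; * *CSR independence*: $n_1$ points of class 1 and $n_2$ points of class 2, all independent and uniform on a measurable region $D\subset\mathbb R^2$ of finite positive area. Let $n\to\infty$ with $n_1/n\to\nu_1\in(0,1)$. Under either pattern: (c) for all large $n$, $\mathbf{Var}_{II}[T_n]>\mathbf{Var}_{I}[T_n]$, where $\mathbf{Var}_{II}$ is the variance under the pattern and $\mathbf{Var}_I$ the variance in the row-wise binomial framework with the same class sizes and $\pi_{11}=\pi_{21}=n_1/n$; (d) the tests are liberal: for $0<\alpha<1/2$, each of the four tests ($S=Z_n$ or $\widetilde Z_n$, either direction) satisfies $\liminf \mathbf P(\text{reject})>\alpha$. The tests are nevertheless consistent as the marginal sums grow: for $0<\alpha<1$, $\varepsilon>0$ and $S\in\{Z_n,\widetilde Z_n\}$, the power of the test against segregation (resp. association) converges to $1$ in each of the following cases. (e) (*departures from CSR independence*) all points are independent, those of class 1 have a common law and those of class 2 have a common law (both without atoms, possibly depending on $n_1,n_2$), $n_1,n_2\to\infty$, and eventually $\mathbf E[T_n]\ge\varepsilon$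 (resp. $\le-\varepsilon$); (f) (*departures from RL*) the locations are fixed and distinct (ties broken in any fixed way), the labels are independent with probabilities that may depend on the location, the expected class sizes $\mathbf E[n_1],\mathbf E[n_2]$ tend to $\infty$, and eventually $\mathbf E[N_{11}]/\mathbf E[n_1]-\mathbf E[N_{21}]/\mathbf E[n_2]\ge\varepsilon$ (resp. $\le-\varepsilon$); (g) (*any other departure*) locations and labels have any joint law with distinct points and fixed class sizes, $n_1,n_2\to\infty$, $\mathbf{Var}[T_n]\to0$, and eventually $\mathbf E[T_n]\ge\varepsilon$ (resp. $\le-\varepsilon$). In (e) and (g), a tie among nearest neighbours is broken in favour of the smallest index. -/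

import Mathlib

open MeasureTheory ProbabilityTheory Filter Topology

noncomputable section

/-- Locations are points of the Euclidean plane. -/
abbrev Plane := EuclideanSpace ℝ (Fin 2)

/-! ### Nearest neighbour contingency tables

The two classes `1, 2` are encoded as `0, 1 : Fin 2`, so that the cell count `N₁₁` is `N 0 0`,
`N₂₁` is `N 1 0`, and so on. -/

/-- A `2 × 2` table of counts: `N i j` is the number of (base, NN) pairs whose base is of class `i`
and whose NN is of class `j`. -/
abbrev Table := Fin 2 → Fin 2 → ℕ

namespace Table

/-- The row sums `n_i`. -/
def rowSum (N : Table) (i : Fin 2) : ℕ := ∑ j, N i j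

/-- The column sums `C_j`. -/
def colSum (N : Table) (j : Fin 2) : ℕ := ∑ i, N i j

/-- The total count `n`. -/
def total (N : Table) : ℕ := ∑ i, ∑ j, N i j

/-- `T_n = N₁₁ / n₁ - N₂₁ / n₂`. -/
def diffT (N : Table) : ℝ := (N 0 0 : ℝ) / N.rowSum 0 - (N 1 0 : ℝ) / N.rowSum 1

/-- `Z_n = (N₁₁ / n₁ - N₂₁ / n₂) √(n₁ n₂ n / (C₁ C₂))`. -/
def pielouZ (N : Table) : ℝ :=
  ((N 0 0 : ℝ) / N.rowSum 0 - (N 1 0 : ℝ) / N.rowSum 1) *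
    √((N.rowSum 0 : ℝ) * N.rowSum 1 * N.total / ((N.colSum 0 : ℝ) * N.colSum 1))

/-- `Z̃_n = (N₁₁ - n₁ C₁ / n) √(n³ / (n₁ n₂ C₁ C₂))`. -/
def pielouZtilde (N : Table) : ℝ :=
  ((N 0 0 : ℝ) - (N.rowSum 0 : ℝ) * N.colSum 0 / N.total) *
    √((N.total : ℝ) ^ 3 /
      ((N.rowSum 0 : ℝ) * N.rowSum 1 * N.colSum 0 * N.colSum 1))

end Table

/-- The table obtained by cross-classifying finitely many (base, NN) pairs, the `k`-th one having
base class `base k` and NN class `nn k`. -/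
def nnct {ι : Type*} [Fintype ι] (base nn : ι → Fin 2) : Table :=
  fun i j => (Finset.univ.filter fun k => base k = i ∧ nn k = j).card

/-! ### The one-sided tests -/

/-- The `β`-quantile of the standard normal distribution. -/
def normalQuantile (β : ℝ) : ℝ := sInf {x : ℝ | β ≤ cdf (gaussianReal 0 1) x}

/-- Rejection region of the one-sided level `α` test against segregation based on `S`. -/
def rejectSeg (S : Table → ℝ) (α : ℝ) : Set Table := {N | normalQuantile (1 - α) < S N}

/-- Rejection region of the one-sided level `α` test against spatial association based on `S`. -/
def rejectAssoc (S : Table → ℝ) (α : ℝ) : Set Table := {N | S N < normalQuantile α}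

/-! ### Random samples of (base, NN) pairs -/

/-- The law of a random class label that is class 1 with probability `p` (for `0 ≤ p ≤ 1`). -/
def labelLaw (p : ℝ) : Measure (Fin 2) :=
  ENNReal.ofReal p • Measure.dirac 0 + ENNReal.ofReal (1 - p) • Measure.dirac 1

/-- Row-wise binomial framework: the NN labels of `n₁` pairs with base class 1 and of `n₂` pairs
with base class 2; all are independent, and a NN label is class 1 with probability `p₁`
(resp. `p₂`) if the base is of class 1 (resp. 2). -/
def rowwiseLaw (n₁ n₂ : ℕ) (p₁ p₂ : ℝ) : Measure ((Fin n₁ → Fin 2) × (Fin n₂ → Fin 2)) :=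
  (Measure.pi fun _ => labelLaw p₁).prod (Measure.pi fun _ => labelLaw p₂)

/-- The table of a row-wise sample. -/
def rowwiseTable {n₁ n₂ : ℕ} (s : (Fin n₁ → Fin 2) × (Fin n₂ → Fin 2)) : Table :=
  nnct (Sum.elim (fun _ : Fin n₁ => (0 : Fin 2)) (fun _ : Fin n₂ => (1 : Fin 2)))
    (Sum.elim s.1 s.2)

/-- Overall multinomial framework: `n` independent pairs (base label, NN label) with common
law `μ`. -/
def pairsLaw (n : ℕ) (μ : Measure (Fin 2 × Fin 2)) : Measure (Fin n → Fin 2 × Fin 2) :=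
  Measure.pi fun _ => μ

/-- The table of a sample of pairs. -/
def pairsTable {n : ℕ} (s : Fin n → Fin 2 × Fin 2) : Table :=
  nnct (fun k => (s k).1) (fun k => (s k).2)

/-! ### Nearest neighbours and labelled point patterns -/

/-- `x j` is a nearest neighbour of `x i` in the finite pattern `x`. -/
def IsNN {n : ℕ} (x : Fin n → Plane) (i j : Fin n) : Prop :=
  j ≠ i ∧ ∀ l, l ≠ i → dist (x i) (x j) ≤ dist (x i) (x l)

/-- `f` selects one nearest neighbour for every point of `x` (ties are broken in any way). -/
def IsNNMap {n : ℕ} (x : Fin n → Plane) (f : Fin n → Fin n) : Prop := ∀ i, IsNN x i (f i)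

/-- A nearest neighbour map for random locations; a tie is broken in favour of the smallest
index. (A point without nearest neighbour, i.e. the only point of a pattern, is sent to itself.) -/
def nnMap {n : ℕ} (x : Fin n → Plane) (i : Fin n) : Fin n :=
  open Classical in
  if h : (Finset.univ.filter fun j => IsNN x i j).Nonempty then
    (Finset.univ.filter fun j => IsNN x i j).min' h
  else i

/-- `R`: the number of points that are the NN of their own NN, i.e. twice the number of
reflexive pairs. -/
def reflexiveCount {n : ℕ} (f : Fin n → Fin n) : ℕ :=
  (Finset.univ.filter fun i => f (f i) = i).card

/-- The NNCT of points labelled by `lab` with nearest neighbour map `f`. -/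
def spatialTable {n : ℕ} (f : Fin n → Fin n) (lab : Fin n → Fin 2) : Table :=
  nnct lab (fun k => lab (f k))

/-- Random labelling: all assignments of class 1 to exactly `n₁` of the `n₁ + n₂` fixed locations,
and class 2 to the others, are equally likely. -/
def rlLaw (n₁ n₂ : ℕ) : Measure (Fin (n₁ + n₂) → Fin 2) :=
  uniformOn {lab | (Finset.univ.filter fun k => lab k = 0).card = n₁}

/-- The labels when the first `n₁` points are those of class 1, the other `n₂` those of class 2. -/
def blockLabels (n₁ n₂ : ℕ) : Fin (n₁ + n₂) → Fin 2 := fun k => if k.val < n₁ then 0 else 1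

/-- The law of independent locations of which the first `n₁` (class 1) have law `μ₁` and the other
`n₂` (class 2) have law `μ₂`. -/
def locationLaw (n₁ n₂ : ℕ) (μ₁ μ₂ : Measure Plane) : Measure (Fin (n₁ + n₂) → Plane) :=
  Measure.pi fun k => if k.val < n₁ then μ₁ else μ₂

/-- CSR independence: `n₁` class 1 points and `n₂` class 2 points, all independent and uniformly
distributed on the region `D`. -/
def csrLaw (n₁ n₂ : ℕ) (D : Set Plane) : Measure (Fin (n₁ + n₂) → Plane) :=
  locationLaw n₁ n₂ (cond volume D) (cond volume D)

/-- The NNCT of locations of which the first `n₁` are those of class 1. -/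
def blockTable {n₁ n₂ : ℕ} (x : Fin (n₁ + n₂) → Plane) : Table :=
  spatialTable (nnMap x) (blockLabels n₁ n₂)

end

/-! The two statistics are the same function of the table (`Table.pielouZtilde_eq_pielouZ`), so one
analysis serves all tests. By `Table.pielouZ_eq_of_pos` the statistic is T divided by √(v n / (n₁
n₂)), times √(v / (c (1 - c))) with c = C₁ / n. When c tends in probability to p and v = p (1 - p),
the last factor tends to 1, and the size of the tests is governed by the fluctuations of T alone.

For random samples of pairs, the numerator is a sum of independent terms, up to a negligible product
of two centred means in the multinomial case. Normal limits come from characteristic functions: if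
E[W exp(isW)] is close to is E[exp(isW)], then φ nearly solves φ' = -tφ and is close to the normal
characteristic function. The estimate `norm_charFn_sub_le_of_multilinear` covers sums of independent
variables as well as quadratic forms in independent variables.

Under random labelling, T is a multiple of the quadratic form `nnForm`, the sum over i of u_i u_{f
i} with u the centred class indicators. For i.i.d. labels this form has variance v² (n + R): the R
ordered reflexive pairs are counted twice. Hence T is more dispersed than in the row-wise model by
the factor 1 + R/n, which is why the variance is larger and the tests are liberal. Normality for
i.i.d. labels needs bounded in-degree of the nearest neighbour map, which holds because two points
with a common nearest neighbour are seen from it under an angle of at least 60 degrees. It passes to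
fixed class sizes by a coupling (`norm_charFn_labelUniform_sub_le`): about √n labels are changed,
which moves the form by the order of n^(1/4) only, against a scale of √n. First and second moments
under random labelling are computed from random permutations.

CSR independence reduces to random labelling: the points are exchangeable and almost surely have no
ties, so conditionally on the locations the labels are random (`integral_exchangeable`). The bounds
for random labelling are uniform in the nearest neighbour map, and the expected number of points in
reflexive pairs is at least n/32 by the Lebesgue density theorem.

For consistency, |T| ≥ δ and row sums at least K force a statistic of absolute value at least δ√K
(`Table.pielouZ_ge`, `Table.pielouZ_le`). It remains to concentrate T, or the counts that it is made
of, by Chebyshev's inequality. For independent locations or independent labels the variances are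
bounded by the Efron–Stein inequality `variance_pi_le_sum_influence`, again through the bounded
in-degree. -/

noncomputable section

set_option linter.unusedSectionVars false

/-! ### Resampling one coordinate of a product measure -/

section Resampling

variable {ι : Type*} {α : Type*}

/-- A bounded measurable real function. -/
def BddMeas [MeasurableSpace α] (g : α → ℝ) : Prop := Measurable g ∧ ∃ C, ∀ x, |g x| ≤ C

namespace BddMeas

variable [MeasurableSpace α] {g h : α → ℝ}

lemma integrable (hg : BddMeas g) (P : Measure α) [IsFiniteMeasure P] : Integrable g P := by
  obtain ⟨C, hC⟩ := hg.2
  exact Integrable.of_bound hg.1.aestronglyMeasurable C (Eventually.of_forall hC)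

lemma memLp (hg : BddMeas g) (P : Measure α) [IsFiniteMeasure P] (p : ENNReal) : MemLp g p P := by
  obtain ⟨C, hC⟩ := hg.2
  exact MemLp.of_bound hg.1.aestronglyMeasurable C (Eventually.of_forall hC)

lemma sub (hg : BddMeas g) (hh : BddMeas h) : BddMeas fun x => g x - h x := by
  obtain ⟨C, hC⟩ := hg.2
  obtain ⟨D, hD⟩ := hh.2
  exact ⟨hg.1.sub hh.1, C + D, fun x => (abs_sub _ _).trans (add_le_add (hC x) (hD x))⟩

lemma mul (hg : BddMeas g) (hh : BddMeas h) : BddMeas fun x => g x * h x := by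
  obtain ⟨C, hC⟩ := hg.2
  obtain ⟨D, hD⟩ := hh.2
  refine ⟨hg.1.mul hh.1, C * D, fun x => ?_⟩
  rw [abs_mul]
  exact mul_le_mul (hC x) (hD x) (abs_nonneg _) ((abs_nonneg _).trans (hC x))

lemma sq (hg : BddMeas g) : BddMeas fun x => g x ^ 2 := by
  simpa only [pow_two] using hg.mul hg

lemma comp {β : Type*} [MeasurableSpace β] (hg : BddMeas g) {u : β → α} (hu : Measurable u) :
    BddMeas fun x => g (u x) :=
  ⟨hg.1.comp hu, hg.2.imp fun _ hC x => hC (u x)⟩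

lemma of_finite [Finite α] [MeasurableSingletonClass α] (g : α → ℝ) : BddMeas g := by
  refine ⟨Measurable.of_discrete, ?_⟩
  obtain ⟨C, hC⟩ := (Set.finite_range fun x => |g x|).bddAbove
  exact ⟨C, fun x => hC ⟨x, rfl⟩⟩

lemma integral_right {β : Type*} [MeasurableSpace β] {G : α × β → ℝ} (hG : BddMeas G)
    (Q : Measure β) [IsProbabilityMeasure Q] : BddMeas fun x => ∫ y, G (x, y) ∂Q := by
  obtain ⟨C, hC⟩ := hG.2
  refine ⟨(hG.1.stronglyMeasurable.integral_prod_right' (ν := Q)).measurable, C, fun x => ?_⟩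
  simpa using norm_integral_le_of_norm_le_const (μ := Q) (f := fun y => G (x, y))
    (Eventually.of_forall fun y => by simpa using hC (x, y))

end BddMeas

variable [Fintype ι] [DecidableEq ι] [MeasurableSpace α]

lemma measurable_update_prod (k : ι) :
    Measurable fun z : (ι → α) × α => Function.update z.1 k z.2 := by
  refine measurable_pi_lambda _ fun i => ?_
  by_cases h : i = k
  · subst h; simpa using measurable_snd
  · simp only [Function.update_of_ne h]
    exact (measurable_pi_apply i).comp measurable_fst

variable (μ : ι → Measure α) [∀ i, IsProbabilityMeasure (μ i)]

/-- Redrawing one coordinate independently from its own law does not change the product law. All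
Fubini arguments about single coordinates go through this map. -/
lemma measurePreserving_update_prod (k : ι) :
    MeasurePreserving (fun z : (ι → α) × α => Function.update z.1 k z.2)
      ((Measure.pi μ).prod (μ k)) (Measure.pi μ) := by
  refine ⟨measurable_update_prod k, ?_⟩
  refine (Measure.pi_eq fun s hs => ?_).symm
  rw [Measure.map_apply (measurable_update_prod k) (MeasurableSet.univ_pi hs)]
  have : (fun z : (ι → α) × α => Function.update z.1 k z.2) ⁻¹' Set.univ.pi s =
      (Set.univ.pi (Function.update s k Set.univ)) ×ˢ s k := by
    ext ⟨x, y⟩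
    simp only [Set.mem_preimage, Set.mem_pi, Set.mem_univ, true_implies, Set.mem_prod]
    constructor
    · intro h
      refine ⟨fun i => ?_, by simpa using h k⟩
      by_cases hi : i = k
      · subst hi; simp
      · simpa [Function.update_of_ne hi] using h i
    · rintro ⟨h, hk⟩ i
      by_cases hi : i = k
      · subst hi; simpa using hk
      · simpa [Function.update_of_ne hi] using h i
  rw [this, Measure.prod_prod, Measure.pi_pi, ← Finset.mul_prod_erase _ _ (Finset.mem_univ k),
    ← Finset.mul_prod_erase _ (fun i => μ i (s i)) (Finset.mem_univ k), Function.update_self,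
    measure_univ, one_mul, mul_comm]
  congr 1
  refine Finset.prod_congr rfl fun i hi => ?_
  rw [Function.update_of_ne (Finset.ne_of_mem_erase hi)]

lemma integral_update {E : Type*} [NormedAddCommGroup E] [NormedSpace ℝ E] (k : ι)
    {g : (ι → α) → E} (hg : Integrable g (Measure.pi μ)) :
    ∫ x, ∫ y, g (Function.update x k y) ∂(μ k) ∂(Measure.pi μ) = ∫ x, g x ∂(Measure.pi μ) := by
  have h := measurePreserving_update_prod μ k
  have h1 : ∫ x, g x ∂(Measure.pi μ) =
      ∫ z, g (Function.update z.1 k z.2) ∂((Measure.pi μ).prod (μ k)) := by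
    conv_lhs => rw [← h.map_eq]
    exact integral_map h.measurable.aemeasurable (by rw [h.map_eq]; exact hg.aestronglyMeasurable)
  rw [h1, integral_prod]
  exact h.integrable_comp_of_integrable hg

/-- Averaging out the coordinate `k`. -/
def avgAt (k : ι) (g : (ι → α) → ℝ) (x : ι → α) : ℝ := ∫ y, g (Function.update x k y) ∂(μ k)

/-- The expected squared effect of resampling coordinate `k`. -/
def influence (k : ι) (g : (ι → α) → ℝ) : ℝ :=
  ∫ x, ∫ y, (g x - g (Function.update x k y)) ^ 2 ∂(μ k) ∂(Measure.pi μ)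

variable {μ} {g : (ι → α) → ℝ}

lemma BddMeas.avgAt (hg : BddMeas g) (k : ι) : BddMeas (avgAt μ k g) :=
  (hg.comp (measurable_update_prod k)).integral_right (μ k)

lemma avgAt_update (k : ι) (x : ι → α) (y : α) :
    avgAt μ k g (Function.update x k y) = avgAt μ k g x := by
  simp [avgAt]

lemma integral_avgAt (hg : BddMeas g) (k : ι) :
    ∫ x, avgAt μ k g x ∂(Measure.pi μ) = ∫ x, g x ∂(Measure.pi μ) :=
  integral_update μ k (hg.integrable _)

/-- Given the other coordinates, the original and the resampled value of `g` are independent copies,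
and a variance is half the mean squared difference of two such copies. -/
lemma integral_sq_sub_integral_avgAt_sq (hg : BddMeas g) (k : ι) :
    ∫ x, g x ^ 2 ∂(Measure.pi μ) - ∫ x, avgAt μ k g x ^ 2 ∂(Measure.pi μ) =
      1 / 2 * influence μ k g := by
  have hu : ∀ x, BddMeas fun y => g (Function.update x k y) := fun x =>
    (hg.comp (measurable_update_prod k)).comp (measurable_const.prodMk measurable_id)
  have h1 : ∀ x, ∫ y, (g x - g (Function.update x k y)) ^ 2 ∂(μ k) =
      g x ^ 2 - 2 * (g x * avgAt μ k g x) + avgAt μ k (fun x => g x ^ 2) x := by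
    intro x
    have : ∀ y, (g x - g (Function.update x k y)) ^ 2 =
        g x ^ 2 - 2 * g x * g (Function.update x k y) + g (Function.update x k y) ^ 2 :=
      fun y => by ring
    simp_rw [this]
    rw [integral_add, integral_sub, integral_const_mul]
    · simp [avgAt]; ring
    · exact integrable_const _
    · exact ((hu x).integrable _).const_mul _
    · exact (integrable_const _).sub (((hu x).integrable _).const_mul _)
    · exact (hu x).sq.integrable _
  have h2 : ∫ x, g x * avgAt μ k g x ∂(Measure.pi μ) = ∫ x, avgAt μ k g x ^ 2 ∂(Measure.pi μ) := by
    rw [← integral_avgAt (hg.mul (hg.avgAt k)) k]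
    congr 1
    ext x
    simp only [avgAt, Function.update_idem]
    rw [integral_mul_const]
    ring
  have hga := hg.mul (hg.avgAt (μ := μ) k)
  simp only [influence]
  simp_rw [h1]
  rw [integral_add, integral_sub, integral_const_mul, h2, integral_avgAt hg.sq]
  · ring
  · exact hg.sq.integrable _
  · exact (hga.integrable _).const_mul _
  · exact (hg.sq.integrable _).sub ((hga.integrable _).const_mul _)
  · exact (hg.sq.avgAt k).integrable _

lemma sq_integral_le {β : Type*} [MeasurableSpace β] {h : β → ℝ} (hh : BddMeas h) (P : Measure β)
    [IsProbabilityMeasure P] : (∫ z, h z ∂P) ^ 2 ≤ ∫ z, h z ^ 2 ∂P := by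
  have := variance_eq_sub (hh.memLp P 2)
  have h0 := variance_nonneg h P
  simp only [Pi.pow_apply] at this
  linarith

/-- Jensen's inequality takes the square inside the average over coordinate `j`. After Fubini, the
redrawn coordinate `j` is absorbed into the product law. -/
lemma influence_avgAt_le (hg : BddMeas g) {j k : ι} (hjk : j ≠ k) :
    influence μ k (avgAt μ j g) ≤ influence μ k g := by
  have hm : Measurable fun z : ((ι → α) × α) => Function.update z.1 k z.2 :=
    measurable_update_prod k
  have hH : BddMeas fun z : (ι → α) × α => (g z.1 - g (Function.update z.1 k z.2)) ^ 2 :=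
    ((hg.comp measurable_fst).sub (hg.comp hm)).sq
  have hm3 : Measurable fun z : ((ι → α) × α) × α => (Function.update z.1.1 j z.2, z.1.2) :=
    ((measurable_update_prod j).comp
      ((measurable_fst.comp measurable_fst).prodMk measurable_snd)).prodMk
        (measurable_snd.comp measurable_fst)
  have hm3' : Measurable fun z : ((ι → α) × α) × α => (Function.update z.1.1 j z.1.2, z.2) :=
    ((measurable_update_prod j).comp measurable_fst).prodMk measurable_snd
  have key : ∀ x y, (avgAt μ j g x - avgAt μ j g (Function.update x k y)) ^ 2 ≤
      ∫ z, (g (Function.update x j z) - g (Function.update (Function.update x j z) k y)) ^ 2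
        ∂(μ j) := by
    intro x y
    have hb1 : BddMeas fun z => g (Function.update x j z) :=
      (hg.comp (measurable_update_prod j)).comp (measurable_const.prodMk measurable_id)
    have hb2 : BddMeas fun z => g (Function.update (Function.update x j z) k y) := by
      simp_rw [Function.update_comm hjk]
      exact (hg.comp (measurable_update_prod j)).comp (measurable_const.prodMk measurable_id)
    refine le_trans (le_of_eq ?_) (sq_integral_le (hb1.sub hb2) (μ j))
    rw [integral_sub (hb1.integrable _) (hb2.integrable _)]
    simp only [avgAt, Function.update_comm hjk]
  have hI : BddMeas fun z : (ι → α) × α =>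
      ∫ w, (g (Function.update z.1 j w) - g (Function.update (Function.update z.1 j w) k z.2)) ^ 2
        ∂(μ j) := (hH.comp hm3).integral_right (μ j)
  have hL : BddMeas fun z : (ι → α) × α =>
      (avgAt μ j g z.1 - avgAt μ j g (Function.update z.1 k z.2)) ^ 2 :=
    (((hg.avgAt j).comp measurable_fst).sub ((hg.avgAt j).comp hm)).sq
  calc influence μ k (avgAt μ j g)
      ≤ ∫ x, ∫ y, ∫ z, (g (Function.update x j z) -
          g (Function.update (Function.update x j z) k y)) ^ 2 ∂(μ j) ∂(μ k) ∂(Measure.pi μ) := by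
        refine integral_mono ((hL.integral_right (μ k)).integrable _)
          ((hI.integral_right (μ k)).integrable _) fun x => ?_
        exact integral_mono ((hL.comp (measurable_const.prodMk measurable_id)).integrable _)
          ((hI.comp (measurable_const.prodMk measurable_id)).integrable _) fun y => key x y
    _ = ∫ x, ∫ z, ∫ y, (g (Function.update x j z) -
          g (Function.update (Function.update x j z) k y)) ^ 2 ∂(μ k) ∂(μ j) ∂(Measure.pi μ) := by
        congr 1
        ext x
        refine integral_integral_swap (f := fun y z => (g (Function.update x j z) -
          g (Function.update (Function.update x j z) k y)) ^ 2) ?_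
        exact ((hH.comp hm3).comp
          ((measurable_const.prodMk measurable_fst).prodMk measurable_snd)).integrable _
    _ = influence μ k g :=
        integral_update μ j (g := fun x => ∫ y, (g x - g (Function.update x k y)) ^ 2 ∂(μ k))
          ((hH.integral_right (μ k)).integrable _)

/-- The telescoping behind Efron–Stein: coordinates are averaged out one at a time, each step costs
half an influence, and earlier averaging has not increased that influence. The other conjuncts are
what the induction has to carry along. -/
lemma integral_sq_sub_foldr_le (l : List ι) (hl : l.Nodup) (hg : BddMeas g) :
    BddMeas (l.foldr (avgAt μ) g) ∧
    (∀ k ∈ l, ∀ x y, l.foldr (avgAt μ) g (Function.update x k y) = l.foldr (avgAt μ) g x) ∧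
    (∀ k ∉ l, influence μ k (l.foldr (avgAt μ) g) ≤ influence μ k g) ∧
    ∫ x, l.foldr (avgAt μ) g x ∂(Measure.pi μ) = ∫ x, g x ∂(Measure.pi μ) ∧
    ∫ x, g x ^ 2 ∂(Measure.pi μ) - ∫ x, (l.foldr (avgAt μ) g x) ^ 2 ∂(Measure.pi μ) ≤
      (l.map fun k => 1 / 2 * influence μ k g).sum := by
  induction l with
  | nil => simpa using hg
  | cons j l ih =>
    obtain ⟨hjl, hl'⟩ := List.nodup_cons.1 hl
    obtain ⟨h1, h2, h3, h4, h5⟩ := ih hl'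
    simp only [List.foldr_cons, List.map_cons, List.sum_cons]
    refine ⟨h1.avgAt j, ?_, ?_, ?_, ?_⟩
    · intro k hk x y
      by_cases hkj : k = j
      · subst hkj; exact avgAt_update _ _ _
      · have hkl : k ∈ l := (List.mem_cons.1 hk).resolve_left hkj
        simp only [avgAt, Function.update_comm hkj, h2 k hkl]
    · intro k hk
      have hkj : j ≠ k := fun h => hk (by simp [h])
      exact (influence_avgAt_le h1 hkj).trans (h3 k fun h => hk (by simp [h]))
    · rw [integral_avgAt h1, h4]
    · have := integral_sq_sub_integral_avgAt_sq (μ := μ) h1 j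
      have := h3 j hjl
      linarith

/-- The Efron–Stein inequality. -/
theorem variance_pi_le_sum_influence (hg : BddMeas g) :
    variance g (Measure.pi μ) ≤ 1 / 2 * ∑ k, influence μ k g := by
  obtain ⟨-, h2, -, h4, h5⟩ := integral_sq_sub_foldr_le (μ := μ) (Finset.univ : Finset ι).toList
    (Finset.nodup_toList _) hg
  set G := (Finset.univ : Finset ι).toList.foldr (avgAt μ) g
  -- With every coordinate averaged out, `G` is constant. Its value is the mean of `g`, so the
  -- telescoped difference of second moments is the variance.
  have hconst : ∀ x x', G x = G x' := by
    intro x x'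
    have : ∀ s : Finset ι, G (s.piecewise x' x) = G x := by
      intro s
      induction s using Finset.induction_on with
      | empty => simp
      | insert k s hk ih => rw [Finset.piecewise_insert, h2 k (by simp), ih]
    rw [← this Finset.univ, Finset.piecewise_univ]
  have hne : Nonempty (ι → α) := nonempty_of_isProbabilityMeasure (Measure.pi μ)
  obtain ⟨x0⟩ := hne
  have hG : ∀ x, G x = G x0 := fun x => hconst x x0
  simp only [hG, integral_const, probReal_univ, one_smul] at h4 h5
  rw [variance_eq_sub (hg.memLp _ 2)]
  simp only [Pi.pow_apply]
  rw [← h4]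
  rw [Finset.mul_sum]
  refine h5.trans (le_of_eq ?_)
  simp

/-- Chebyshev's inequality for bounded functions. -/
lemma measureReal_abs_sub_ge_le {β : Type*} [MeasurableSpace β] {h : β → ℝ} (hh : BddMeas h)
    (P : Measure β) [IsProbabilityMeasure P] {δ : ℝ} (hδ : 0 < δ) :
    P.real {x | δ ≤ |h x - ∫ z, h z ∂P|} ≤ variance h P / δ ^ 2 := by
  have := meas_ge_le_variance_div_sq (hh.memLp P 2) hδ
  rw [measureReal_def]
  refine (ENNReal.toReal_mono ENNReal.ofReal_ne_top this).trans ?_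
  rw [ENNReal.toReal_ofReal (div_nonneg (variance_nonneg _ _) (sq_nonneg _))]

/-- Markov's inequality for bounded functions. -/
lemma measureReal_ge_le {β : Type*} [MeasurableSpace β] {h : β → ℝ} (hh : BddMeas h)
    (h0 : ∀ x, 0 ≤ h x) (P : Measure β) [IsProbabilityMeasure P] {δ : ℝ} (hδ : 0 < δ) :
    P.real {x | δ ≤ h x} ≤ (∫ x, h x ∂P) / δ := by
  rw [le_div_iff₀ hδ, mul_comm]
  exact mul_meas_ge_le_integral_of_nonneg (Eventually.of_forall h0) (hh.integrable P) δ

end Resampling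

/-! ### Asymptotic normality -/

/-- The standard normal distribution function. -/
def stdCDF (x : ℝ) : ℝ := cdf (gaussianReal 0 1) x

instance : NullSingletonClass (gaussianReal 0 1) := nullSingletonClass_gaussianReal one_ne_zero

lemma stdCDF_eq (x : ℝ) : stdCDF x = (gaussianReal 0 1).real (Set.Iic x) := cdf_eq_real _ x

lemma stdCDF_eq_Iio (x : ℝ) : stdCDF x = (gaussianReal 0 1).real (Set.Iio x) := by
  rw [stdCDF_eq]
  exact measureReal_congr Iio_ae_eq_Iic.symm

lemma one_sub_stdCDF (x : ℝ) : 1 - stdCDF x = (gaussianReal 0 1).real (Set.Ioi x) := by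
  rw [stdCDF_eq, ← probReal_compl_eq_one_sub measurableSet_Iic, Set.compl_Iic]

lemma stdCDF_neg (x : ℝ) : stdCDF (-x) = 1 - stdCDF x := by
  have h : (gaussianReal 0 1).map (fun x => -x) = gaussianReal 0 1 := by
    simpa using gaussianReal_map_neg (μ := 0) (v := 1)
  rw [one_sub_stdCDF, stdCDF_eq_Iio]
  conv_lhs => rw [← h]
  rw [map_measureReal_apply measurable_neg measurableSet_Iio]
  congr 1
  ext y
  simp

lemma stdCDF_strictMono : StrictMono stdCDF := by
  intro a b hab
  have h1 : (gaussianReal 0 1).real (Set.Ioc a b) = stdCDF b - stdCDF a := by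
    have : Set.Ioc a b = Set.Iic b \ Set.Iic a := by ext; simp [and_comm]
    rw [stdCDF_eq, stdCDF_eq, this, measureReal_sdiff (by simpa using hab.le)
      measurableSet_Iic]
  have h2 : 0 < (gaussianReal 0 1).real (Set.Ioc a b) := by
    rw [measureReal_def]
    refine ENNReal.toReal_pos ?_ (measure_ne_top _ _)
    intro h
    have := gaussianReal_absolutelyContinuous' 0 (v := 1) one_ne_zero h
    simp only [Real.volume_Ioc, ENNReal.ofReal_eq_zero] at this
    linarith
  linarith

lemma continuous_stdCDF : Continuous stdCDF := by
  have h : ∀ x, ContinuousAt stdCDF x := by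
    intro x
    have h0 : (gaussianReal 0 1) {x} = 0 := measure_singleton x
    have h1 := (cdf (gaussianReal 0 1)).measure_singleton x
    rw [measure_cdf, h0, eq_comm, ENNReal.ofReal_eq_zero] at h1
    have hm : Monotone stdCDF := monotone_cdf _
    refine hm.continuousAt_iff_leftLim_eq_rightLim.2 ?_
    have h2 : Function.rightLim stdCDF x = stdCDF x := (cdf (gaussianReal 0 1)).rightLim_eq x
    rw [h2]
    refine le_antisymm (hm.leftLim_le le_rfl) ?_
    have : stdCDF x - Function.leftLim stdCDF x ≤ 0 := h1
    linarith
  exact continuous_iff_continuousAt.2 h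

/-- Continuity provides a point `c` of value `β`, and strict monotonicity turns the set whose
infimum defines the quantile into `Set.Ici c`. -/
lemma stdCDF_normalQuantile {β : ℝ} (h0 : 0 < β) (h1 : β < 1) : stdCDF (normalQuantile β) = β := by
  have hb : Tendsto stdCDF atBot (𝓝 0) := tendsto_cdf_atBot _
  have ht : Tendsto stdCDF atTop (𝓝 1) := tendsto_cdf_atTop _
  obtain ⟨a, ha⟩ := ((tendsto_order.1 hb).2 β h0).exists
  obtain ⟨b, hb'⟩ := ((tendsto_order.1 ht).1 β h1).exists
  obtain ⟨c, -, hc⟩ := intermediate_value_uIcc (a := a) (b := b) continuous_stdCDF.continuousOn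
    (Set.mem_uIcc.2 (Or.inl ⟨ha.le, hb'.le⟩))
  have : {x : ℝ | β ≤ cdf (gaussianReal 0 1) x} = Set.Ici c := by
    ext x
    change β ≤ stdCDF x ↔ c ≤ x
    rw [← hc, stdCDF_strictMono.le_iff_le]
  rw [normalQuantile, this, csInf_Ici, hc]

lemma normalQuantile_one_sub {α : ℝ} (h0 : 0 < α) (h1 : α < 1) :
    normalQuantile (1 - α) = -normalQuantile α := by
  apply stdCDF_strictMono.injective
  rw [stdCDF_neg, stdCDF_normalQuantile h0 h1, stdCDF_normalQuantile (by linarith) (by linarith)]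

lemma normalQuantile_one_sub_pos {α : ℝ} (h0 : 0 < α) (h1 : α < 1 / 2) :
    0 < normalQuantile (1 - α) := by
  have h : stdCDF 0 = 1 / 2 := by have := stdCDF_neg 0; simp at this; linarith
  rw [← stdCDF_strictMono.lt_iff_lt, h, stdCDF_normalQuantile (by linarith) (by linarith)]
  linarith

/-! ### Convergence in law and in probability along varying probability spaces -/

section Convergence

variable {κ : Type*} {l : Filter κ} {Ω : κ → Type*} [∀ k, MeasurableSpace (Ω k)]

/-- The variables `W k` are asymptotically standard normal under the laws `P k`. -/
def AsympNormal (l : Filter κ) (P : ∀ k, Measure (Ω k)) (W : ∀ k, Ω k → ℝ) : Prop :=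
  ∀ x : ℝ, Tendsto (fun k => (P k).real {ω | x < W k ω}) l (𝓝 (1 - stdCDF x)) ∧
    Tendsto (fun k => (P k).real {ω | W k ω < x}) l (𝓝 (stdCDF x))

/-- The variables `U k` tend to the constant `c` in probability. -/
def TendstoInProb (l : Filter κ) (P : ∀ k, Measure (Ω k)) (U : ∀ k, Ω k → ℝ) (c : ℝ) : Prop :=
  ∀ δ : ℝ, 0 < δ → Tendsto (fun k => (P k).real {ω | δ ≤ |U k ω - c|}) l (𝓝 0)

variable {P : ∀ k, Measure (Ω k)} [∀ k, IsProbabilityMeasure (P k)] {W V U : ∀ k, Ω k → ℝ}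

lemma asympNormal_of_tendsto_charFun [l.IsCountablyGenerated] (hW : ∀ k, Measurable (W k))
    (h : ∀ t : ℝ, Tendsto (fun k => ∫ ω, Complex.exp (t * W k ω * Complex.I) ∂(P k)) l
      (𝓝 (Real.exp (-t ^ 2 / 2) : ℝ))) : AsympNormal l P W := by
  let ν : κ → ProbabilityMeasure ℝ := fun k =>
    ⟨(P k).map (W k), Measure.isProbabilityMeasure_map (hW k).aemeasurable⟩
  let ν₀ : ProbabilityMeasure ℝ := ⟨gaussianReal 0 1, inferInstance⟩
  -- Lévy's continuity theorem is applied along sequences, which is enough because `l` is countably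
  -- generated.
  have hν : Tendsto ν l (𝓝 ν₀) := by
    refine tendsto_of_seq_tendsto fun u hu => ?_
    refine ProbabilityMeasure.tendsto_of_tendsto_charFun fun t => ?_
    have h1 : charFun (ν₀ : Measure ℝ) t = (Real.exp (-t ^ 2 / 2) : ℝ) := by
      change charFun (gaussianReal 0 1) t = _
      rw [charFun_gaussianReal]
      push_cast
      congr 1
      simp; ring
    rw [h1]
    refine ((h t).comp hu).congr fun n => ?_
    change _ = charFun ((P (u n)).map (W (u n))) t
    rw [charFun_apply_real, integral_map (hW _).aemeasurable (by fun_prop)]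
    rfl
  intro x
  constructor
  · have := ProbabilityMeasure.tendsto_measure_of_null_frontier_of_tendsto' hν
      (E := Set.Ioi x) (by simp [ν₀])
    rw [one_sub_stdCDF]
    refine ((ENNReal.tendsto_toReal (measure_ne_top _ _)).comp this).congr fun k => ?_
    simp only [Function.comp, ν, ProbabilityMeasure.coe_mk, measureReal_def]
    rw [Measure.map_apply (hW k) measurableSet_Ioi]; rfl
  · have := ProbabilityMeasure.tendsto_measure_of_null_frontier_of_tendsto' hν
      (E := Set.Iio x) (by simp [ν₀])
    rw [stdCDF_eq_Iio]
    refine ((ENNReal.tendsto_toReal (measure_ne_top _ _)).comp this).congr fun k => ?_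
    simp only [Function.comp, ν, ProbabilityMeasure.coe_mk, measureReal_def]
    rw [Measure.map_apply (hW k) measurableSet_Iio]; rfl

/-- Up to events of vanishing probability, `A` lies between `E (x + δ)` and `E (x - δ)`, whose
limiting probabilities are both close to `F x` by continuity. -/
lemma tendsto_measureReal_of_squeeze {A : ∀ k, Set (Ω k)} {F : ℝ → ℝ} {x : ℝ}
    (hF : ContinuousAt F x) {E : ℝ → ∀ k, Set (Ω k)} (hE : ∀ y, Tendsto (fun k =>
      (P k).real (E y k)) l (𝓝 (F y)))
    (h : ∀ δ > 0, ∃ B : ∀ k, Set (Ω k), Tendsto (fun k => (P k).real (B k)) l (𝓝 0) ∧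
      ∀ᶠ k in l, E (x + δ) k ⊆ A k ∪ B k ∧ A k ⊆ E (x - δ) k ∪ B k) :
    Tendsto (fun k => (P k).real (A k)) l (𝓝 (F x)) := by
  rw [tendsto_order]
  have aux : ∀ s : ℝ, Tendsto (fun δ => F (x + s * δ)) (𝓝[>] 0) (𝓝 (F x)) := by
    intro s
    have : Tendsto (fun δ : ℝ => x + s * δ) (𝓝[>] 0) (𝓝 x) := by
      have : Tendsto (fun δ : ℝ => x + s * δ) (𝓝 0) (𝓝 (x + s * 0)) := by
        apply Continuous.tendsto; fun_prop
      simpa using this.mono_left nhdsWithin_le_nhds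
    exact hF.tendsto.comp this
  constructor
  · intro a ha
    obtain ⟨δ, hδa, hδ⟩ := (((tendsto_order.1 (aux 1)).1 a ha).and self_mem_nhdsWithin).exists
    obtain ⟨B, hB, hAB⟩ := h δ hδ
    rw [one_mul] at hδa
    have h1 := (hE (x + δ)).sub hB
    rw [sub_zero] at h1
    filter_upwards [(tendsto_order.1 h1).1 a hδa, hAB] with k hk hs
    have := (measureReal_mono (μ := P k) hs.1).trans (measureReal_union_le _ _)
    linarith
  · intro a ha
    obtain ⟨δ, hδa, hδ⟩ := (((tendsto_order.1 (aux (-1))).2 a ha).and self_mem_nhdsWithin).exists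
    obtain ⟨B, hB, hAB⟩ := h δ hδ
    have h1 := (hE (x - δ)).add hB
    rw [neg_one_mul, ← sub_eq_add_neg] at hδa
    rw [add_zero] at h1
    filter_upwards [(tendsto_order.1 h1).2 a hδa, hAB] with k hk hs
    have := (measureReal_mono (μ := P k) hs.2).trans (measureReal_union_le _ _)
    linarith

lemma AsympNormal.of_approx (h : AsympNormal l P W) (hx : ∀ x : ℝ, ∀ δ > 0,
    ∃ B : ∀ k, Set (Ω k), Tendsto (fun k => (P k).real (B k)) l (𝓝 0) ∧
      ∀ᶠ k in l, ∀ ω, ω ∉ B k →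
        (x + δ < W k ω → x < V k ω) ∧ (x < V k ω → x - δ < W k ω) ∧
        (W k ω < x - δ → V k ω < x) ∧ (V k ω < x → W k ω < x + δ)) :
    AsympNormal l P V := by
  intro x
  constructor
  · refine tendsto_measureReal_of_squeeze (F := fun y => 1 - stdCDF y)
      (E := fun y k => {ω | y < W k ω}) (by have := continuous_stdCDF; fun_prop)
      (fun y => (h y).1) fun δ hδ => ?_
    obtain ⟨B, hB, hB'⟩ := hx x δ hδ
    refine ⟨B, hB, hB'.mono fun k hk => ⟨fun ω hω => ?_, fun ω hω => ?_⟩⟩ <;>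
    · by_cases hb : ω ∈ B k
      · exact Or.inr hb
      · first | exact Or.inl ((hk ω hb).1 hω) | exact Or.inl ((hk ω hb).2.1 hω)
  -- The squeeze is formulated for events that shrink as the threshold grows, so lower tails are
  -- parametrized by the negative threshold.
  · suffices Tendsto (fun k => (P k).real {ω | V k ω < x}) l (𝓝 (stdCDF (- -x))) by
      simpa using this
    refine tendsto_measureReal_of_squeeze (F := fun y => stdCDF (-y)) (x := -x)
      (E := fun y k => {ω | W k ω < -y}) (by have := continuous_stdCDF; fun_prop)
      (fun y => (h (-y)).2) fun δ hδ => ?_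
    obtain ⟨B, hB, hB'⟩ := hx x δ hδ
    refine ⟨B, hB, hB'.mono fun k hk => ⟨fun ω hω => ?_, fun ω hω => ?_⟩⟩ <;>
    by_cases hb : ω ∈ B k
    · exact Or.inr hb
    · refine Or.inl ((hk ω hb).2.2.1 ?_)
      have : W k ω < -(-x + δ) := hω
      linarith
    · exact Or.inr hb
    · refine Or.inl ?_
      have := (hk ω hb).2.2.2 hω
      change W k ω < -(-x - δ)
      linarith

lemma AsympNormal.add_of_tendstoInProb (h : AsympNormal l P W) (hU : TendstoInProb l P U 0)
    (hV : ∀ᶠ k in l, ∀ ω, V k ω = W k ω + U k ω) : AsympNormal l P V := by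
  refine h.of_approx fun x δ hδ => ⟨_, hU δ hδ, hV.mono fun k hk ω hω => ?_⟩
  simp only [sub_zero, Set.mem_ofPred_eq, not_le, abs_lt] at hω
  rw [hk ω]
  refine ⟨fun _ => ?_, fun _ => ?_, fun _ => ?_, fun _ => ?_⟩ <;> linarith

lemma AsympNormal.mul_of_tendstoInProb (h : AsympNormal l P W) (hU : TendstoInProb l P U 1)
    (hV : ∀ᶠ k in l, ∀ ω, V k ω = W k ω * U k ω) : AsympNormal l P V := by
  refine h.of_approx fun x δ hδ => ?_
  -- If |U - 1| < η then U > 1/2, and |x / U - x| ≤ 2 |x| η ≤ δ: dividing the threshold by U moves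
  -- it by at most δ.
  set η : ℝ := min (1 / 2) (δ / (2 * |x| + 1)) with hη
  have hx0 := abs_nonneg x
  have hη0 : 0 < η := by positivity
  have hη1 : η ≤ 1 / 2 := min_le_left _ _
  have hη2 : η * (2 * |x| + 1) ≤ δ := by
    rw [← le_div_iff₀ (by positivity)]; exact min_le_right _ _
  refine ⟨_, hU η hη0, hV.mono fun k hk ω hω => ?_⟩
  simp only [Set.mem_ofPred_eq, not_le, abs_lt] at hω
  rw [hk ω]
  have hu : 1 / 2 < U k ω := by linarith
  have hu0 : 0 < U k ω := by linarith
  have hxu : |x / U k ω - x| ≤ δ := by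
    have : x / U k ω - x = x * (1 - U k ω) / U k ω := by field_simp
    rw [this, abs_div, abs_mul, abs_of_pos hu0, div_le_iff₀ hu0]
    have h1 : |1 - U k ω| ≤ η := by rw [abs_le]; constructor <;> linarith
    nlinarith [mul_le_mul_of_nonneg_left h1 hx0]
  rw [abs_le] at hxu
  have e1 : x < W k ω * U k ω ↔ x / U k ω < W k ω := (div_lt_iff₀ hu0).symm
  have e2 : W k ω * U k ω < x ↔ W k ω < x / U k ω := (lt_div_iff₀ hu0).symm
  rw [e1, e2]
  refine ⟨fun _ => ?_, fun _ => ?_, fun _ => ?_, fun _ => ?_⟩ <;> linarith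

/-- The asymptotic upper tail of a variable that is at least `c₀` times a standard normal one. -/
lemma AsympNormal.eventually_le_tail (h : AsympNormal l P W) {c : κ → ℝ} {c₀ : ℝ} (hc₀ : 0 < c₀)
    (hc : ∀ᶠ k in l, c₀ ≤ c k) (hV : ∀ᶠ k in l, ∀ ω, V k ω = c k * W k ω) {x : ℝ} (hx : 0 < x)
    {δ : ℝ} (hδ : 0 < δ) :
    (∀ᶠ k in l, 1 - stdCDF (x / c₀) - δ ≤ (P k).real {ω | x < V k ω}) ∧
    (∀ᶠ k in l, 1 - stdCDF (x / c₀) - δ ≤ (P k).real {ω | V k ω < -x}) := by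
  constructor
  · have h1 := (tendsto_order.1 (h (x / c₀)).1).1 (1 - stdCDF (x / c₀) - δ) (by linarith)
    filter_upwards [h1, hc, hV] with k hk hck hVk
    refine hk.le.trans (measureReal_mono fun ω hω => ?_)
    simp only [Set.mem_ofPred_eq, div_lt_iff₀ hc₀] at hω ⊢
    rw [hVk]
    have : 0 < W k ω := by
      by_contra hn
      nlinarith
    nlinarith
  · have h1 := (tendsto_order.1 (h (-(x / c₀))).2).1 (1 - stdCDF (x / c₀) - δ)
      (by rw [stdCDF_neg]; linarith)
    filter_upwards [h1, hc, hV] with k hk hck hVk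
    refine hk.le.trans (measureReal_mono fun ω hω => ?_)
    have hω' : x / c₀ < -W k ω := by simp only [Set.mem_ofPred_eq] at hω; linarith
    simp only [Set.mem_ofPred_eq, div_lt_iff₀ hc₀] at hω' ⊢
    rw [hVk]
    have : 0 < -W k ω := by
      by_contra hn
      nlinarith
    nlinarith

/-- A test based on an asymptotically standard normal statistic has asymptotic level `α`. -/
lemma AsympNormal.tendsto_reject {S : Table → ℝ} {T : ∀ k, Ω k → Table}
    (h : AsympNormal l P fun k ω => S (T k ω)) {α : ℝ} (h0 : 0 < α) (h1 : α < 1) :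
    Tendsto (fun k => (P k).real {ω | T k ω ∈ rejectSeg S α}) l (𝓝 α) ∧
    Tendsto (fun k => (P k).real {ω | T k ω ∈ rejectAssoc S α}) l (𝓝 α) := by
  have a := (h (normalQuantile (1 - α))).1
  have b := (h (normalQuantile α)).2
  rw [stdCDF_normalQuantile (by linarith) (by linarith), sub_sub_cancel] at a
  rw [stdCDF_normalQuantile (by linarith) (by linarith)] at b
  exact ⟨a, b⟩

lemma tendstoInProb_of_tendsto_integral (hb : ∀ k, BddMeas fun ω => |U k ω|) {c : ℝ}
    (hc : c = 0)
    (h : Tendsto (fun k => ∫ ω, |U k ω| ∂(P k)) l (𝓝 0)) : TendstoInProb l P U c := by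
  subst hc
  intro δ hδ
  have h1 : Tendsto (fun k => (∫ ω, |U k ω| ∂(P k)) / δ) l (𝓝 0) := by
    simpa using h.div_const δ
  refine squeeze_zero (fun k => measureReal_nonneg) (fun k => ?_) h1
  simpa using measureReal_ge_le (hb k) (fun ω => abs_nonneg _) (P k) hδ

lemma tendstoInProb_of_sq (hb : ∀ k, BddMeas (U k)) {c : ℝ} {v : κ → ℝ}
    (h : ∀ k, ∫ ω, (U k ω - c) ^ 2 ∂(P k) ≤ v k) (hv : Tendsto v l (𝓝 0)) :
    TendstoInProb l P U c := by
  intro δ hδ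
  have h1 : Tendsto (fun k => v k / δ ^ 2) l (𝓝 0) := by simpa using hv.div_const (δ ^ 2)
  refine squeeze_zero (fun k => measureReal_nonneg) (fun k => ?_) h1
  have hs : BddMeas fun ω => (U k ω - c) ^ 2 :=
    ((hb k).sub ⟨measurable_const, |c|, fun _ => le_rfl⟩).sq
  have := measureReal_ge_le hs (fun ω => sq_nonneg _) (P k) (sq_pos_of_pos hδ)
  refine le_trans (measureReal_mono fun ω hω => ?_) (this.trans ?_)
  · simp only [Set.mem_ofPred_eq] at hω ⊢
    exact sq_le_sq' (by linarith [abs_nonneg (U k ω - c)]) hω |>.trans (sq_abs _).le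
  · gcongr; exact h k

lemma TendstoInProb.comp_continuousAt (hU : TendstoInProb l P U a) {g : ℝ → ℝ}
    (hg : ContinuousAt g a) : TendstoInProb l P (fun k ω => g (U k ω)) (g a) := by
  intro δ hδ
  obtain ⟨η, hη, h⟩ := Metric.continuousAt_iff.1 hg δ hδ
  refine squeeze_zero (fun k => measureReal_nonneg) (fun k => measureReal_mono fun ω hω => ?_)
    (hU η hη)
  simp only [Set.mem_ofPred_eq] at hω ⊢
  by_contra hn
  exact absurd (h (x := U k ω) (by rw [Real.dist_eq]; exact not_le.1 hn))
    (by rw [Real.dist_eq]; exact not_lt.2 hω)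

lemma TendstoInProb.mul_one (hU : TendstoInProb l P U 1) (hV : TendstoInProb l P V 1) :
    TendstoInProb l P (fun k ω => U k ω * V k ω) 1 := by
  intro δ hδ
  set η : ℝ := min 1 (δ / 3) with hη
  have hη0 : 0 < η := by positivity
  have hη1 : η ≤ 1 := min_le_left _ _
  have hη2 : η ≤ δ / 3 := min_le_right _ _
  have h1 := (hU η hη0).add (hV η hη0)
  rw [add_zero] at h1
  refine squeeze_zero (fun k => measureReal_nonneg) (fun k => ?_) h1
  refine le_trans (measureReal_mono fun ω hω => ?_) (measureReal_union_le _ _)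
  by_contra hn
  simp only [Set.mem_union, Set.mem_ofPred_eq, not_or, not_le] at hn hω
  have e : U k ω * V k ω - 1 = (U k ω - 1) * (V k ω - 1) + (U k ω - 1) + (V k ω - 1) := by ring
  have h2 : |(U k ω - 1) * (V k ω - 1)| ≤ η := by
    rw [abs_mul]
    nlinarith [abs_nonneg (U k ω - 1), abs_nonneg (V k ω - 1)]
  rw [e] at hω
  have := (abs_add_le ((U k ω - 1) * (V k ω - 1) + (U k ω - 1)) (V k ω - 1))
  have := (abs_add_le ((U k ω - 1) * (V k ω - 1)) (U k ω - 1))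
  linarith [hn.1, hn.2]

end Convergence

/-! ### A central limit theorem for multilinear statistics of independent variables -/

lemma norm_cexp_mul_I_sub_one_le (u : ℝ) : ‖Complex.exp (u * Complex.I) - 1‖ ≤ |u| := by
  have := Real.norm_exp_I_mul_ofReal_sub_one_le (x := u)
  rwa [mul_comm, Real.norm_eq_abs] at this

/-- Mean value inequality on [-|u|, |u|], where the derivative is bounded by |u| according to the
first order estimate. The optimal factor 1/2 is not needed. -/
lemma norm_cexp_mul_I_sub_one_sub_le (u : ℝ) :
    ‖Complex.exp (u * Complex.I) - 1 - u * Complex.I‖ ≤ u ^ 2 := by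
  have h : ∀ x ∈ Set.Icc (-|u|) |u|, HasDerivWithinAt
      (fun x : ℝ => Complex.exp (x * Complex.I) - 1 - x * Complex.I)
      (Complex.exp (x * Complex.I) * Complex.I - Complex.I) (Set.Icc (-|u|) |u|) x := by
    intro x _
    have h1 : HasDerivAt (fun x : ℝ => (x : ℂ) * Complex.I) Complex.I x := by
      simpa using (Complex.ofRealCLM.hasDerivAt (x := x)).mul_const Complex.I
    exact ((h1.cexp.sub_const 1).sub h1).hasDerivWithinAt
  have hb : ∀ x ∈ Set.Icc (-|u|) |u|,
      ‖Complex.exp (x * Complex.I) * Complex.I - Complex.I‖ ≤ |u| := by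
    intro x hx
    rw [← sub_one_mul, norm_mul, Complex.norm_I, mul_one]
    exact (norm_cexp_mul_I_sub_one_le x).trans (abs_le.2 hx)
  have := (convex_Icc (-|u|) |u|).norm_image_sub_le_of_norm_hasDerivWithin_le h hb
    (x := 0) (y := u) (by simp) ⟨neg_abs_le u, le_abs_self u⟩
  simpa [← pow_two] using this

/-! ### Stability of the differential equation of the normal characteristic function -/

section ODE

variable {Ω : Type*} [MeasurableSpace Ω] (P : Measure Ω) [IsProbabilityMeasure P]

/-- The characteristic function of the variable `W`. -/
def charFn (W : Ω → ℝ) (s : ℝ) : ℂ := ∫ ω, Complex.exp (s * W ω * Complex.I) ∂P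

variable {P}

lemma norm_cexp_real_mul_I (a b : ℝ) : ‖Complex.exp (a * b * Complex.I)‖ = 1 := by
  rw [← Complex.ofReal_mul, Complex.norm_exp_ofReal_mul_I]

lemma hasDerivAt_charFn {W : Ω → ℝ} (hW : BddMeas W) (s : ℝ) :
    HasDerivAt (charFn P W)
      (Complex.I * ∫ ω, W ω * Complex.exp (s * W ω * Complex.I) ∂P) s := by
  obtain ⟨C, hC⟩ := hW.2
  have hm := hW.1
  have hd : ∀ (ω : Ω) (x : ℝ), HasDerivAt (fun x : ℝ => Complex.exp (x * W ω * Complex.I))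
      (Complex.I * (W ω * Complex.exp (x * W ω * Complex.I))) x := by
    intro ω x
    have h1 : HasDerivAt (fun x : ℝ => (x : ℂ) * W ω * Complex.I) (1 * W ω * Complex.I) x := by
      simpa using ((Complex.ofRealCLM.hasDerivAt (x := x)).mul_const (W ω : ℂ)).mul_const Complex.I
    convert h1.cexp using 1
    ring
  have hmeas : ∀ x : ℝ, Measurable fun ω => Complex.exp (x * W ω * Complex.I) := fun x => by
    fun_prop
  rw [← integral_const_mul]
  refine (hasDerivAt_integral_of_dominated_loc_of_deriv_le (bound := fun _ => C)
    (Metric.ball_mem_nhds s zero_lt_one) (Eventually.of_forall fun x =>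
      (hmeas x).aestronglyMeasurable) ?_ ?_ ?_ (integrable_const _)
    (Eventually.of_forall fun ω x _ => hd ω x)).2
  · exact Integrable.of_bound (hmeas s).aestronglyMeasurable 1
      (Eventually.of_forall fun ω => (norm_cexp_real_mul_I _ _).le)
  · exact Measurable.aestronglyMeasurable (by fun_prop)
  · refine Eventually.of_forall fun ω x _ => ?_
    rw [norm_mul, norm_mul, Complex.norm_I, norm_cexp_real_mul_I, one_mul, mul_one,
      Complex.norm_real]
    exact hC ω

/-- An approximate solution of the differential equation `φ' = -t φ` of the normal characteristic
function is close to it. -/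
lemma norm_charFn_sub_le {W : Ω → ℝ} (hW : BddMeas W) {a b : ℝ} (ha : 0 ≤ a) (hb : 0 ≤ b)
    (h : ∀ s : ℝ, ‖∫ ω, W ω * Complex.exp (s * W ω * Complex.I) ∂P - s * charFn P W s * Complex.I‖
      ≤ a * |s| + b * s ^ 2) (t : ℝ) :
    ‖charFn P W t - (Real.exp (-t ^ 2 / 2) : ℝ)‖ ≤ (a * |t| + b * t ^ 2) * |t| := by
  -- Integrating factor: the derivative of `ψ` contains only the error in the differential equation.
  -- The mean value inequality bounds ψ(t) - ψ(0), and the factor exp(t²/2) cancels at the end.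
  set ψ : ℝ → ℂ := fun s => charFn P W s * (Real.exp (s ^ 2 / 2) : ℝ) with hψ
  have hd : ∀ s ∈ Set.Icc (-|t|) |t|, HasDerivWithinAt ψ
      (Complex.I * (∫ ω, W ω * Complex.exp (s * W ω * Complex.I) ∂P
        - s * charFn P W s * Complex.I) * (Real.exp (s ^ 2 / 2) : ℝ)) (Set.Icc (-|t|) |t|) s := by
    intro s _
    have h1 : HasDerivAt (fun s : ℝ => Real.exp (s ^ 2 / 2)) (Real.exp (s ^ 2 / 2) * s) s := by
      have : HasDerivAt (fun s : ℝ => s ^ 2 / 2) s s := by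
        simpa using (hasDerivAt_pow 2 s).div_const 2
      exact this.exp
    have h2 := (hasDerivAt_charFn (P := P) hW s).mul h1.ofReal_comp
    refine (h2.congr_deriv ?_).hasDerivWithinAt
    push_cast
    linear_combination (s * charFn P W s * Complex.exp (s ^ 2 / 2)) * Complex.I_sq
  have hbd : ∀ s ∈ Set.Icc (-|t|) |t|,
      ‖Complex.I * (∫ ω, W ω * Complex.exp (s * W ω * Complex.I) ∂P
        - s * charFn P W s * Complex.I) * (Real.exp (s ^ 2 / 2) : ℝ)‖ ≤
      (a * |t| + b * t ^ 2) * Real.exp (t ^ 2 / 2) := by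
    intro s hs
    have hst : |s| ≤ |t| := abs_le.2 hs
    have hst2 : s ^ 2 ≤ t ^ 2 := sq_le_sq.2 hst
    rw [norm_mul, norm_mul, Complex.norm_I, one_mul, Complex.norm_real, Real.norm_eq_abs,
      Real.abs_exp]
    refine mul_le_mul ((h s).trans ?_) (Real.exp_le_exp.2 (by linarith)) (Real.exp_pos _).le
      (by positivity)
    gcongr
  have := (convex_Icc (-|t|) |t|).norm_image_sub_le_of_norm_hasDerivWithin_le hd hbd
    (x := 0) (y := t) (by simp) ⟨neg_abs_le t, le_abs_self t⟩
  have h0 : ψ 0 = 1 := by simp [hψ, charFn]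
  rw [h0, sub_zero, Real.norm_eq_abs] at this
  have he : charFn P W t - (Real.exp (-t ^ 2 / 2) : ℝ) =
      (ψ t - 1) * (Real.exp (-t ^ 2 / 2) : ℝ) := by
    have : (Real.exp (t ^ 2 / 2) : ℂ) * (Real.exp (-t ^ 2 / 2) : ℝ) = 1 := by
      rw [← Complex.ofReal_mul, ← Real.exp_add]
      simp [neg_div]
    simp only [hψ]
    rw [sub_mul, mul_assoc, this, mul_one, one_mul]
  rw [he, norm_mul, Complex.norm_real, Real.norm_eq_abs, Real.abs_exp]
  calc ‖ψ t - 1‖ * Real.exp (-t ^ 2 / 2)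
      ≤ ((a * |t| + b * t ^ 2) * Real.exp (t ^ 2 / 2) * |t|) * Real.exp (-t ^ 2 / 2) := by gcongr
    _ = (a * |t| + b * t ^ 2) * |t| * (Real.exp (t ^ 2 / 2) * Real.exp (-t ^ 2 / 2)) := by ring
    _ = (a * |t| + b * t ^ 2) * |t| := by
      rw [← Real.exp_add]; simp [neg_div]

end ODE

/-! ### Stein-type estimates, one coordinate at a time -/

section CLT

variable {ι α : Type*} [Fintype ι] [DecidableEq ι] [MeasurableSpace α] [Finite α]
  [MeasurableSingletonClass α] {μ : ι → Measure α} [∀ i, IsProbabilityMeasure (μ i)]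

lemma integral_coord_mul (k : ι) (F : α → ℝ) {B : (ι → α) → ℂ}
    (hB : ∀ x y, B (Function.update x k y) = B x) :
    ∫ x, (F (x k) : ℂ) * B x ∂(Measure.pi μ) = (∫ y, F y ∂(μ k) : ℝ) * ∫ x, B x ∂(Measure.pi μ) := by
  rw [← integral_update μ k Integrable.of_finite]
  simp_rw [Function.update_self, hB]
  rw [← integral_const_mul]
  congr 1
  ext x
  rw [integral_mul_const, integral_complex_ofReal]

variable {Y : ι → α → ℝ} {L : ι → (ι → α) → ℝ} {W : (ι → α) → ℝ} {c η ε : ℝ}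

/-- Write D = Y_k L_k. Since W - D and L_k do not involve coordinate k, centring of Y_k kills the
zeroth order term of the expansion of exp(isD), and the first order term produces the conditional
second moment of D. The second order remainder and the replacement of exp(is(W - D)) by exp(isW)
cost η s² E[D²] each. -/
lemma norm_integral_mul_cexp_sub_le (k : ι) (hL : ∀ x y, L k (Function.update x k y) = L k x)
    (hW : ∀ x y, W (Function.update x k y) - Y k y * L k x = W x - Y k (x k) * L k x)
    (hY0 : ∫ y, Y k y ∂(μ k) = 0) (hη : ∀ x, |Y k (x k) * L k x| ≤ η) (s : ℝ) :
    ‖∫ x, (Y k (x k) * L k x : ℝ) * Complex.exp (s * W x * Complex.I) ∂(Measure.pi μ) -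
      s * Complex.I * ∫ x, ((∫ y, Y k y ^ 2 ∂(μ k)) * L k x ^ 2 : ℝ) *
        Complex.exp (s * W x * Complex.I) ∂(Measure.pi μ)‖ ≤
      2 * η * s ^ 2 * ∫ x, (∫ y, Y k y ^ 2 ∂(μ k)) * L k x ^ 2 ∂(Measure.pi μ) := by
  set v := ∫ y, Y k y ^ 2 ∂(μ k) with hv
  have hv0 : 0 ≤ v := integral_nonneg fun y => sq_nonneg _
  set D : (ι → α) → ℝ := fun x => Y k (x k) * L k x with hD
  set e : (ι → α) → ℂ := fun x => Complex.exp (s * (W x - D x : ℝ) * Complex.I) with he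
  have heinv : ∀ x y, e (Function.update x k y) = e x := by
    intro x y
    simp only [he, hD, Function.update_self, hL, hW]
  have hen : ∀ x, ‖e x‖ = 1 := fun x => norm_cexp_real_mul_I _ _
  have hexp : ∀ x, Complex.exp (s * W x * Complex.I) =
      e x * Complex.exp ((s * D x : ℝ) * Complex.I) := by
    intro x
    rw [he, ← Complex.exp_add]
    congr 1
    push_cast
    ring
  have h1 : ∫ x, (D x : ℂ) * e x ∂(Measure.pi μ) = 0 := by
    have := integral_coord_mul (μ := μ) k (Y k) (B := fun x => L k x * e x)
      (fun x y => by rw [hL, heinv])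
    rw [hY0] at this
    simp only [Complex.ofReal_zero, zero_mul] at this
    rw [← this]
    congr 1
    ext x
    simp only [hD]
    push_cast
    ring
  have h2 : ∫ x, (D x : ℂ) ^ 2 * e x ∂(Measure.pi μ) =
      ∫ x, (v * L k x ^ 2 : ℝ) * e x ∂(Measure.pi μ) := by
    have := integral_coord_mul (μ := μ) k (fun y => Y k y ^ 2) (B := fun x => L k x ^ 2 * e x)
      (fun x y => by rw [hL, heinv])
    rw [← hv, ← integral_const_mul] at this
    refine Eq.trans ?_ (this.trans ?_) <;>
    · refine integral_congr_ae (Eventually.of_forall fun x => ?_)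
      simp only [hD]
      push_cast
      ring
  have h3 : ∫ x, (D x) ^ 2 ∂(Measure.pi μ) = ∫ x, v * L k x ^ 2 ∂(Measure.pi μ) := by
    have := integral_coord_mul (μ := μ) k (fun y => Y k y ^ 2)
      (B := fun x => ((L k x ^ 2 : ℝ) : ℂ)) (fun x y => by rw [hL])
    rw [← hv, ← integral_const_mul] at this
    have h4 : ∀ f : (ι → α) → ℝ, ((∫ x, f x ∂(Measure.pi μ) : ℝ) : ℂ) =
        ∫ x, (f x : ℂ) ∂(Measure.pi μ) := fun f => integral_ofReal.symm
    have h5 : ((∫ x, (D x) ^ 2 ∂(Measure.pi μ) : ℝ) : ℂ) =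
        ((∫ x, v * L k x ^ 2 ∂(Measure.pi μ) : ℝ) : ℂ) := by
      rw [h4, h4]
      refine Eq.trans ?_ (this.trans ?_) <;>
      · refine integral_congr_ae (Eventually.of_forall fun x => ?_)
        simp only [hD]
        push_cast
        ring
    exact_mod_cast h5
  have h6 : ∫ x, (D x : ℂ) * Complex.exp (s * W x * Complex.I) ∂(Measure.pi μ) -
      s * Complex.I * ∫ x, (v * L k x ^ 2 : ℝ) * Complex.exp (s * W x * Complex.I) ∂(Measure.pi μ)
      -- The subtracted terms integrate to 0 (`h1`) and to is times the conditional second moment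
      -- (`h2`), so only the two remainders are left.
      = ∫ x, e x * (D x * (Complex.exp ((s * D x : ℝ) * Complex.I) - 1 -
          (s * D x : ℝ) * Complex.I)) ∂(Measure.pi μ) -
        ∫ x, s * Complex.I * ((v * L k x ^ 2 : ℝ) *
          (e x * (Complex.exp ((s * D x : ℝ) * Complex.I) - 1))) ∂(Measure.pi μ) := by
    have e1 : ∀ x, e x * (D x * (Complex.exp ((s * D x : ℝ) * Complex.I) - 1 -
          (s * D x : ℝ) * Complex.I)) = D x * Complex.exp (s * W x * Complex.I) - D x * e x -
          s * Complex.I * ((D x : ℂ) ^ 2 * e x) := by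
      intro x; rw [hexp]; push_cast; ring
    have e2 : ∀ x, s * Complex.I * ((v * L k x ^ 2 : ℝ) *
          (e x * (Complex.exp ((s * D x : ℝ) * Complex.I) - 1))) =
        s * Complex.I * ((v * L k x ^ 2 : ℝ) * Complex.exp (s * W x * Complex.I)) -
        s * Complex.I * ((v * L k x ^ 2 : ℝ) * e x) := by
      intro x; rw [hexp]; ring
    simp_rw [e1, e2]
    rw [integral_sub Integrable.of_finite Integrable.of_finite,
      integral_sub Integrable.of_finite Integrable.of_finite,
      integral_sub Integrable.of_finite Integrable.of_finite, h1,
      integral_const_mul, integral_const_mul, integral_const_mul, h2]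
    ring
  rw [h6]
  have hD2 : ∀ x, |D x| ≤ η := hη
  have b1 : ‖∫ x, e x * (D x * (Complex.exp ((s * D x : ℝ) * Complex.I) - 1 -
          (s * D x : ℝ) * Complex.I)) ∂(Measure.pi μ)‖ ≤
      ∫ x, η * s ^ 2 * D x ^ 2 ∂(Measure.pi μ) := by
    refine norm_integral_le_of_norm_le Integrable.of_finite (Eventually.of_forall fun x => ?_)
    rw [norm_mul, norm_mul, hen, one_mul, Complex.norm_real, Real.norm_eq_abs]
    calc |D x| * _ ≤ η * (s * D x) ^ 2 := by
          refine mul_le_mul (hD2 x) (norm_cexp_mul_I_sub_one_sub_le _) (norm_nonneg _) ?_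
          exact (abs_nonneg _).trans (hD2 x)
      _ = η * s ^ 2 * D x ^ 2 := by ring
  have b2 : ‖∫ x, s * Complex.I * ((v * L k x ^ 2 : ℝ) *
          (e x * (Complex.exp ((s * D x : ℝ) * Complex.I) - 1))) ∂(Measure.pi μ)‖ ≤
      ∫ x, η * s ^ 2 * (v * L k x ^ 2) ∂(Measure.pi μ) := by
    refine norm_integral_le_of_norm_le Integrable.of_finite (Eventually.of_forall fun x => ?_)
    rw [norm_mul, norm_mul, norm_mul, norm_mul, hen, one_mul, Complex.norm_real, Complex.norm_real,
      Complex.norm_I, mul_one, Real.norm_eq_abs, Real.norm_eq_abs,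
      abs_of_nonneg (by positivity : 0 ≤ v * L k x ^ 2)]
    have := norm_cexp_mul_I_sub_one_le (s * D x)
    rw [abs_mul] at this
    have h7 : |s| * |D x| ≤ |s| * η := by gcongr; exact hD2 x
    calc |s| * (v * L k x ^ 2 * _) ≤ |s| * (v * L k x ^ 2 * (|s| * η)) := by
          gcongr; exact this.trans h7
      _ = η * s ^ 2 * (v * L k x ^ 2) := by rw [← sq_abs s]; ring
  rw [integral_const_mul, h3] at b1
  rw [integral_const_mul (η * s ^ 2)] at b2
  refine (norm_sub_le _ _).trans ((add_le_add b1 b2).trans (le_of_eq ?_))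
  ring

/-- Quantitative normal approximation for a statistic `W` that is affine in each coordinate, with
slopes `L k`, and satisfies `c W = ∑ Y k L k`. -/
theorem norm_charFn_sub_le_of_multilinear (hc : 1 ≤ c) (hη0 : 0 ≤ η) (hε0 : 0 ≤ ε)
    (hL : ∀ k x y, L k (Function.update x k y) = L k x)
    (hW : ∀ k x y, W (Function.update x k y) - Y k y * L k x = W x - Y k (x k) * L k x)
    (hsum : ∀ x, c * W x = ∑ k, Y k (x k) * L k x)
    (hY0 : ∀ k, ∫ y, Y k y ∂(μ k) = 0) (hη : ∀ k x, |Y k (x k) * L k x| ≤ η)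
    (hV : ∫ x, |(∑ k, (∫ y, Y k y ^ 2 ∂(μ k)) * L k x ^ 2) - c| ∂(Measure.pi μ) ≤ ε) (t : ℝ) :
    ‖charFn (Measure.pi μ) W t - (Real.exp (-t ^ 2 / 2) : ℝ)‖ ≤
      (ε * |t| + 2 * η * (1 + ε) * t ^ 2) * |t| := by
  refine norm_charFn_sub_le (BddMeas.of_finite W) hε0 (by positivity) (fun s => ?_) t
  set v : ι → ℝ := fun k => ∫ y, Y k y ^ 2 ∂(μ k) with hv
  set V : (ι → α) → ℝ := fun x => ∑ k, v k * L k x ^ 2 with hVdef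
  -- The mean of V is at most c plus the mean of |V - c|; this controls the sum of the errors of the
  -- single coordinates.
  have hEV : ∑ k, ∫ x, v k * L k x ^ 2 ∂(Measure.pi μ) ≤ c + ε := by
    rw [← integral_finsetSum _ fun k _ => Integrable.of_finite]
    have : ∫ x, V x ∂(Measure.pi μ) ≤ ∫ x, (c + |V x - c|) ∂(Measure.pi μ) :=
      integral_mono Integrable.of_finite Integrable.of_finite fun x => by
        have := le_abs_self (V x - c)
        change V x ≤ c + |V x - c|
        linarith
    rw [integral_add Integrable.of_finite Integrable.of_finite, integral_const, probReal_univ,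
      one_smul] at this
    exact this.trans (by linarith)
  -- Since c W is the sum of the Y_k L_k, the error in the differential equation is the sum of the
  -- one-coordinate errors plus the effect of replacing the random V by the constant c.
  have h1 : (c : ℂ) * (∫ x, W x * Complex.exp (s * W x * Complex.I) ∂(Measure.pi μ) -
        s * charFn (Measure.pi μ) W s * Complex.I) =
      ∑ k, (∫ x, (Y k (x k) * L k x : ℝ) * Complex.exp (s * W x * Complex.I) ∂(Measure.pi μ) -
        s * Complex.I * ∫ x, (v k * L k x ^ 2 : ℝ) *
          Complex.exp (s * W x * Complex.I) ∂(Measure.pi μ)) +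
      ∫ x, s * Complex.I * ((V x - c : ℝ) * Complex.exp (s * W x * Complex.I))
        ∂(Measure.pi μ) := by
    rw [Finset.sum_sub_distrib, ← Finset.mul_sum,
      ← integral_finsetSum _ fun k _ => Integrable.of_finite,
      ← integral_finsetSum _ fun k _ => Integrable.of_finite]
    simp_rw [← Finset.sum_mul, ← Complex.ofReal_sum, ← hsum]
    rw [charFn]
    simp_rw [Complex.ofReal_sub, sub_mul, mul_sub]
    rw [integral_sub Integrable.of_finite Integrable.of_finite]
    simp_rw [Complex.ofReal_mul, mul_assoc, integral_const_mul]
    ring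
  have h2 : ‖∫ x, s * Complex.I * ((V x - c : ℝ) * Complex.exp (s * W x * Complex.I))
        ∂(Measure.pi μ)‖ ≤ |s| * ε := by
    have : ‖∫ x, s * Complex.I * ((V x - c : ℝ) * Complex.exp (s * W x * Complex.I))
        ∂(Measure.pi μ)‖ ≤ ∫ x, |s| * |V x - c| ∂(Measure.pi μ) := by
      refine norm_integral_le_of_norm_le Integrable.of_finite (Eventually.of_forall fun x => ?_)
      rw [norm_mul, norm_mul, norm_mul, norm_cexp_real_mul_I, Complex.norm_I, Complex.norm_real,
        Complex.norm_real, mul_one, mul_one, Real.norm_eq_abs, Real.norm_eq_abs]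
    rw [integral_const_mul |s|] at this
    exact this.trans (by gcongr)
  have h3 : c * ‖∫ x, W x * Complex.exp (s * W x * Complex.I) ∂(Measure.pi μ) -
        s * charFn (Measure.pi μ) W s * Complex.I‖ ≤ 2 * η * s ^ 2 * (c + ε) + |s| * ε := by
    have hcn : ‖(c : ℂ)‖ = c := by
      rw [Complex.norm_real, Real.norm_eq_abs, abs_of_nonneg (by linarith)]
    nth_rewrite 1 [← hcn]
    rw [← norm_mul, h1]
    refine (norm_add_le _ _).trans (add_le_add ((norm_sum_le _ _).trans ?_) h2)
    refine (Finset.sum_le_sum fun k _ => norm_integral_mul_cexp_sub_le (μ := μ) k (hL k) (hW k)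
      (hY0 k) (hη k) s).trans ?_
    rw [← Finset.mul_sum]
    gcongr
  have h4 : 2 * η * s ^ 2 * (c + ε) + |s| * ε ≤ c * (ε * |s| + 2 * η * (1 + ε) * s ^ 2) := by
    -- Dividing by c ≥ 1 only improves the terms that do not carry a factor c.
    have h5 : 0 ≤ (c - 1) * (ε * |s|) := mul_nonneg (by linarith) (by positivity)
    have h6 : 0 ≤ (c - 1) * (2 * η * ε * s ^ 2) := mul_nonneg (by linarith) (by positivity)
    nlinarith
  exact le_of_mul_le_mul_left (h3.trans h4) (by linarith)

/-- The central limit theorem for sums of small independent variables, quantitatively. -/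
theorem norm_charFn_sum_sub_le (hη0 : 0 ≤ η) (hY0 : ∀ k, ∫ y, Y k y ∂(μ k) = 0)
    (hη : ∀ k y, |Y k y| ≤ η) (hV : ∑ k, ∫ y, Y k y ^ 2 ∂(μ k) = 1) (t : ℝ) :
    ‖charFn (Measure.pi μ) (fun x => ∑ k, Y k (x k)) t - (Real.exp (-t ^ 2 / 2) : ℝ)‖ ≤
      2 * η * t ^ 2 * |t| := by
  have := norm_charFn_sub_le_of_multilinear (μ := μ) (Y := Y) (L := fun _ _ => 1)
    (W := fun x => ∑ k, Y k (x k)) (c := 1) (η := η) (ε := 0) le_rfl hη0 le_rfl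
    (fun _ _ _ => rfl) (fun k x y => ?_) (fun x => by simp) hY0 (fun k x => by simpa using hη k _)
    (by simp [hV]) t
  · refine this.trans (le_of_eq ?_)
    ring
  · rw [← Finset.add_sum_erase _ _ (Finset.mem_univ k),
      ← Finset.add_sum_erase _ (fun i => Y i (x i)) (Finset.mem_univ k), Function.update_self]
    have : ∑ i ∈ Finset.univ.erase k, Y i (Function.update x k y i) =
        ∑ i ∈ Finset.univ.erase k, Y i (x i) :=
      Finset.sum_congr rfl fun i hi => by rw [Function.update_of_ne (Finset.ne_of_mem_erase hi)]
    rw [this]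
    ring

end CLT

/-! ### Contingency tables -/

namespace Table

variable (N : Table)

lemma rowSum_eq (i : Fin 2) : (N.rowSum i : ℝ) = N i 0 + N i 1 := by
  simp [rowSum, Fin.sum_univ_two]

lemma colSum_eq (j : Fin 2) : (N.colSum j : ℝ) = N 0 j + N 1 j := by
  simp [colSum, Fin.sum_univ_two]

lemma total_eq : (N.total : ℝ) = N.rowSum 0 + N.rowSum 1 := by
  simp [total, rowSum, Fin.sum_univ_two]

lemma total_eq_colSum : (N.total : ℝ) = N.colSum 0 + N.colSum 1 := by
  simp [total, colSum, Fin.sum_univ_two]; ring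

lemma diffT_eq (h0 : N.rowSum 0 ≠ 0) (h1 : N.rowSum 1 ≠ 0) :
    N.diffT = ((N 0 0 : ℝ) - N.rowSum 0 * N.colSum 0 / N.total) *
      (N.total / (N.rowSum 0 * N.rowSum 1)) := by
  have a : (N.rowSum 0 : ℝ) ≠ 0 := by exact_mod_cast h0
  have b : (N.rowSum 1 : ℝ) ≠ 0 := by exact_mod_cast h1
  have c : (N.rowSum 0 : ℝ) + N.rowSum 1 ≠ 0 := by positivity
  rw [diffT, total_eq, colSum_eq]
  field_simp
  rw [rowSum_eq, rowSum_eq]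
  ring

/-- By `diffT_eq` the two numerators differ by the factor n / (n₁ n₂), which is exactly the
discrepancy between the two roots. -/
lemma pielouZtilde_eq_pielouZ : pielouZtilde = pielouZ := by
  funext N
  by_cases h0 : N.rowSum 0 = 0
  · simp [pielouZ, pielouZtilde, h0]
  by_cases h1 : N.rowSum 1 = 0
  · simp [pielouZ, pielouZtilde, h1]
  have a : (0 : ℝ) < N.rowSum 0 := by exact_mod_cast Nat.pos_of_ne_zero h0
  have b : (0 : ℝ) < N.rowSum 1 := by exact_mod_cast Nat.pos_of_ne_zero h1
  have c : (0 : ℝ) < N.total := by rw [total_eq]; positivity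
  change _ = N.diffT * _
  rw [diffT_eq N h0 h1, pielouZtilde,
    mul_assoc ((N 0 0 : ℝ) - N.rowSum 0 * N.colSum 0 / N.total)]
  congr 1
  nth_rewrite 1 [← Real.sqrt_sq (by positivity : (0 : ℝ) ≤ N.total / (N.rowSum 0 * N.rowSum 1))]
  rw [← Real.sqrt_mul (by positivity)]
  congr 1
  -- With an empty column both radicands are quotients by 0, hence 0, and the equality persists.
  by_cases hc : (N.colSum 0 : ℝ) * N.colSum 1 = 0
  · rw [hc, mul_assoc, hc]; simp
  · have h2 := left_ne_zero_of_mul hc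
    have h3 := right_ne_zero_of_mul hc
    field_simp

lemma abs_diffT_le : |N.diffT| ≤ 1 := by
  have h : ∀ i, 0 ≤ (N i 0 : ℝ) / N.rowSum i ∧ (N i 0 : ℝ) / N.rowSum i ≤ 1 := by
    intro i
    refine ⟨by positivity, div_le_one_of_le₀ ?_ (by positivity)⟩
    rw [rowSum_eq]
    have : (0 : ℝ) ≤ N i 1 := by positivity
    linarith
  rw [diffT, abs_le]
  constructor <;> linarith [(h 0).1, (h 0).2, (h 1).1, (h 1).2]

/-- An empty column makes both row proportions 0 or both 1, so T vanishes. Thus the degenerate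
convention never interferes when T is away from 0. -/
lemma colSum_mul_pos (h0 : N.rowSum 0 ≠ 0) (h1 : N.rowSum 1 ≠ 0) (hT : N.diffT ≠ 0) :
    (0 : ℝ) < N.colSum 0 * N.colSum 1 := by
  by_contra hn
  apply hT
  have a : (N.rowSum 0 : ℝ) ≠ 0 := by exact_mod_cast h0
  have b : (N.rowSum 1 : ℝ) ≠ 0 := by exact_mod_cast h1
  have nn : ∀ i j, (0 : ℝ) ≤ N i j := fun i j => by positivity
  have hz : (N.colSum 0 : ℝ) * N.colSum 1 = 0 := le_antisymm (not_lt.1 hn) (by positivity)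
  rcases mul_eq_zero.1 hz with h | h <;> rw [colSum_eq] at h
  · have e0 : (N 0 0 : ℝ) = 0 := by linarith [nn 0 0, nn 1 0]
    have e1 : (N 1 0 : ℝ) = 0 := by linarith [nn 0 0, nn 1 0]
    simp [diffT, e0, e1]
  · have e0 : (N 0 0 : ℝ) = N.rowSum 0 := by rw [rowSum_eq]; linarith [nn 0 1, nn 1 1]
    have e1 : (N 1 0 : ℝ) = N.rowSum 1 := by rw [rowSum_eq]; linarith [nn 0 1, nn 1 1]
    rw [diffT, e0, e1, div_self a, div_self b, sub_self]

lemma pielouZ_eq_diffT_mul : N.pielouZ = N.diffT *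
    √((N.rowSum 0 : ℝ) * N.rowSum 1 * N.total / ((N.colSum 0 : ℝ) * N.colSum 1)) := rfl

/-- Combine 4 C₁ C₂ ≤ n² with K n ≤ 2 n₁ n₂. -/
lemma sqrt_le_sqrt_colSum {K : ℝ} (hK : 0 < K) (h0 : K ≤ N.rowSum 0) (h1 : K ≤ N.rowSum 1)
    (hT : N.diffT ≠ 0) :
    √K ≤ √((N.rowSum 0 : ℝ) * N.rowSum 1 * N.total / ((N.colSum 0 : ℝ) * N.colSum 1)) := by
  have a : (0 : ℝ) < N.rowSum 0 := hK.trans_le h0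
  have b : (0 : ℝ) < N.rowSum 1 := hK.trans_le h1
  have hC := N.colSum_mul_pos (by exact_mod_cast a.ne') (by exact_mod_cast b.ne') hT
  refine Real.sqrt_le_sqrt ?_
  rw [le_div_iff₀ hC]
  have h4 : 4 * ((N.colSum 0 : ℝ) * N.colSum 1) ≤ N.total ^ 2 := by
    rw [total_eq_colSum]; nlinarith [sq_nonneg ((N.colSum 0 : ℝ) - N.colSum 1)]
  have h5 : K * N.total ≤ 2 * (N.rowSum 0 * N.rowSum 1) := by
    rw [total_eq]; nlinarith
  have h6 : (0 : ℝ) ≤ N.total := by positivity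
  nlinarith [mul_le_mul_of_nonneg_right h5 h6]

/-- The deterministic core of consistency: no probability enters beyond T and the row sums. -/
lemma pielouZ_ge {K δ : ℝ} (hK : 0 < K) (hδ : 0 < δ) (h0 : K ≤ N.rowSum 0) (h1 : K ≤ N.rowSum 1)
    (hT : δ ≤ N.diffT) : δ * √K ≤ N.pielouZ := by
  rw [pielouZ_eq_diffT_mul]
  have h2 : 0 ≤ N.diffT := hδ.le.trans hT
  have := N.sqrt_le_sqrt_colSum hK h0 h1 (by linarith : (0 : ℝ) < N.diffT).ne'
  gcongr

lemma pielouZ_le {K δ : ℝ} (hK : 0 < K) (hδ : 0 < δ) (h0 : K ≤ N.rowSum 0) (h1 : K ≤ N.rowSum 1)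
    (hT : N.diffT ≤ -δ) : N.pielouZ ≤ -(δ * √K) := by
  rw [pielouZ_eq_diffT_mul]
  have := N.sqrt_le_sqrt_colSum hK h0 h1 (by linarith : N.diffT < 0).ne
  have : δ * √K ≤ -N.diffT *
    √((N.rowSum 0 : ℝ) * N.rowSum 1 * N.total / ((N.colSum 0 : ℝ) * N.colSum 1)) := by
    have h2 : δ ≤ -N.diffT := by linarith
    gcongr
    linarith
  linarith

/-- The statistic as a normalized difference times a correction tending to one. -/
lemma pielouZ_eq_of_pos {v : ℝ} (hv : 0 < v) (h0 : N.rowSum 0 ≠ 0) (h1 : N.rowSum 1 ≠ 0) :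
    N.pielouZ = N.diffT / √(v * (N.total / (N.rowSum 0 * N.rowSum 1))) *
      √(v / ((N.colSum 0 / N.total) * (1 - N.colSum 0 / N.total))) := by
  have a : (0 : ℝ) < N.rowSum 0 := by exact_mod_cast Nat.pos_of_ne_zero h0
  have b : (0 : ℝ) < N.rowSum 1 := by exact_mod_cast Nat.pos_of_ne_zero h1
  have c : (0 : ℝ) < N.total := by rw [total_eq]; positivity
  rw [pielouZ_eq_diffT_mul, div_mul_eq_mul_div, mul_div_assoc N.diffT, ← Real.sqrt_div' _ (by positivity)]
  congr 2
  have e : (1 : ℝ) - N.colSum 0 / N.total = N.colSum 1 / N.total := by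
    rw [eq_div_iff c.ne', sub_mul, div_mul_cancel₀ _ c.ne', total_eq_colSum]; ring
  rw [e]
  by_cases hc : (N.colSum 0 : ℝ) * N.colSum 1 = 0
  · rw [hc, div_mul_div_comm, hc]; simp
  · have h2 := left_ne_zero_of_mul hc
    have h3 := right_ne_zero_of_mul hc
    field_simp

end Table

/-- The indicator of class 1. -/
def ind (l : Fin 2) : ℝ := if l = 0 then 1 else 0

@[simp] lemma ind_zero : ind 0 = 1 := rfl
@[simp] lemma ind_one : ind 1 = 0 := rfl

lemma ind_nonneg (l : Fin 2) : 0 ≤ ind l := by unfold ind; split <;> norm_num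
lemma ind_le_one (l : Fin 2) : ind l ≤ 1 := by unfold ind; split <;> norm_num

lemma ind_sq (l : Fin 2) : ind l ^ 2 = ind l := by unfold ind; split <;> norm_num

/-! ### Cell counts and margins as sums of indicators -/

section nnct

variable {ι : Type*} [Fintype ι] (base nn : ι → Fin 2)

lemma nnct_apply (i j : Fin 2) : (nnct base nn i j : ℝ) =
    ∑ k, if base k = i ∧ nn k = j then (1 : ℝ) else 0 := by
  simp [nnct]

lemma nnct_zero_zero : (nnct base nn 0 0 : ℝ) = ∑ k, ind (base k) * ind (nn k) := by
  rw [nnct_apply]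
  refine Finset.sum_congr rfl fun k _ => ?_
  simp only [ind, ite_and, mul_ite, mul_one, mul_zero]
  split <;> simp_all

lemma nnct_one_zero : (nnct base nn 1 0 : ℝ) = ∑ k, (1 - ind (base k)) * ind (nn k) := by
  rw [nnct_apply]
  refine Finset.sum_congr rfl fun k _ => ?_
  have : ∀ a b : Fin 2, (if a = 1 ∧ b = 0 then (1 : ℝ) else 0) = (1 - ind a) * ind b := by
    intro a b; fin_cases a <;> fin_cases b <;> simp [ind]
  exact this _ _

lemma nnct_rowSum (i : Fin 2) : (nnct base nn).rowSum i =
    (Finset.univ.filter fun k => base k = i).card := by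
  have : ((nnct base nn).rowSum i : ℝ) = ((Finset.univ.filter fun k => base k = i).card : ℝ) := by
    rw [Table.rowSum_eq, nnct_apply, nnct_apply, ← Finset.sum_add_distrib,
      Finset.natCast_card_filter]
    refine Finset.sum_congr rfl fun k _ => ?_
    have : ∀ a b c : Fin 2, ((if a = c ∧ b = 0 then (1 : ℝ) else 0) +
      if a = c ∧ b = 1 then 1 else 0) = if a = c then 1 else 0 := by
      intro a b c; fin_cases a <;> fin_cases b <;> fin_cases c <;> simp
    exact this _ _ _
  exact_mod_cast this

lemma nnct_rowSum_zero : ((nnct base nn).rowSum 0 : ℝ) = ∑ k, ind (base k) := by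
  rw [nnct_rowSum, Finset.natCast_card_filter]; rfl

lemma nnct_colSum_zero : ((nnct base nn).colSum 0 : ℝ) = ∑ k, ind (nn k) := by
  rw [Table.colSum_eq, nnct_zero_zero, nnct_one_zero, ← Finset.sum_add_distrib]
  exact Finset.sum_congr rfl fun k _ => by ring

lemma nnct_total : ((nnct base nn).total : ℝ) = Fintype.card ι := by
  rw [Table.total_eq, Table.rowSum_eq, Table.rowSum_eq, nnct_apply, nnct_apply, nnct_apply,
    nnct_apply, ← Finset.sum_add_distrib, ← Finset.sum_add_distrib, ← Finset.sum_add_distrib]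
  have : ∀ a b : Fin 2, (((if a = 0 ∧ b = 0 then (1 : ℝ) else 0) +
      if a = 0 ∧ b = 1 then 1 else 0) + ((if a = 1 ∧ b = 0 then (1 : ℝ) else 0) +
      if a = 1 ∧ b = 1 then 1 else 0)) = 1 := by
    intro a b; fin_cases a <;> fin_cases b <;> simp
  simp_rw [this]
  simp

lemma nnct_rowSum_one : ((nnct base nn).rowSum 1 : ℝ) = Fintype.card ι - ∑ k, ind (base k) := by
  have := (nnct base nn).total_eq
  rw [nnct_total, nnct_rowSum_zero] at this
  linarith

lemma nnct_comp_equiv {ι' : Type*} [Fintype ι'] (e : ι' ≃ ι) :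
    nnct (fun k => base (e k)) (fun k => nn (e k)) = nnct base nn := by
  funext i j
  simp only [nnct]
  refine Finset.card_bij (fun k _ => e k) ?_ ?_ ?_
  · intro k hk; simpa using hk
  · intro a _ b _ h; exact e.injective h
  · intro b hb; exact ⟨e.symm b, by simpa using hb, by simp⟩

end nnct

lemma integral_labelLaw {p : ℝ} (h0 : 0 ≤ p) (h1 : p ≤ 1) (g : Fin 2 → ℝ) :
    ∫ y, g y ∂(labelLaw p) = p * g 0 + (1 - p) * g 1 := by
  rw [labelLaw, integral_add_measure, integral_smul_measure, integral_smul_measure,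
    integral_dirac, integral_dirac, ENNReal.toReal_ofReal h0, ENNReal.toReal_ofReal (by linarith)]
  · rfl
  · exact (Integrable.of_finite).smul_measure ENNReal.ofReal_ne_top
  · exact (Integrable.of_finite).smul_measure ENNReal.ofReal_ne_top

lemma isProbabilityMeasure_labelLaw {p : ℝ} (h0 : 0 ≤ p) (h1 : p ≤ 1) :
    IsProbabilityMeasure (labelLaw p) := by
  constructor
  simp only [labelLaw, Measure.coe_add, Measure.coe_smul, Pi.add_apply, Pi.smul_apply,
    measure_univ, smul_eq_mul, mul_one]
  rw [← ENNReal.ofReal_add h0 (by linarith)]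
  simp

/-! ### Consistency of tests based on `pielouZ` -/

section Power

variable {κ : Type*} {l : Filter κ} {Ω : κ → Type*} [∀ k, MeasurableSpace (Ω k)]
  {P : ∀ k, Measure (Ω k)} [∀ k, IsProbabilityMeasure (P k)] {T : ∀ k, Ω k → Table}

lemma tendsto_one_of_compl {A B : ∀ k, Set (Ω k)}
    (hB : Tendsto (fun k => (P k).real (B k)) l (𝓝 0)) (h : ∀ k ω, ω ∉ B k → ω ∈ A k) :
    Tendsto (fun k => (P k).real (A k)) l (𝓝 1) := by
  have h1 : Tendsto (fun k => 1 - (P k).real (B k)) l (𝓝 1) := by simpa using hB.const_sub 1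
  refine tendsto_of_tendsto_of_tendsto_of_le_of_le h1 tendsto_const_nhds (fun k => ?_)
    fun k => measureReal_le_one
  have hu : (Set.univ : Set (Ω k)) ⊆ A k ∪ B k := fun ω _ => by
    by_cases hb : ω ∈ B k
    · exact Or.inr hb
    · exact Or.inl (h k ω hb)
  have := (measureReal_mono (μ := P k) hu).trans (measureReal_union_le _ _)
  rw [probReal_univ] at this
  simp only
  linarith

lemma exists_lt_mul_sqrt (z : ℝ) {δ : ℝ} (hδ : 0 < δ) : ∃ K : ℝ, 0 < K ∧ z < δ * √K := by
  refine ⟨((|z| + 1) / δ) ^ 2, by positivity, ?_⟩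
  rw [Real.sqrt_sq (by positivity), mul_div_cancel₀ _ hδ.ne']
  linarith [le_abs_self z]

/-- A single K with δ√K above the critical value is enough; the critical value does not depend on
the sample size. -/
lemma tendsto_rejectSeg_of_diffT {S : Table → ℝ}
    (hS : S = Table.pielouZ ∨ S = Table.pielouZtilde) (α : ℝ) {δ : ℝ} (hδ : 0 < δ)
    (h : ∀ K : ℝ, Tendsto (fun k => (P k).real {ω | ¬ (δ ≤ (T k ω).diffT ∧
      K ≤ (T k ω).rowSum 0 ∧ K ≤ (T k ω).rowSum 1)}) l (𝓝 0)) :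
    Tendsto (fun k => (P k).real {ω | T k ω ∈ rejectSeg S α}) l (𝓝 1) := by
  have hS' : S = Table.pielouZ := hS.elim id fun h => h.trans Table.pielouZtilde_eq_pielouZ
  subst hS'
  obtain ⟨K, hK, hz⟩ := exists_lt_mul_sqrt (normalQuantile (1 - α)) hδ
  refine tendsto_one_of_compl (h K) fun k ω hω => ?_
  simp only [Set.mem_ofPred_eq, not_not] at hω
  exact hz.trans_le (Table.pielouZ_ge _ hK hδ hω.2.1 hω.2.2 hω.1)

lemma tendsto_rejectAssoc_of_diffT {S : Table → ℝ}
    (hS : S = Table.pielouZ ∨ S = Table.pielouZtilde) (α : ℝ) {δ : ℝ} (hδ : 0 < δ)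
    (h : ∀ K : ℝ, Tendsto (fun k => (P k).real {ω | ¬ ((T k ω).diffT ≤ -δ ∧
      K ≤ (T k ω).rowSum 0 ∧ K ≤ (T k ω).rowSum 1)}) l (𝓝 0)) :
    Tendsto (fun k => (P k).real {ω | T k ω ∈ rejectAssoc S α}) l (𝓝 1) := by
  have hS' : S = Table.pielouZ := hS.elim id fun h => h.trans Table.pielouZtilde_eq_pielouZ
  subst hS'
  obtain ⟨K, hK, hz⟩ := exists_lt_mul_sqrt (-normalQuantile α) hδ
  refine tendsto_one_of_compl (h K) fun k ω hω => ?_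
  simp only [Set.mem_ofPred_eq, not_not] at hω
  have := Table.pielouZ_le _ hK hδ hω.2.1 hω.2.2 hω.1
  change (T k ω).pielouZ < normalQuantile α
  linarith

lemma bddMeas_diffT {β : Type*} [MeasurableSpace β] {T : β → Table} (hT : Measurable T) :
    BddMeas fun ω => (T ω).diffT :=
  ⟨(Measurable.of_discrete (f := Table.diffT)).comp hT, 1, fun ω => (T ω).abs_diffT_le⟩

/-- A test is consistent if the variance of `T` vanishes while its mean stays away from zero. -/
lemma tendsto_reject_of_variance {S : Table → ℝ}
    (hS : S = Table.pielouZ ∨ S = Table.pielouZtilde) (α : ℝ) {ε : ℝ} (hε : 0 < ε)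
    (hT : ∀ k, Measurable (T k))
    (hvar : Tendsto (fun k => variance (fun ω => (T k ω).diffT) (P k)) l (𝓝 0))
    {m : Fin 2 → κ → ℝ} (hm : ∀ i, Tendsto (m i) l atTop)
    (hrow : ∀ k, ∀ᵐ ω ∂(P k), ∀ i, ((T k ω).rowSum i : ℝ) = m i k) :
    ((∀ᶠ k in l, ε ≤ ∫ ω, (T k ω).diffT ∂(P k)) →
      Tendsto (fun k => (P k).real {ω | T k ω ∈ rejectSeg S α}) l (𝓝 1)) ∧
    ((∀ᶠ k in l, ∫ ω, (T k ω).diffT ∂(P k) ≤ -ε) →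
      Tendsto (fun k => (P k).real {ω | T k ω ∈ rejectAssoc S α}) l (𝓝 1)) := by
  have hε2 : 0 < ε / 2 := by positivity
  have hlim : Tendsto (fun k => variance (fun ω => (T k ω).diffT) (P k) / (ε / 2) ^ 2) l
      (𝓝 0) := by simpa using hvar.div_const ((ε / 2) ^ 2)
  -- Once the mean is beyond ε and the row sums are large, failing to have T beyond ε/2 forces a
  -- deviation of ε/2 from the mean, so Chebyshev's inequality applies.
  have key : ∀ A : ∀ k, Set (Ω k), (∀ᶠ k in l, ∀ ω, ω ∈ A k → (∀ i, ((T k ω).rowSum i : ℝ) = m i k)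
      → ε / 2 ≤ |(T k ω).diffT - ∫ ω, (T k ω).diffT ∂(P k)|) →
      Tendsto (fun k => (P k).real (A k)) l (𝓝 0) := by
    intro A hA
    refine squeeze_zero' (Eventually.of_forall fun k => measureReal_nonneg)
      (hA.mono fun k hk => ?_) hlim
    refine le_trans ?_ (measureReal_abs_sub_ge_le (bddMeas_diffT (hT k)) (P k) hε2)
    rw [measureReal_def, measureReal_def]
    refine ENNReal.toReal_mono (measure_ne_top _ _) (measure_mono_ae ?_)
    filter_upwards [hrow k] with ω hω hA
    exact hk ω hA hω
  constructor
  · intro hmean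
    refine tendsto_rejectSeg_of_diffT hS α hε2 fun K => key _ ?_
    filter_upwards [hmean, (hm 0).eventually_ge_atTop K, (hm 1).eventually_ge_atTop K]
      with k hk h0 h1 ω hω hr
    simp only [hr, h0, h1, and_true, not_le] at hω
    rw [le_abs]; right; linarith
  · intro hmean
    refine tendsto_rejectAssoc_of_diffT hS α hε2 fun K => key _ ?_
    filter_upwards [hmean, (hm 0).eventually_ge_atTop K, (hm 1).eventually_ge_atTop K]
      with k hk h0 h1 ω hω hr
    simp only [hr, h0, h1, and_true, not_le] at hω
    rw [le_abs]; left; linarith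

end Power

/-! ### Uniformly random permutations -/

section Permutations

variable {ι : Type*} [Fintype ι] [DecidableEq ι]

instance permMeasurableSpace : MeasurableSpace (Equiv.Perm ι) := ⊤

instance : MeasurableSingletonClass (Equiv.Perm ι) := ⟨fun _ => trivial⟩

/-- The uniform law on the permutations of `ι`. -/
def permLaw (ι : Type*) [Fintype ι] [DecidableEq ι] : Measure (Equiv.Perm ι) :=
  uniformOn Set.univ

instance : IsProbabilityMeasure (permLaw ι) :=
  isProbabilityMeasure_uniformOn Set.finite_univ Set.univ_nonempty

variable {E : Type*} [NormedAddCommGroup E] [NormedSpace ℝ E] [CompleteSpace E]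

lemma integral_permLaw (F : Equiv.Perm ι → E) :
    ∫ π, F π ∂(permLaw ι) = (Fintype.card (Equiv.Perm ι) : ℝ)⁻¹ • ∑ π, F π := by
  rw [integral_fintype Integrable.of_finite, Finset.smul_sum]
  refine Finset.sum_congr rfl fun π _ => ?_
  congr 1
  rw [permLaw, measureReal_def, uniformOn_univ]
  simp

lemma integral_permLaw_mul_right (F : Equiv.Perm ι → E) (σ : Equiv.Perm ι) :
    ∫ π, F (π * σ) ∂(permLaw ι) = ∫ π, F π ∂(permLaw ι) := by
  rw [integral_permLaw, integral_permLaw]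
  congr 1
  exact Equiv.sum_comp (Equiv.mulRight σ) F

lemma integral_permLaw_coord (g : ι → ℝ) (i : ι) :
    ∫ π, g (π i) ∂(permLaw ι) = (∑ j, g j) / Fintype.card ι := by
  have h : ∀ j, ∫ π, g (π j) ∂(permLaw ι) = ∫ π, g (π i) ∂(permLaw ι) := by
    intro j
    rw [← integral_permLaw_mul_right (fun π => g (π i)) (Equiv.swap i j)]
    simp
  have h1 : ∑ j, ∫ π, g (π j) ∂(permLaw ι) = ∑ j, g j := by
    rw [← integral_finsetSum _ fun _ _ => Integrable.of_finite]
    have : ∀ π : Equiv.Perm ι, ∑ j, g (π j) = ∑ j, g j := fun π => Equiv.sum_comp π g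
    simp [this]
  have : Nonempty ι := ⟨i⟩
  rw [eq_div_iff (by positivity), ← h1, Finset.sum_congr rfl fun j _ => h j]
  simp [mul_comm]

/-- Integrating out one of the coordinates of a random permutation, for a function with mean
zero. -/
lemma integral_permLaw_mul_centered {a : ι → ℝ} (ha : ∑ i, a i = 0) (s : Finset ι)
    {F : Equiv.Perm ι → ℝ}
    (hF : ∀ π, ∀ j ∉ s, ∀ j' ∉ s, F (π * Equiv.swap j j') = F π) {j : ι} (hj : j ∉ s) :
    ((Fintype.card ι : ℝ) - s.card) * ∫ π, F π * a (π j) ∂(permLaw ι) =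
      -∑ i ∈ s, ∫ π, F π * a (π i) ∂(permLaw ι) := by
  -- All positions outside `s` give the same integral by exchangeability, and summing over all
  -- positions gives 0 because `a` is centred.
  have h : ∀ j' ∈ Finset.univ \ s, ∫ π, F π * a (π j') ∂(permLaw ι) =
      ∫ π, F π * a (π j) ∂(permLaw ι) := by
    intro j' hj'
    rw [← integral_permLaw_mul_right (fun π => F π * a (π j)) (Equiv.swap j j')]
    simp [hF _ j hj j' (Finset.mem_sdiff.1 hj').2]
  have h1 : ∑ i, ∫ π, F π * a (π i) ∂(permLaw ι) = 0 := by
    rw [← integral_finsetSum _ fun _ _ => Integrable.of_finite]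
    have : ∀ π : Equiv.Perm ι, ∑ i, F π * a (π i) = 0 := fun π => by
      rw [← Finset.mul_sum, Equiv.sum_comp π a, ha, mul_zero]
    simp [this]
  rw [← Finset.sum_sdiff (Finset.subset_univ s), Finset.sum_congr rfl h, Finset.sum_const,
    Finset.card_sdiff_of_subset (Finset.subset_univ s), nsmul_eq_mul,
    Finset.card_univ, Nat.cast_sub (Finset.card_le_univ s)] at h1
  linarith

/-- Here and in the analogues for three and four positions, removing a centred factor at a new
position gains a factor of order 1/n and merges that factor with one of the remaining positions. -/
lemma integral_permLaw_two {a : ι → ℝ} (ha : ∑ i, a i = 0) (g : ι → ℝ) {i j : ι} (hij : j ≠ i) :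
    ((Fintype.card ι : ℝ) - 1) * ∫ π, g (π i) * a (π j) ∂(permLaw ι) =
      -∫ π, g (π i) * a (π i) ∂(permLaw ι) := by
  have := integral_permLaw_mul_centered ha {i} (F := fun π => g (π i)) (fun π k hk k' hk' => ?_)
    (j := j) (by simpa using hij)
  · simpa using this
  · simp only [Finset.mem_singleton] at hk hk'
    simp [Equiv.swap_apply_of_ne_of_ne (Ne.symm hk) (Ne.symm hk')]

lemma integral_permLaw_three {a : ι → ℝ} (ha : ∑ i, a i = 0) (g : ι → ι → ℝ) {i i' j : ι}
    (hi : i ≠ i') (h1 : j ≠ i) (h2 : j ≠ i') :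
    ((Fintype.card ι : ℝ) - 2) * ∫ π, g (π i) (π i') * a (π j) ∂(permLaw ι) =
      -(∫ π, g (π i) (π i') * a (π i) ∂(permLaw ι) +
        ∫ π, g (π i) (π i') * a (π i') ∂(permLaw ι)) := by
  have := integral_permLaw_mul_centered ha {i, i'} (F := fun π => g (π i) (π i'))
    (fun π k hk k' hk' => ?_) (j := j) (by simp [h1, h2])
  · rw [Finset.card_pair hi, Finset.sum_pair hi] at this
    exact_mod_cast this
  · simp only [Finset.mem_insert, Finset.mem_singleton, not_or] at hk hk'
    simp [Equiv.swap_apply_of_ne_of_ne (Ne.symm hk.1) (Ne.symm hk'.1),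
      Equiv.swap_apply_of_ne_of_ne (Ne.symm hk.2) (Ne.symm hk'.2)]

lemma integral_permLaw_four {a : ι → ℝ} (ha : ∑ i, a i = 0) (g : ι → ι → ι → ℝ) {i i' i'' j : ι}
    (hi : i ≠ i') (hi' : i ≠ i'') (hi'' : i' ≠ i'') (h1 : j ≠ i) (h2 : j ≠ i') (h3 : j ≠ i'') :
    ((Fintype.card ι : ℝ) - 3) * ∫ π, g (π i) (π i') (π i'') * a (π j) ∂(permLaw ι) =
      -(∫ π, g (π i) (π i') (π i'') * a (π i) ∂(permLaw ι) +
        ∫ π, g (π i) (π i') (π i'') * a (π i') ∂(permLaw ι) +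
        ∫ π, g (π i) (π i') (π i'') * a (π i'') ∂(permLaw ι)) := by
  have := integral_permLaw_mul_centered ha {i, i', i''} (F := fun π => g (π i) (π i') (π i''))
    (fun π k hk k' hk' => ?_) (j := j) (by simp [h1, h2, h3])
  · rw [Finset.card_eq_three.2 ⟨_, _, _, hi, hi', hi'', rfl⟩, Finset.sum_insert (by simp [hi, hi']),
      Finset.sum_pair hi'', ← add_assoc] at this
    exact_mod_cast this
  · simp only [Finset.mem_insert, Finset.mem_singleton, not_or] at hk hk'
    simp [Equiv.swap_apply_of_ne_of_ne (Ne.symm hk.1) (Ne.symm hk'.1),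
      Equiv.swap_apply_of_ne_of_ne (Ne.symm hk.2.1) (Ne.symm hk'.2.1),
      Equiv.swap_apply_of_ne_of_ne (Ne.symm hk.2.2) (Ne.symm hk'.2.2)]

lemma abs_integral_le_of_abs_le {β : Type*} [MeasurableSpace β] {P : Measure β}
    [IsProbabilityMeasure P] {F : β → ℝ} {C : ℝ} (h : ∀ x, |F x| ≤ C) : |∫ x, F x ∂P| ≤ C := by
  simpa using norm_integral_le_of_norm_le_const (μ := P) (f := F)
    (Eventually.of_forall fun y => by simpa using h y)

/-! ### Fourth order moments of a centred vector under a random permutation -/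

section Moments

variable {u : ι → ℝ}

lemma integral_permLaw_mul_self (hu0 : ∑ i, u i = 0) {i j : ι} (hij : j ≠ i) (hn : 2 ≤ Fintype.card ι) :
    ∫ π, u (π i) * u (π j) ∂(permLaw ι) =
      -((∑ i, u i ^ 2) / Fintype.card ι) / (Fintype.card ι - 1) := by
  have h := integral_permLaw_two hu0 u hij
  have hn' : (2 : ℝ) ≤ Fintype.card ι := by exact_mod_cast hn
  have h2 := integral_permLaw_coord (fun i => u i ^ 2) i
  simp only [← pow_two] at h
  rw [h2] at h
  rw [eq_div_iff (by linarith), mul_comm]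
  exact h

lemma abs_integral_permLaw_sq_mul_mul_le (hu0 : ∑ i, u i = 0) (hu1 : ∀ i, |u i| ≤ 1)
    {i j k : ι} (hij : i ≠ j) (hk : k ≠ i) (hk' : k ≠ j)
    (hn : 3 ≤ Fintype.card ι) :
    |∫ π, u (π i) ^ 2 * u (π j) * u (π k) ∂(permLaw ι)| ≤ 2 / (Fintype.card ι - 2) := by
  have hn' : (3 : ℝ) ≤ Fintype.card ι := by exact_mod_cast hn
  have h := integral_permLaw_three hu0 (fun x y => u x ^ 2 * u y) hij hk hk'
  rw [le_div_iff₀ (by linarith), mul_comm]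
  rw [← abs_of_pos (by linarith : (0 : ℝ) < Fintype.card ι - 2), ← abs_mul, h, abs_neg]
  have b : ∀ x y z, |u x ^ 2 * u y * u z| ≤ 1 := by
    intro x y z
    rw [abs_mul, abs_mul, abs_pow]
    have hx := pow_le_one₀ (n := 2) (abs_nonneg _) (hu1 x)
    exact mul_le_one₀ (mul_le_one₀ hx (abs_nonneg _) (hu1 y)) (abs_nonneg _) (hu1 z)
  refine (abs_add_le _ _).trans ?_
  have h1 := abs_integral_le_of_abs_le (P := permLaw ι) fun π => b (π i) (π j) (π i)
  have h2 := abs_integral_le_of_abs_le (P := permLaw ι) fun π => b (π i) (π j) (π j)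
  linarith

/-- Removing one position leaves three moments with one squared factor, each already of order 1/n.
The resulting order 1/n² matters, since there are about n² such terms in the second moment of the
form. -/
lemma abs_integral_permLaw_mul_mul_mul_le (hu0 : ∑ i, u i = 0) (hu1 : ∀ i, |u i| ≤ 1)
    {i j k l : ι} (hij : i ≠ j) (hik : i ≠ k) (hjk : j ≠ k)
    (hl : l ≠ i) (hl' : l ≠ j) (hl'' : l ≠ k) (hn : 4 ≤ Fintype.card ι) :
    |∫ π, u (π i) * u (π j) * u (π k) * u (π l) ∂(permLaw ι)| ≤
      6 / ((Fintype.card ι - 2) * (Fintype.card ι - 3)) := by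
  have hn' : (4 : ℝ) ≤ Fintype.card ι := by exact_mod_cast hn
  have h := integral_permLaw_four hu0 (fun x y z => u x * u y * u z) hij hik hjk hl hl' hl''
  have hn3 : (0 : ℝ) < Fintype.card ι - 3 := by linarith
  have hn2 : (0 : ℝ) < Fintype.card ι - 2 := by linarith
  have e : (6 : ℝ) / ((Fintype.card ι - 2) * (Fintype.card ι - 3)) =
      (3 * (2 / ((Fintype.card ι : ℝ) - 2))) / ((Fintype.card ι : ℝ) - 3) := by
    field_simp; norm_num
  rw [e, le_div_iff₀ hn3, mul_comm]
  rw [← abs_of_pos hn3, ← abs_mul, h, abs_neg]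
  have c1 := abs_integral_permLaw_sq_mul_mul_le hu0 hu1 hij hik.symm hjk.symm (by omega)
  have c2 := abs_integral_permLaw_sq_mul_mul_le hu0 hu1 hij.symm hjk.symm hik.symm (by omega)
  have c3 := abs_integral_permLaw_sq_mul_mul_le hu0 hu1 hik.symm hjk hij.symm (by omega)
  have e1 : ∀ π : Equiv.Perm ι, u (π i) * u (π j) * u (π k) * u (π i) =
    u (π i) ^ 2 * u (π j) * u (π k) := fun π => by ring
  have e2 : ∀ π : Equiv.Perm ι, u (π i) * u (π j) * u (π k) * u (π j) =
    u (π j) ^ 2 * u (π i) * u (π k) := fun π => by ring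
  have e3 : ∀ π : Equiv.Perm ι, u (π i) * u (π j) * u (π k) * u (π k) =
    u (π k) ^ 2 * u (π i) * u (π j) := fun π => by ring
  simp_rw [e1, e2, e3]
  refine (abs_add_le _ _).trans ?_
  have := abs_add_le (∫ π, u (π i) ^ 2 * u (π j) * u (π k) ∂(permLaw ι))
    (∫ π, u (π j) ^ 2 * u (π i) * u (π k) ∂(permLaw ι))
  linarith

/-- The two-position identity is applied to the centred vector u² - v. -/
lemma le_integral_permLaw_sq_mul_sq (hu1 : ∀ i, |u i| ≤ 1) {i j : ι} (hij : j ≠ i) (hn : 2 ≤ Fintype.card ι) :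
    ((∑ i, u i ^ 2) / Fintype.card ι) ^ 2 - 1 / (Fintype.card ι - 1) ≤
      ∫ π, u (π i) ^ 2 * u (π j) ^ 2 ∂(permLaw ι) := by
  have hn' : (2 : ℝ) ≤ Fintype.card ι := by exact_mod_cast hn
  set v := (∑ i, u i ^ 2) / Fintype.card ι with hv
  have hsq : ∀ i, u i ^ 2 ≤ 1 := fun i => by
    rw [← sq_abs]; exact pow_le_one₀ (abs_nonneg _) (hu1 i)
  have hv0 : 0 ≤ v := by positivity
  have hv1 : v ≤ 1 := by
    rw [hv, div_le_one (by linarith)]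
    calc ∑ i, u i ^ 2 ≤ ∑ _i : ι, (1 : ℝ) := Finset.sum_le_sum fun i _ => hsq i
      _ = _ := by simp
  have hc : ∑ i, (u i ^ 2 - v) = 0 := by
    rw [Finset.sum_sub_distrib, Finset.sum_const, Finset.card_univ, nsmul_eq_mul, hv,
      mul_div_cancel₀ _ (by linarith), sub_self]
  have h := integral_permLaw_two hc (fun i => u i ^ 2) hij
  have e : ∫ π, u (π i) ^ 2 * (u (π j) ^ 2 - v) ∂(permLaw ι) =
      ∫ π, u (π i) ^ 2 * u (π j) ^ 2 ∂(permLaw ι) - v ^ 2 := by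
    simp_rw [mul_sub]
    rw [integral_sub Integrable.of_finite Integrable.of_finite, integral_mul_const,
      integral_permLaw_coord (fun i => u i ^ 2), ← hv]
    ring
  have hb : ∫ π, u (π i) ^ 2 * (u (π i) ^ 2 - v) ∂(permLaw ι) ≤ 1 := by
    refine (le_abs_self _).trans (abs_integral_le_of_abs_le fun π => ?_)
    rw [abs_mul, abs_of_nonneg (sq_nonneg _)]
    refine mul_le_one₀ (hsq _) (abs_nonneg _) ?_
    rw [abs_le]; constructor <;> linarith [hsq (π i), sq_nonneg (u (π i))]
  rw [e] at h
  have h3 : -1 / ((Fintype.card ι : ℝ) - 1) ≤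
      ∫ π, u (π i) ^ 2 * u (π j) ^ 2 ∂(permLaw ι) - v ^ 2 := by
    rw [div_le_iff₀ (by linarith)]
    linarith
  rw [neg_div] at h3
  linarith

end Moments

/-! ### Quadratic forms of randomly permuted labels -/

/-- The sum over `i` of `u i * u (f i)`. -/
def nnForm (f : ι → ι) (u : ι → ℝ) : ℝ := ∑ i, u i * u (f i)

/-- The indices whose pair `{i', f i'}` meets `{i, f i}`. -/
def nearIdx (f : ι → ι) (i : ι) : Finset ι :=
  {i, f i} ∪ (Finset.univ.filter fun j => f j = i) ∪ (Finset.univ.filter fun j => f j = f i)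

/-- `f` has no fixed points, and its fibres have at most `25` elements. -/
structure GoodMap (f : ι → ι) : Prop where
  ne : ∀ i, f i ≠ i
  card_fiber_le : ∀ j, (Finset.univ.filter fun i => f i = j).card ≤ 25

/-- 52 = 2 + 25 + 25: the two points themselves and the fibres over each of them. -/
lemma GoodMap.card_nearIdx_le {f : ι → ι} (hf : GoodMap f) (i : ι) : (nearIdx f i).card ≤ 52 := by
  refine (Finset.card_union_le _ _).trans ?_
  have h1 := Finset.card_union_le {i, f i} (Finset.univ.filter fun j => f j = i)
  have h2 : ({i, f i} : Finset ι).card ≤ 2 := Finset.card_le_two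
  have := hf.card_fiber_le i
  have := hf.card_fiber_le (f i)
  omega

lemma mem_nearIdx {f : ι → ι} {i j : ι} :
    j ∈ nearIdx f i ↔ j = i ∨ j = f i ∨ f j = i ∨ f j = f i := by
  simp [nearIdx]; tauto

lemma integral_nnForm {f : ι → ι} (hf : GoodMap f) {u : ι → ℝ} (hu0 : ∑ i, u i = 0)
    (hn : 2 ≤ Fintype.card ι) :
    ∫ π, nnForm f (fun i => u (π i)) ∂(permLaw ι) =
      -(∑ i, u i ^ 2) / (Fintype.card ι - 1) := by
  have hn' : (2 : ℝ) ≤ Fintype.card ι := by exact_mod_cast hn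
  simp only [nnForm]
  rw [integral_finsetSum _ fun _ _ => Integrable.of_finite,
    Finset.sum_congr rfl fun i _ => integral_permLaw_mul_self hu0 (hf.ne i) hn,
    Finset.sum_const, Finset.card_univ, nsmul_eq_mul]
  have : (Fintype.card ι : ℝ) - 1 ≠ 0 := by linarith
  field_simp

lemma integral_nnForm_sq_ge {f : ι → ι} (hf : GoodMap f) {u : ι → ℝ} (hu0 : ∑ i, u i = 0)
    (hu1 : ∀ i, |u i| ≤ 1) (hn : 6 ≤ Fintype.card ι) {v : ℝ}
    (hv : v = (∑ i, u i ^ 2) / Fintype.card ι) :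
    ((Fintype.card ι : ℝ) + (Finset.univ.filter fun i => f (f i) = i).card) * v ^ 2 - 400 ≤
      ∫ π, nnForm f (fun i => u (π i)) ^ 2 ∂(permLaw ι) := by
  have hn' : (6 : ℝ) ≤ Fintype.card ι := by exact_mod_cast hn
  set n : ℝ := (Fintype.card ι : ℝ) with hndef
  set m : ℝ := v ^ 2 - 1 / (n - 1) with hm
  set A : ℝ := 2 / (n - 2) with hA
  set B : ℝ := 6 / ((n - 2) * (n - 3)) with hB
  have hA0 : 0 ≤ A := by apply div_nonneg <;> linarith
  have hB0 : 0 ≤ B := by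
    apply div_nonneg; norm_num; apply mul_nonneg <;> linarith
  -- The square expands into n² fourth moments. Equal and reversed pairs contribute about v²; other
  -- overlapping pairs share exactly one point and are at least -A, of order 1/n; disjoint pairs are
  -- at least -B, of order 1/n².
  have hterm : ∀ i j, (if j = i then m else 0) + (if j = f i ∧ f j = i then m else 0) -
      (if j ∈ nearIdx f i then A else 0) - B ≤
      ∫ π, u (π i) * u (π (f i)) * (u (π j) * u (π (f j))) ∂(permLaw ι) := by
    intro i j
    have hm22 : ∀ i j, j ≠ i → m ≤ ∫ π, u (π i) ^ 2 * u (π j) ^ 2 ∂(permLaw ι) := by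
      intro i j hij
      have := le_integral_permLaw_sq_mul_sq hu1 hij (by omega)
      rwa [← hv] at this
    have hm211 : ∀ i j k, i ≠ j → k ≠ i → k ≠ j →
        -A ≤ ∫ π, u (π i) ^ 2 * u (π j) * u (π k) ∂(permLaw ι) := fun i j k h1 h2 h3 =>
      (abs_le.1 (abs_integral_permLaw_sq_mul_mul_le hu0 hu1 h1 h2 h3 (by omega))).1
    by_cases h1 : j = i
    · subst h1
      have h2 : ¬ (j = f j ∧ f j = j) := fun h => hf.ne j h.2
      have h3 : j ∈ nearIdx f j := by simp [mem_nearIdx]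
      simp only [if_true, h2, if_false, h3]
      have e : ∀ π : Equiv.Perm ι, u (π j) * u (π (f j)) * (u (π j) * u (π (f j))) =
        u (π j) ^ 2 * u (π (f j)) ^ 2 := fun π => by ring
      simp_rw [e]
      have := hm22 j (f j) (hf.ne j)
      linarith
    by_cases h2 : j = f i ∧ f j = i
    · have h3 : j ∈ nearIdx f i := by simp [mem_nearIdx, h2.1]
      rw [if_neg h1, if_pos h2, if_pos h3, h2.2, h2.1]
      have e : ∀ π : Equiv.Perm ι, u (π i) * u (π (f i)) * (u (π (f i)) * u (π i)) =
        u (π i) ^ 2 * u (π (f i)) ^ 2 := fun π => by ring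
      simp_rw [e]
      have := hm22 i (f i) (hf.ne i)
      linarith
    simp only [h1, h2, if_false]
    by_cases h3 : j ∈ nearIdx f i
    · rw [if_pos h3]
      have hfi := hf.ne i
      have hfj := hf.ne j
      suffices -A ≤ ∫ π, u (π i) * u (π (f i)) * (u (π j) * u (π (f j))) ∂(permLaw ι) by linarith
      rcases mem_nearIdx.1 h3 with h | h | h | h
      · exact absurd h h1
      · have h4 : f j ≠ i := fun h' => h2 ⟨h, h'⟩
        have e : ∀ π : Equiv.Perm ι, u (π i) * u (π (f i)) * (u (π j) * u (π (f j))) =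
          u (π j) ^ 2 * u (π i) * u (π (f j)) := fun π => by rw [← h]; ring
        simp_rw [e]
        exact hm211 _ _ _ h1 hfj h4
      · have h4 : j ≠ f i := fun h' => h2 ⟨h', h⟩
        have e : ∀ π : Equiv.Perm ι, u (π i) * u (π (f i)) * (u (π j) * u (π (f j))) =
          u (π i) ^ 2 * u (π (f i)) * u (π j) := fun π => by rw [h]; ring
        simp_rw [e]
        exact hm211 _ _ _ hfi.symm h1 h4
      · have e : ∀ π : Equiv.Perm ι, u (π i) * u (π (f i)) * (u (π j) * u (π (f j))) =
          u (π (f i)) ^ 2 * u (π i) * u (π j) := fun π => by rw [h]; ring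
        simp_rw [e]
        refine hm211 _ _ _ hfi ?_ h1
        rw [← h]; exact hfj.symm
    · rw [if_neg h3]
      rw [mem_nearIdx] at h3
      push Not at h3
      have e : ∀ π : Equiv.Perm ι, u (π i) * u (π (f i)) * (u (π j) * u (π (f j))) =
        u (π i) * u (π (f i)) * u (π j) * u (π (f j)) := fun π => by ring
      simp_rw [e]
      have := (abs_le.1 (abs_integral_permLaw_mul_mul_mul_le hu0 hu1 (hf.ne i).symm (Ne.symm h1)
        h3.2.1.symm h3.2.2.1 h3.2.2.2 (hf.ne j) (by omega))).1
      linarith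
  have hsum : ∫ π, nnForm f (fun i => u (π i)) ^ 2 ∂(permLaw ι) =
      ∑ i, ∑ j, ∫ π, u (π i) * u (π (f i)) * (u (π j) * u (π (f j))) ∂(permLaw ι) := by
    simp only [nnForm, pow_two, Finset.sum_mul_sum]
    rw [integral_finsetSum _ fun _ _ => Integrable.of_finite]
    exact Finset.sum_congr rfl fun i _ => integral_finsetSum _ fun _ _ => Integrable.of_finite
  rw [hsum]
  refine le_trans ?_ (Finset.sum_le_sum fun i _ => Finset.sum_le_sum fun j _ => hterm i j)
  have hrow : ∀ i, m + (if f (f i) = i then m else 0) - 52 * A - n * B ≤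
      ∑ j, ((if j = i then m else 0) + (if j = f i ∧ f j = i then m else 0) -
      (if j ∈ nearIdx f i then A else 0) - B) := by
    intro i
    rw [Finset.sum_sub_distrib, Finset.sum_sub_distrib, Finset.sum_add_distrib]
    have e1 : ∑ j, (if j = i then m else 0) = m := by simp
    have e2 : ∑ j, (if j = f i ∧ f j = i then m else 0) = if f (f i) = i then m else 0 := by
      rw [Finset.sum_eq_single (f i)]
      · simp
      · intro j _ hj; simp [hj]
      · simp
    have e3 : ∑ j, (if j ∈ nearIdx f i then A else 0) ≤ 52 * A := by
      rw [Finset.sum_ite_mem, Finset.univ_inter, Finset.sum_const, nsmul_eq_mul]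
      gcongr
      exact_mod_cast hf.card_nearIdx_le i
    have e4 : ∑ _j : ι, B = n * B := by simp [hndef]
    rw [e1, e2, e4]
    linarith
  refine le_trans ?_ (Finset.sum_le_sum fun i _ => hrow i)
  set R : ℝ := ((Finset.univ.filter fun i => f (f i) = i).card : ℝ) with hR
  have hRn : R ≤ n := by
    rw [hR, hndef]; exact_mod_cast Finset.card_le_univ _
  have e : ∑ i, (m + (if f (f i) = i then m else 0) - 52 * A - n * B) =
      (n + R) * m - n * (52 * A) - n * (n * B) := by
    rw [Finset.sum_sub_distrib, Finset.sum_sub_distrib, Finset.sum_add_distrib, ← Finset.sum_filter]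
    simp only [Finset.sum_const, Finset.card_univ, nsmul_eq_mul, ← hndef, ← hR]
    ring
  rw [e, hm]
  -- The losses 4, 156 and 18 add up to less than 400. The last two bounds are attained at n = 6,
  -- which explains the lower bound on the number of points.
  have b1 : (n + R) * (1 / (n - 1)) ≤ 4 := by
    rw [mul_one_div, div_le_iff₀ (by linarith)]; linarith
  have b2 : n * (52 * A) ≤ 156 := by
    rw [hA, mul_div_assoc', mul_div_assoc', div_le_iff₀ (by linarith)]; linarith
  have b3 : n * (n * B) ≤ 18 := by
    rw [hB, mul_div_assoc', mul_div_assoc', div_le_iff₀ (by apply mul_pos <;> linarith)]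
    nlinarith
  nlinarith

end Permutations

/-! ### Effect on the quadratic form of changing few labels -/

section Coupling

variable {ι : Type*} [Fintype ι] [DecidableEq ι]

lemma integral_permLaw_abs_mul_abs_le {D : ι → ℝ} {i j : ι} (hij : j ≠ i)
    (hn : 2 ≤ Fintype.card ι) :
    ∫ π, |D (π i)| * |D (π j)| ∂(permLaw ι) ≤
      (∑ i, |D i|) ^ 2 / (Fintype.card ι * (Fintype.card ι - 1)) := by
  have hn' : (2 : ℝ) ≤ Fintype.card ι := by exact_mod_cast hn
  set n : ℝ := (Fintype.card ι : ℝ) with hndef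
  set d := ∑ i, |D i| with hd
  have hc : ∑ i, (|D i| - d / n) = 0 := by
    rw [Finset.sum_sub_distrib, Finset.sum_const, Finset.card_univ, nsmul_eq_mul,
      ← hndef, mul_div_cancel₀ _ (by linarith), sub_self]
  have h := integral_permLaw_two hc (fun i => |D i|) hij
  simp_rw [mul_sub] at h
  rw [integral_sub Integrable.of_finite Integrable.of_finite,
    integral_sub Integrable.of_finite Integrable.of_finite, integral_mul_const,
    integral_permLaw_coord (fun i => |D i|), ← hndef, ← hd] at h
  have h0 : 0 ≤ ∫ π, |D (π i)| * |D (π i)| ∂(permLaw ι) :=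
    integral_nonneg fun π => mul_nonneg (abs_nonneg _) (abs_nonneg _)
  rw [le_div_iff₀ (by apply mul_pos <;> linarith)]
  have e : n * (d / n) = d := mul_div_cancel₀ _ (by linarith)
  have e1 : (n - 1) * (∫ π, |D (π i)| * |D (π j)| ∂(permLaw ι)) ≤ n * (d / n * (d / n)) := by
    linarith
  calc _ = n * ((n - 1) * (∫ π, |D (π i)| * |D (π j)| ∂(permLaw ι))) := by ring
    _ ≤ n * (n * (d / n * (d / n))) := by gcongr
    _ = (n * (d / n)) ^ 2 := by ring
    _ = d ^ 2 := by rw [e]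

/-- Overlapping pairs, at most 52 n of them, cost d/n each. For disjoint pairs the centred factor
`a` is removed by the four-position identity, so they contribute d²/n in total rather than d². This
gain makes the coupling of random and i.i.d. labels work. -/
lemma integral_permLaw_sum_mul_sq_le {f : ι → ι} (hf : GoodMap f) {D a : ι → ℝ}
    (ha0 : ∑ i, a i = 0) (ha1 : ∀ i, |a i| ≤ 1) (hD : ∀ i, |D i| ≤ 1) (hn : 6 ≤ Fintype.card ι)
    {p q : ι → ι} (hpq : ∀ i, p i ≠ q i)
    (hdist : ∀ i, ∀ j ∉ nearIdx f i, p i ≠ p j ∧ p i ≠ q j ∧ q i ≠ p j ∧ q i ≠ q j) :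
    ∫ π, (∑ i, D (π (p i)) * a (π (q i))) ^ 2 ∂(permLaw ι) ≤
      52 * (∑ i, |D i|) + 12 * (∑ i, |D i|) ^ 2 / Fintype.card ι := by
  have hn' : (6 : ℝ) ≤ Fintype.card ι := by exact_mod_cast hn
  set n : ℝ := (Fintype.card ι : ℝ) with hndef
  set d := ∑ i, |D i| with hd
  have hd0 : 0 ≤ d := Finset.sum_nonneg fun i _ => abs_nonneg _
  set e2 : ℝ := d ^ 2 / (n * (n - 1)) with he2
  have hterm : ∀ i j, ∫ π, D (π (p i)) * a (π (q i)) * (D (π (p j)) * a (π (q j))) ∂(permLaw ι) ≤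
      (if j ∈ nearIdx f i then d / n else 0) + 3 * e2 / (n - 3) := by
    intro i j
    have he : 0 ≤ 3 * e2 / (n - 3) := by
      apply div_nonneg _ (by linarith)
      have : 0 ≤ e2 := div_nonneg (sq_nonneg _) (by apply mul_nonneg <;> linarith)
      linarith
    by_cases h : j ∈ nearIdx f i
    · rw [if_pos h]
      have h1 : ∫ π, D (π (p i)) * a (π (q i)) * (D (π (p j)) * a (π (q j))) ∂(permLaw ι) ≤
          ∫ π, |D (π (p i))| ∂(permLaw ι) := by
        refine integral_mono Integrable.of_finite Integrable.of_finite fun π => ?_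
        refine (le_abs_self _).trans ?_
        simp only [abs_mul]
        rw [mul_assoc]
        refine mul_le_of_le_one_right (abs_nonneg _) ?_
        exact mul_le_one₀ (ha1 _) (by positivity) (mul_le_one₀ (hD _) (abs_nonneg _) (ha1 _))
      rw [integral_permLaw_coord (fun i => |D i|), ← hndef, ← hd] at h1
      linarith
    · rw [if_neg h, zero_add, le_div_iff₀ (by linarith), mul_comm]
      obtain ⟨h1, h2, h3, h4⟩ := hdist i j h
      have h5 := integral_permLaw_four ha0 (fun x y z => D x * D y * a z) h1 (hpq i) h3.symm
        h2.symm (hpq j).symm h4.symm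
      have e : ∀ π : Equiv.Perm ι, D (π (p i)) * a (π (q i)) * (D (π (p j)) * a (π (q j))) =
        D (π (p i)) * D (π (p j)) * a (π (q i)) * a (π (q j)) := fun π => by ring
      simp_rw [e]
      rw [← hndef] at h5
      rw [h5]
      have hb : ∀ r, -(∫ π, D (π (p i)) * D (π (p j)) * a (π (q i)) * a (π r) ∂(permLaw ι)) ≤
          e2 := by
        intro r
        refine le_trans ?_ (integral_permLaw_abs_mul_abs_le (D := D) h1.symm (by omega))
        rw [← integral_neg]
        refine integral_mono Integrable.of_finite Integrable.of_finite fun π => ?_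
        refine (neg_le_abs _).trans ?_
        simp only [abs_mul]
        rw [mul_assoc]
        refine mul_le_of_le_one_right (by positivity) ?_
        exact mul_le_one₀ (ha1 _) (abs_nonneg _) (ha1 _)
      linarith [hb (p i), hb (p j), hb (q i)]
  have hsum : ∫ π, (∑ i, D (π (p i)) * a (π (q i))) ^ 2 ∂(permLaw ι) = ∑ i, ∑ j,
      ∫ π, D (π (p i)) * a (π (q i)) * (D (π (p j)) * a (π (q j))) ∂(permLaw ι) := by
    simp only [pow_two, Finset.sum_mul_sum]
    rw [integral_finsetSum _ fun _ _ => Integrable.of_finite]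
    exact Finset.sum_congr rfl fun i _ => integral_finsetSum _ fun _ _ => Integrable.of_finite
  rw [hsum]
  refine (Finset.sum_le_sum fun i _ => Finset.sum_le_sum fun j _ => hterm i j).trans ?_
  have hrow : ∀ i, ∑ j, ((if j ∈ nearIdx f i then d / n else 0) + 3 * e2 / (n - 3)) ≤
      52 * (d / n) + n * (3 * e2 / (n - 3)) := by
    intro i
    rw [Finset.sum_add_distrib, Finset.sum_ite_mem, Finset.univ_inter, Finset.sum_const,
      nsmul_eq_mul, Finset.sum_const, Finset.card_univ, nsmul_eq_mul, ← hndef]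
    gcongr
    exact_mod_cast hf.card_nearIdx_le i
  refine (Finset.sum_le_sum fun i _ => hrow i).trans ?_
  rw [Finset.sum_const, Finset.card_univ, nsmul_eq_mul, ← hndef, mul_add]
  have e1 : n * (52 * (d / n)) = 52 * d := by field_simp
  have e3 : n * (n * (3 * e2 / (n - 3))) ≤ 12 * d ^ 2 / n := by
    have p1 : 0 < n - 1 := by linarith
    have p3 : 0 < n - 3 := by linarith
    rw [he2, le_div_iff₀ (by linarith)]
    have : n * (n * (3 * (d ^ 2 / (n * (n - 1))) / (n - 3))) * n =
        (3 * n ^ 2 / ((n - 1) * (n - 3))) * d ^ 2 := by field_simp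
    rw [this]
    gcongr
    rw [div_le_iff₀ (by positivity)]
    nlinarith
  linarith

/-- Changing few coordinates of a centered vector changes its randomly permuted form little. -/
lemma integral_permLaw_abs_nnForm_sub_le {f : ι → ι} (hf : GoodMap f) {a b : ι → ℝ}
    (ha0 : ∑ i, a i = 0) (ha1 : ∀ i, |a i| ≤ 1) (hab : ∀ i, |a i - b i| ≤ 1)
    (hn : 6 ≤ Fintype.card ι) {d : ℝ} (hd : d = ∑ i, |a i - b i|) :
    ∫ π, |nnForm f (fun i => a (π i)) - nnForm f (fun i => b (π i))| ∂(permLaw ι) ≤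
      2 * √(52 * d + 12 * d ^ 2 / Fintype.card ι) + 2 * d ^ 2 / Fintype.card ι := by
  have hn' : (6 : ℝ) ≤ Fintype.card ι := by exact_mod_cast hn
  set D : ι → ℝ := fun i => a i - b i with hD
  -- With D = a - b, a a' - b b' = D a' + D' a - D D'. The first two sums are bounded in L² using
  -- the centring of `a`; in the last one absolute values suffice.
  have e : ∀ π : Equiv.Perm ι, nnForm f (fun i => a (π i)) - nnForm f (fun i => b (π i)) =
      ∑ i, D (π i) * a (π (f i)) + ∑ i, D (π (f i)) * a (π i) -
        ∑ i, D (π i) * D (π (f i)) := by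
    intro π
    simp only [nnForm]
    rw [← Finset.sum_sub_distrib, ← Finset.sum_add_distrib, ← Finset.sum_sub_distrib]
    refine Finset.sum_congr rfl fun i _ => ?_
    simp only [hD]; ring
  have b1 := integral_permLaw_sum_mul_sq_le hf ha0 ha1 hab hn (p := fun i => i) (q := f)
    (fun i => (hf.ne i).symm) (fun i j hj => by
      rw [mem_nearIdx] at hj
      push Not at hj
      exact ⟨hj.1.symm, hj.2.2.1.symm, hj.2.1.symm, hj.2.2.2.symm⟩)
  have b2 := integral_permLaw_sum_mul_sq_le hf ha0 ha1 hab hn (p := f) (q := fun i => i)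
    (fun i => hf.ne i) (fun i j hj => by
      rw [mem_nearIdx] at hj
      push Not at hj
      exact ⟨hj.2.2.2.symm, hj.2.1.symm, hj.2.2.1.symm, hj.1.symm⟩)
  rw [← hd] at b1 b2
  have hj : ∀ F : Equiv.Perm ι → ℝ, ∀ C, ∫ π, F π ^ 2 ∂(permLaw ι) ≤ C →
      ∫ π, |F π| ∂(permLaw ι) ≤ √C := by
    intro F C hC
    refine Real.le_sqrt_of_sq_le (le_trans (sq_integral_le (BddMeas.of_finite _) _) ?_)
    simpa only [sq_abs] using hC
  have c1 := hj _ _ b1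
  have c2 := hj _ _ b2
  have c3 : ∫ π, |∑ i, D (π i) * D (π (f i))| ∂(permLaw ι) ≤ 2 * d ^ 2 / Fintype.card ι := by
    have h1 : ∫ π, |∑ i, D (π i) * D (π (f i))| ∂(permLaw ι) ≤
        ∑ i, ∫ π, |D (π i)| * |D (π (f i))| ∂(permLaw ι) := by
      rw [← integral_finsetSum _ fun _ _ => Integrable.of_finite]
      refine integral_mono Integrable.of_finite Integrable.of_finite fun π => ?_
      refine (Finset.abs_sum_le_sum_abs _ _).trans (le_of_eq ?_)
      simp only [abs_mul]
    refine h1.trans ((Finset.sum_le_sum fun i _ =>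
      integral_permLaw_abs_mul_abs_le (D := D) (hf.ne i) (by omega)).trans ?_)
    rw [Finset.sum_const, Finset.card_univ, nsmul_eq_mul, ← hd, mul_div_assoc',
      div_le_div_iff₀ (by apply mul_pos <;> linarith) (by linarith)]
    nlinarith [mul_nonneg (sq_nonneg d)
      (mul_nonneg (by linarith : (0 : ℝ) ≤ Fintype.card ι) (by linarith : (0 : ℝ) ≤ Fintype.card ι))]
  calc ∫ π, |nnForm f (fun i => a (π i)) - nnForm f (fun i => b (π i))| ∂(permLaw ι)
      ≤ ∫ π, (|∑ i, D (π i) * a (π (f i))| + |∑ i, D (π (f i)) * a (π i)| +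
          |∑ i, D (π i) * D (π (f i))|) ∂(permLaw ι) := by
        refine integral_mono Integrable.of_finite Integrable.of_finite fun π => ?_
        simp only [e]
        exact (abs_sub _ _).trans (by gcongr; exact abs_add_le _ _)
    _ ≤ _ := by
        rw [integral_add Integrable.of_finite Integrable.of_finite,
          integral_add Integrable.of_finite Integrable.of_finite]
        linarith

end Coupling

/-! ### Random labelling as a random permutation of labels -/

section Labels

variable {ι : Type*} [Fintype ι] [DecidableEq ι]

/-- The number of class 1 labels. -/
def countZero (a : ι → Fin 2) : ℕ := (Finset.univ.filter fun k => a k = 0).card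

lemma countZero_eq_sum (a : ι → Fin 2) : (countZero a : ℝ) = ∑ i, ind (a i) := by
  rw [countZero, Finset.natCast_card_filter]; rfl

lemma countZero_comp (a : ι → Fin 2) (π : Equiv.Perm ι) : countZero (a ∘ π) = countZero a := by
  have h : ((countZero (a ∘ π) : ℕ) : ℝ) = (countZero a : ℕ) := by
    rw [countZero_eq_sum, countZero_eq_sum]
    exact Equiv.sum_comp π fun i => ind (a i)
  exact_mod_cast h

lemma exists_perm_of_countZero_eq {a b : ι → Fin 2} (h : countZero a = countZero b) :
    ∃ σ : Equiv.Perm ι, b = a ∘ σ := by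
  have hc : Fintype.card {i // b i = 0} = Fintype.card {i // a i = 0} := by
    rw [Fintype.card_subtype, Fintype.card_subtype]; exact h.symm
  let e := Fintype.equivOfCardEq hc
  refine ⟨e.extendSubtype, ?_⟩
  funext i
  by_cases hi : b i = 0
  · rw [hi]; exact (e.extendSubtype_mem i hi).symm
  · have h1 : ¬ a (e.extendSubtype i) = 0 := e.extendSubtype_not_mem i hi
    have h2 : ∀ x : Fin 2, x ≠ 0 → x = 1 := by decide
    rw [h2 _ hi, Function.comp_apply, h2 _ h1]

/-- All labellings with `m` labels of class 1 are equally likely. -/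
def labelUniform (ι : Type*) [Fintype ι] (m : ℕ) : Measure (ι → Fin 2) :=
  uniformOn {lab | (Finset.univ.filter fun k => lab k = 0).card = m}

variable {E : Type*} [NormedAddCommGroup E] [NormedSpace ℝ E] [CompleteSpace E]

/-- The permutations act transitively on the labellings with `m` labels of class 1, and the uniform
law on permutations is translation invariant, so all these labellings get equal mass. -/
lemma map_permLaw_eq_labelUniform {m : ℕ} {a : ι → Fin 2} (ha : countZero a = m) :
    (permLaw ι).map (fun π : Equiv.Perm ι => a ∘ π) = labelUniform ι m := by
  set A : Finset (ι → Fin 2) := Finset.univ.filter fun lab => countZero lab = m with hA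
  have hAset : {lab : ι → Fin 2 | (Finset.univ.filter fun k => lab k = 0).card = m} = ↑A := by
    ext lab
    rw [Finset.mem_coe, hA, Finset.mem_filter]
    exact ⟨fun h => ⟨Finset.mem_univ _, h⟩, fun h => h.2⟩
  have haA : a ∈ A := by simp [hA, ha]
  have hm : Measurable fun π : Equiv.Perm ι => a ∘ π := Measurable.of_discrete
  have : IsProbabilityMeasure ((permLaw ι).map fun π : Equiv.Perm ι => a ∘ π) :=
    Measure.isProbabilityMeasure_map hm.aemeasurable
  have hout : ∀ b ∉ A, (permLaw ι).map (fun π : Equiv.Perm ι => a ∘ π) {b} = 0 := by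
    intro b hb
    rw [Measure.map_apply hm (measurableSet_singleton b)]
    convert measure_empty (μ := permLaw ι)
    ext π
    simp only [Set.mem_preimage, Set.mem_singleton_iff, Set.mem_empty_iff_false, iff_false]
    intro h
    apply hb
    simp [hA, ← h, countZero_comp, ha]
  have hin : ∀ b ∈ A, (permLaw ι).map (fun π : Equiv.Perm ι => a ∘ π) {b} =
      (permLaw ι).map (fun π : Equiv.Perm ι => a ∘ π) {a} := by
    intro b hb
    simp only [hA, Finset.mem_filter, Finset.mem_univ, true_and] at hb
    obtain ⟨σ, hσ⟩ := exists_perm_of_countZero_eq (ha.trans hb.symm)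
    have hreal : ((permLaw ι).map (fun π : Equiv.Perm ι => a ∘ π)).real {b} =
        ((permLaw ι).map (fun π : Equiv.Perm ι => a ∘ π)).real {a} := by
      rw [map_measureReal_apply hm (measurableSet_singleton b),
        map_measureReal_apply hm (measurableSet_singleton a),
        ← integral_indicator_one (MeasurableSet.of_discrete),
        ← integral_indicator_one (MeasurableSet.of_discrete),
        ← integral_permLaw_mul_right _ σ]
      congr 1
      ext π
      have : (a ∘ ⇑(π * σ) = b) ↔ a ∘ π = a := by
        rw [hσ, Equiv.Perm.coe_mul, ← Function.comp_assoc]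
        exact σ.surjective.right_cancellable
      simp only [Set.indicator, Set.mem_preimage, Set.mem_singleton_iff, this]
      rfl
    rwa [measureReal_def, measureReal_def, ENNReal.toReal_eq_toReal_iff' (measure_ne_top _ _)
      (measure_ne_top _ _)] at hreal
  have htot : (A.card : ENNReal) * (permLaw ι).map (fun π : Equiv.Perm ι => a ∘ π) {a} = 1 := by
    have h1 : ∑ b, (permLaw ι).map (fun π : Equiv.Perm ι => a ∘ π) {b} = 1 := by
      rw [← measure_univ (μ := (permLaw ι).map fun π : Equiv.Perm ι => a ∘ π), ← Finset.coe_univ,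
        ← sum_measure_singleton]
    rw [← Finset.sum_subset (Finset.subset_univ A) (fun b _ hb => hout b hb),
      Finset.sum_congr rfl hin, Finset.sum_const, nsmul_eq_mul] at h1
    exact h1
  have hcard : (A.card : ENNReal) ≠ 0 := by
    exact_mod_cast (Finset.card_pos.2 ⟨a, haA⟩).ne'
  refine Measure.ext_of_singleton fun b => ?_
  have hu : labelUniform ι m {b} = if b ∈ A then (A.card : ENNReal)⁻¹ else 0 := by
    rw [labelUniform, hAset, ← Finset.coe_singleton, uniformOn_apply_finset]
    by_cases hb : b ∈ A
    · rw [if_pos hb, Finset.inter_singleton_of_mem hb]; simp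
    · rw [if_neg hb, Finset.inter_singleton_of_notMem hb]; simp
  rw [hu]
  by_cases hb : b ∈ A
  · rw [if_pos hb, hin b hb]
    exact ENNReal.eq_inv_of_mul_eq_one_left (by rwa [mul_comm])
  · rw [if_neg hb, hout b hb]

lemma integral_labelUniform {m : ℕ} {a : ι → Fin 2} (ha : countZero a = m) (g : (ι → Fin 2) → E) :
    ∫ lab, g lab ∂(labelUniform ι m) = ∫ π, g (a ∘ π) ∂(permLaw ι) := by
  rw [← map_permLaw_eq_labelUniform ha, integral_map
    (Measurable.of_discrete (f := fun π : Equiv.Perm ι => a ∘ π)).aemeasurable]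
  exact StronglyMeasurable.of_discrete.aestronglyMeasurable

/-- Class 1 of `b` is shrunk or enlarged to size `m`. As the sets are nested, the number of changed
labels equals the difference of their sizes. -/
lemma exists_countZero_eq {m : ℕ} (hm : m ≤ Fintype.card ι) (b : ι → Fin 2) :
    ∃ a : ι → Fin 2, countZero a = m ∧
      ∑ i, |ind (a i) - ind (b i)| = |∑ i, ind (b i) - m| := by
  set B : Finset ι := Finset.univ.filter fun k => b k = 0 with hB
  have h2 : ∀ x : Fin 2, x ≠ 0 → x = 1 := by decide
  have hbB : ∀ i, ind (b i) = if i ∈ B then 1 else 0 := fun i => by simp [hB, ind]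
  obtain ⟨A, hA, hAB⟩ : ∃ A : Finset ι, A.card = m ∧ (A ⊆ B ∨ B ⊆ A) := by
    by_cases h : m ≤ B.card
    · obtain ⟨A, hAB, hA⟩ := Finset.exists_subset_card_eq h
      exact ⟨A, hA, Or.inl hAB⟩
    · obtain ⟨A, hBA, -, hA⟩ := Finset.exists_subsuperset_card_eq (Finset.subset_univ B)
        (not_le.1 h).le (by rwa [Finset.card_univ])
      exact ⟨A, hA, Or.inr hBA⟩
  refine ⟨fun i => if i ∈ A then 0 else 1, ?_, ?_⟩
  · rw [← hA, countZero]
    congr 1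
    ext i
    simp
  · have haA : ∀ i, ind (if i ∈ A then 0 else 1) = if i ∈ A then 1 else 0 := fun i => by
      split <;> simp
    have hs : (m : ℝ) = ∑ i, ind (if i ∈ A then 0 else 1) := by
      simp_rw [haA]; simp [hA]
    rw [hs, ← Finset.sum_sub_distrib]
    rcases hAB with h | h
    · rw [abs_of_nonneg]
      · refine Finset.sum_congr rfl fun i _ => ?_
        rw [abs_sub_comm, abs_of_nonneg]
        rw [haA, hbB]
        by_cases hi : i ∈ A
        · simp [hi, h hi]
        · simp only [hi, if_false]; split <;> norm_num
      · refine Finset.sum_nonneg fun i _ => ?_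
        rw [haA, hbB]
        by_cases hi : i ∈ A
        · simp [hi, h hi]
        · simp only [hi, if_false]; split <;> norm_num
    · rw [abs_of_nonpos]
      · rw [← Finset.sum_neg_distrib]
        refine Finset.sum_congr rfl fun i _ => ?_
        rw [neg_sub, abs_of_nonneg]
        rw [haA, hbB]
        by_cases hi : i ∈ B
        · simp [hi, h hi]
        · simp only [hi, if_false]; split <;> norm_num
      · refine Finset.sum_nonpos fun i _ => ?_
        rw [haA, hbB]
        by_cases hi : i ∈ B
        · simp [hi, h hi]
        · simp only [hi, if_false]; split <;> norm_num

lemma measurePreserving_comp_perm {α : Type*} [MeasurableSpace α] (μ : Measure α)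
    [IsProbabilityMeasure μ] (π : Equiv.Perm ι) :
    MeasurePreserving (fun x : ι → α => x ∘ π) (Measure.pi fun _ => μ) (Measure.pi fun _ => μ) := by
  have hm : Measurable fun x : ι → α => x ∘ π :=
    measurable_pi_lambda _ fun i => measurable_pi_apply (π i)
  refine ⟨hm, (Measure.pi_eq fun s hs => ?_).symm⟩
  rw [Measure.map_apply hm (MeasurableSet.univ_pi hs)]
  have : (fun x : ι → α => x ∘ π) ⁻¹' Set.univ.pi s = Set.univ.pi fun i => s (π.symm i) := by
    ext x
    simp only [Set.mem_preimage, Set.mem_pi, Set.mem_univ, true_implies, Function.comp]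
    exact ⟨fun h i => by simpa using h (π.symm i), fun h i => by simpa using h (π i)⟩
  rw [this, Measure.pi_pi]
  exact Equiv.prod_comp π.symm fun i => μ (s i)

/-- An i.i.d. sample may be shuffled by an independent random permutation. This serves both to
couple i.i.d. with random labels and to exchange locations. -/
lemma integral_pi_comp_perm {α : Type*} [MeasurableSpace α] (μ : Measure α)
    [IsProbabilityMeasure μ] {g : (ι → α) → E} (hg : Integrable g (Measure.pi fun _ => μ)) :
    ∫ x, g x ∂(Measure.pi fun _ => μ) =
      ∫ π, ∫ x, g (x ∘ π) ∂(Measure.pi fun _ => μ) ∂(permLaw ι) := by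
  have h : ∀ π : Equiv.Perm ι, ∫ x, g (x ∘ π) ∂(Measure.pi fun _ => μ) =
      ∫ x, g x ∂(Measure.pi fun _ => μ) := by
    intro π
    have hp := measurePreserving_comp_perm μ π
    conv_rhs => rw [← hp.map_eq]
    rw [integral_map hp.measurable.aemeasurable]
    rw [hp.map_eq]; exact hg.aestronglyMeasurable
  simp [h]

end Labels

/-! ### The quadratic form of a nearest neighbour map for independent labels -/

section Slope

variable {ι : Type*} [Fintype ι] [DecidableEq ι] {f : ι → ι}

/-- The partial derivative of `nnForm f` in coordinate `k`. -/
def nnSlope (f : ι → ι) (u : ι → ℝ) (k : ι) : ℝ := u (f k) + ∑ j, if f j = k then u j else 0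

/-- The number of `f`-arrows between `k` and `j`. -/
def nnAdj (f : ι → ι) (k j : ι) : ℝ := (if f k = j then 1 else 0) + if f j = k then 1 else 0

lemma nnAdj_nonneg (k j : ι) : 0 ≤ nnAdj f k j := by
  unfold nnAdj; split <;> split <;> norm_num

lemma nnAdj_comm (k j : ι) : nnAdj f k j = nnAdj f j k := by
  unfold nnAdj; rw [add_comm]

lemma nnSlope_eq_sum (u : ι → ℝ) (k : ι) : nnSlope f u k = ∑ j, nnAdj f k j * u j := by
  simp only [nnSlope, nnAdj, add_mul, Finset.sum_add_distrib]
  simp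

lemma GoodMap.sum_nnAdj_le (hf : GoodMap f) (k : ι) : ∑ j, nnAdj f k j ≤ 26 := by
  simp only [nnAdj, Finset.sum_add_distrib]
  rw [← Finset.natCast_card_filter (fun j => f j = k)]
  have h1 : ((Finset.univ.filter fun j => f j = k).card : ℝ) ≤ 25 := by
    exact_mod_cast hf.card_fiber_le k
  simp only [Finset.sum_ite_eq, Finset.mem_univ, if_true]
  linarith

/-- Reflexive pairs enter here: a double arrow gives an entry 2 of square 4, twice what two single
arrows would give. -/
lemma sum_sum_nnAdj_sq : ∑ k, ∑ j, nnAdj f k j ^ 2 = 2 * ((Fintype.card ι : ℝ) +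
    (Finset.univ.filter fun i => f (f i) = i).card) := by
  have h : ∀ k j, nnAdj f k j ^ 2 = (if f k = j then 1 else 0) + (if f j = k then 1 else 0) +
      2 * if f k = j ∧ f j = k then 1 else 0 := by
    intro k j
    unfold nnAdj
    by_cases h1 : f k = j <;> by_cases h2 : f j = k <;> (simp [h1, h2]; try norm_num)
  simp_rw [h, Finset.sum_add_distrib, ← Finset.mul_sum]
  have e1 : ∑ k, ∑ j, (if f k = j then (1 : ℝ) else 0) = Fintype.card ι := by simp
  have e2 : ∑ k, ∑ j, (if f j = k then (1 : ℝ) else 0) = Fintype.card ι := by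
    rw [Finset.sum_comm]; simp
  have e3 : ∑ k, ∑ j, (if f k = j ∧ f j = k then (1 : ℝ) else 0) =
      (Finset.univ.filter fun i => f (f i) = i).card := by
    rw [Finset.natCast_card_filter]
    refine Finset.sum_congr rfl fun k _ => ?_
    rw [Finset.sum_eq_single (f k)]
    · simp
    · intro j _ hj; simp [hj.symm]
    · simp
  rw [e1, e2, e3]
  ring

lemma nnSlope_update (u : ι → ℝ) (j k : ι) (z : ℝ) :
    nnSlope f (Function.update u j z) k = nnSlope f u k + nnAdj f k j * (z - u j) := by
  rw [nnSlope_eq_sum, nnSlope_eq_sum, ← Finset.add_sum_erase _ _ (Finset.mem_univ j),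
    ← Finset.add_sum_erase _ (fun i => nnAdj f k i * u i) (Finset.mem_univ j),
    Function.update_self]
  have : ∑ i ∈ Finset.univ.erase j, nnAdj f k i * Function.update u j z i =
      ∑ i ∈ Finset.univ.erase j, nnAdj f k i * u i :=
    Finset.sum_congr rfl fun i hi => by rw [Function.update_of_ne (Finset.ne_of_mem_erase hi)]
  rw [this]
  ring

lemma GoodMap.nnAdj_self (hf : GoodMap f) (k : ι) : nnAdj f k k = 0 := by
  simp [nnAdj, hf.ne k]

/-- Euler's identity for a homogeneous form of degree 2; it is the reason for c = 2 in the normal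
approximation. -/
lemma sum_mul_nnSlope (u : ι → ℝ) : ∑ k, u k * nnSlope f u k = 2 * nnForm f u := by
  simp only [nnSlope, mul_add, Finset.sum_add_distrib, Finset.mul_sum, nnForm]
  rw [Finset.sum_comm (γ := ι)]
  have : ∀ i, ∑ k, u k * (if f i = k then u i else 0) = u i * u (f i) := fun i => by
    simp [mul_comm]
  simp_rw [this]
  rw [← Finset.mul_sum]
  ring

lemma GoodMap.abs_nnSlope_le (hf : GoodMap f) {u : ι → ℝ} (hu : ∀ i, |u i| ≤ 1) (k : ι) :
    |nnSlope f u k| ≤ 26 := by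
  rw [nnSlope_eq_sum]
  refine (Finset.abs_sum_le_sum_abs _ _).trans (le_trans (Finset.sum_le_sum fun j _ => ?_)
    (hf.sum_nnAdj_le k))
  rw [abs_mul, abs_of_nonneg (nnAdj_nonneg k j)]
  exact mul_le_of_le_one_right (nnAdj_nonneg k j) (hu j)

/-- Without fixed points the form has no square terms, so it is affine in each coordinate. The
identity is read off from Euler's identity at both arguments. -/
lemma GoodMap.nnForm_update (hf : GoodMap f) (u : ι → ℝ) (k : ι) (z : ℝ) :
    nnForm f (Function.update u k z) - z * nnSlope f u k = nnForm f u - u k * nnSlope f u k := by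
  have h := sum_mul_nnSlope (f := f) (Function.update u k z)
  have h' := sum_mul_nnSlope (f := f) u
  simp_rw [nnSlope_update, mul_add, Finset.sum_add_distrib] at h
  have e1 : ∑ i, Function.update u k z i * nnSlope f u i =
      ∑ i, u i * nnSlope f u i + (z - u k) * nnSlope f u k := by
    rw [← Finset.add_sum_erase _ _ (Finset.mem_univ k),
      ← Finset.add_sum_erase _ (fun i => u i * nnSlope f u i) (Finset.mem_univ k),
      Function.update_self]
    have : ∑ i ∈ Finset.univ.erase k, Function.update u k z i * nnSlope f u i =
        ∑ i ∈ Finset.univ.erase k, u i * nnSlope f u i :=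
      Finset.sum_congr rfl fun i hi => by rw [Function.update_of_ne (Finset.ne_of_mem_erase hi)]
    rw [this]
    ring
  have e2 : ∑ i, Function.update u k z i * (nnAdj f i k * (z - u k)) =
      (z - u k) * nnSlope f u k := by
    rw [nnSlope_eq_sum, Finset.mul_sum]
    refine Finset.sum_congr rfl fun i _ => ?_
    by_cases hi : i = k
    · subst hi; simp [hf.nnAdj_self]
    · rw [Function.update_of_ne hi, nnAdj_comm]; ring
  rw [e1, e2, h'] at h
  linarith

/-- Only the slopes at neighbours of `j` move. Slopes are at most 26, so each square changes by at
most 52 times the adjacency, and adjacencies sum to at most 26: 1352 = 26 · 52. -/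
lemma GoodMap.abs_sum_nnSlope_sq_update_le (hf : GoodMap f) {u : ι → ℝ} (hu : ∀ i, |u i| ≤ 1)
    (j : ι) {z : ℝ} (hz : |z| ≤ 1) (hzu : |z - u j| ≤ 1) :
    |∑ k, nnSlope f u k ^ 2 - ∑ k, nnSlope f (Function.update u j z) k ^ 2| ≤ 1352 := by
  rw [← Finset.sum_sub_distrib]
  refine (Finset.abs_sum_le_sum_abs _ _).trans ?_
  have hu' : ∀ i, |Function.update u j z i| ≤ 1 := fun i => by
    by_cases hi : i = j
    · subst hi; simpa using hz
    · simpa [Function.update_of_ne hi] using hu i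
  have h : ∀ k, |nnSlope f u k ^ 2 - nnSlope f (Function.update u j z) k ^ 2| ≤
      nnAdj f j k * 52 := by
    intro k
    have e : nnSlope f u k ^ 2 - nnSlope f (Function.update u j z) k ^ 2 =
        -(nnAdj f k j * (z - u j)) * (nnSlope f u k + nnSlope f (Function.update u j z) k) := by
      rw [nnSlope_update]; ring
    rw [e, abs_mul, abs_neg, abs_mul, abs_of_nonneg (nnAdj_nonneg k j), nnAdj_comm]
    have h1 := hf.abs_nnSlope_le hu k
    have h2 := hf.abs_nnSlope_le hu' k
    have h3 := abs_add_le (nnSlope f u k) (nnSlope f (Function.update u j z) k)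
    exact mul_le_mul (mul_le_of_le_one_right (nnAdj_nonneg j k) hzu) (by linarith) (abs_nonneg _)
      (nnAdj_nonneg j k)
  refine (Finset.sum_le_sum fun k _ => h k).trans ?_
  rw [← Finset.sum_mul]
  linarith [hf.sum_nnAdj_le j]

end Slope

/-! ### Normal approximation for i.i.d. labels and its transfer to random labelling -/

section IID

variable {ι : Type*} [Fintype ι] [DecidableEq ι]

lemma integral_coord_mul_real {α : Type*} [MeasurableSpace α] [Finite α]
    [MeasurableSingletonClass α] {μ : ι → Measure α} [∀ i, IsProbabilityMeasure (μ i)]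
    (k : ι) (F : α → ℝ) {B : (ι → α) → ℝ} (hB : ∀ x y, B (Function.update x k y) = B x) :
    ∫ x, F (x k) * B x ∂(Measure.pi μ) = (∫ y, F y ∂(μ k)) * ∫ x, B x ∂(Measure.pi μ) := by
  rw [← integral_update μ k Integrable.of_finite]
  simp_rw [Function.update_self, hB, integral_mul_const]
  rw [integral_const_mul]

lemma integral_coord {α : Type*} [MeasurableSpace α] [Finite α]
    [MeasurableSingletonClass α] {μ : ι → Measure α} [∀ i, IsProbabilityMeasure (μ i)]
    (k : ι) (F : α → ℝ) : ∫ x, F (x k) ∂(Measure.pi μ) = ∫ y, F y ∂(μ k) := by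
  simpa using integral_coord_mul_real (μ := μ) k F (B := fun _ => 1) (fun _ _ => rfl)

/-- The second moment of a sum of independent centered variables. -/
lemma integral_sum_coord_sq {α : Type*} [MeasurableSpace α] [Finite α]
    [MeasurableSingletonClass α] {μ : ι → Measure α} [∀ i, IsProbabilityMeasure (μ i)]
    {Y : ι → α → ℝ} (hY : ∀ k, ∫ y, Y k y ∂(μ k) = 0) :
    ∫ x, (∑ k, Y k (x k)) ^ 2 ∂(Measure.pi μ) = ∑ k, ∫ y, Y k y ^ 2 ∂(μ k) := by
  simp_rw [pow_two, Finset.sum_mul_sum]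
  rw [integral_finsetSum _ fun _ _ => Integrable.of_finite]
  refine Finset.sum_congr rfl fun i _ => ?_
  rw [integral_finsetSum _ fun _ _ => Integrable.of_finite, Finset.sum_eq_single i]
  · exact integral_coord i fun y => Y i y * Y i y
  · intro j _ hj
    rw [integral_coord_mul_real i (Y i) (fun x y => by rw [Function.update_of_ne hj]), hY, zero_mul]
  · simp

variable {ν v : ℝ} (f : ι → ι)

/-- The centered class 1 indicators of the labels. -/
def ctr (ν : ℝ) (x : ι → Fin 2) (i : ι) : ℝ := ind (x i) - ν

lemma ctr_update (x : ι → Fin 2) (k : ι) (y : Fin 2) :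
    ctr ν (Function.update x k y) = Function.update (ctr ν x) k (ind y - ν) := by
  funext i
  by_cases hi : i = k
  · subst hi; simp [ctr]
  · simp [ctr, Function.update_of_ne hi]

lemma abs_ind_sub_le (h0 : 0 ≤ ν) (h1 : ν ≤ 1) (y : Fin 2) : |ind y - ν| ≤ 1 := by
  rw [abs_le]; constructor <;> linarith [ind_nonneg y, ind_le_one y]

lemma integral_ind_sub (h0 : 0 ≤ ν) (h1 : ν ≤ 1) : ∫ y, (ind y - ν) ∂(labelLaw ν) = 0 := by
  rw [integral_labelLaw h0 h1]; simp; ring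

lemma integral_ind_sub_sq (h0 : 0 ≤ ν) (h1 : ν ≤ 1) :
    ∫ y, (ind y - ν) ^ 2 ∂(labelLaw ν) = ν * (1 - ν) := by
  rw [integral_labelLaw h0 h1]; simp; ring

lemma integral_sum_mul_ctr_sq (h0 : 0 ≤ ν) (h1 : ν ≤ 1) (c : ι → ℝ) :
    ∫ x, (∑ k, c k * ctr ν x k) ^ 2 ∂(Measure.pi fun _ : ι => labelLaw ν) =
      ν * (1 - ν) * ∑ k, c k ^ 2 := by
  have := isProbabilityMeasure_labelLaw h0 h1
  have h := integral_sum_coord_sq (μ := fun _ : ι => labelLaw ν)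
    (Y := fun k y => c k * (ind y - ν)) (fun k => by
      rw [integral_const_mul, integral_ind_sub h0 h1, mul_zero])
  simp_rw [mul_pow, integral_const_mul, integral_ind_sub_sq h0 h1] at h
  rw [Finset.mul_sum]
  simp_rw [mul_comm (ν * (1 - ν))]
  exact h

variable {f}

/-- Normal approximation for the quadratic form of independent labels. -/
theorem norm_charFn_nnForm_sub_le (hf : GoodMap f) (h0 : 0 ≤ ν) (h1 : ν ≤ 1) (hv : v = ν * (1 - ν))
    (hv0 : 0 < v) (hn : 1 ≤ Fintype.card ι) {S : ℝ} (hS : S = v * √((Fintype.card ι : ℝ) +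
      (Finset.univ.filter fun i => f (f i) = i).card)) (t : ℝ) :
    ‖charFn (Measure.pi fun _ : ι => labelLaw ν) (fun x => nnForm f (ctr ν x) / S) t -
      (Real.exp (-t ^ 2 / 2) : ℝ)‖ ≤
      (1000 / (v * √(Fintype.card ι)) * |t| + 2 * (26 / (v * √(Fintype.card ι))) *
        (1 + 1000 / (v * √(Fintype.card ι))) * t ^ 2) * |t| := by
  have := isProbabilityMeasure_labelLaw h0 h1
  set P := Measure.pi fun _ : ι => labelLaw ν with hP
  set n : ℝ := (Fintype.card ι : ℝ) with hndef
  set R : ℝ := ((Finset.univ.filter fun i => f (f i) = i).card : ℝ) with hR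
  have hn' : (1 : ℝ) ≤ n := by rw [hndef]; exact_mod_cast hn
  have hR0 : 0 ≤ R := Nat.cast_nonneg _
  have hsn : 0 < √n := Real.sqrt_pos.2 (by linarith)
  have hS1 : v * √n ≤ S := by
    rw [hS]; gcongr; linarith
  have hS0 : 0 < S := lt_of_lt_of_le (by positivity) hS1
  have hS2 : S ^ 2 = v ^ 2 * (n + R) := by
    rw [hS, mul_pow, Real.sq_sqrt (by linarith)]
  have hctr : ∀ x : ι → Fin 2, ∀ i, |ctr ν x i| ≤ 1 := fun x i => abs_ind_sub_le h0 h1 _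
  set Q : (ι → Fin 2) → ℝ := fun x => ∑ k, nnSlope f (ctr ν x) k ^ 2 with hQ
  -- Each slope is a linear combination of independent centred labels, so its second moment is v
  -- times a row sum of squared adjacencies.
  have hEQ : ∫ x, Q x ∂P = v * (2 * (n + R)) := by
    rw [hQ, integral_finsetSum _ fun _ _ => Integrable.of_finite, ← sum_sum_nnAdj_sq (f := f),
      Finset.mul_sum]
    refine Finset.sum_congr rfl fun k _ => ?_
    simp_rw [nnSlope_eq_sum]
    rw [integral_sum_mul_ctr_sq h0 h1, hv]
  -- Efron–Stein with influences at most 1352²; half of 1352² is below 1000².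
  have hVar : variance Q P ≤ n * 1000 ^ 2 := by
    refine (variance_pi_le_sum_influence (BddMeas.of_finite Q)).trans ?_
    have hinf : ∀ k, influence (fun _ : ι => labelLaw ν) k Q ≤ 1352 ^ 2 := by
      intro k
      have hb : ∀ x y, |(Q x - Q (Function.update x k y)) ^ 2| ≤ 1352 ^ 2 := by
        intro x y
        rw [abs_pow]
        refine pow_le_pow_left₀ (abs_nonneg _) ?_ 2
        simp only [hQ, ctr_update]
        refine hf.abs_sum_nnSlope_sq_update_le (hctr x) k (abs_ind_sub_le h0 h1 y) ?_
        simp only [ctr]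
        rw [abs_le]
        constructor <;> linarith [ind_nonneg y, ind_le_one y, ind_nonneg (x k), ind_le_one (x k)]
      refine (le_abs_self _).trans (abs_integral_le_of_abs_le fun x => ?_)
      exact abs_integral_le_of_abs_le fun y => hb x y
    have := Finset.sum_le_sum fun k (_ : k ∈ Finset.univ) => hinf k
    rw [Finset.sum_const, Finset.card_univ, nsmul_eq_mul, ← hndef] at this
    linarith
  -- The scale S² = v² (n + R) makes the conditional variance have mean exactly 2, and the
  -- fluctuation of Q is smaller by the order √n.
  have hV : ∫ x, |(∑ k, (∫ y, (ind y - ν) ^ 2 ∂(labelLaw ν)) *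
      (nnSlope f (ctr ν x) k / S) ^ 2) - 2| ∂P ≤ 1000 / (v * √n) := by
    have e : ∀ x, (∑ k, (∫ y, (ind y - ν) ^ 2 ∂(labelLaw ν)) *
      (nnSlope f (ctr ν x) k / S) ^ 2) - 2 = (v / S ^ 2) * (Q x - ∫ x, Q x ∂P) := by
      intro x
      rw [integral_ind_sub_sq h0 h1, ← hv, hEQ, ← Finset.mul_sum]
      simp_rw [div_pow]
      rw [← Finset.sum_div, mul_sub, hS2]
      have : n + R ≠ 0 := by linarith
      field_simp
      rfl
    simp_rw [e, abs_mul]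
    rw [integral_const_mul, abs_of_nonneg (by positivity)]
    have h2 : ∫ x, |Q x - ∫ x, Q x ∂P| ∂P ≤ √(n * 1000 ^ 2) := by
      refine Real.le_sqrt_of_sq_le (le_trans (sq_integral_le (BddMeas.of_finite _) _) ?_)
      simp only [sq_abs]
      rw [← variance_eq_integral (BddMeas.of_finite Q).1.aemeasurable]
      exact hVar
    rw [Real.sqrt_mul (by linarith), Real.sqrt_sq (by norm_num)] at h2
    calc v / S ^ 2 * ∫ x, |Q x - ∫ x, Q x ∂P| ∂P ≤ v / (v * √n) ^ 2 * (√n * 1000) := by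
          gcongr
      _ = 1000 / (v * √n) := by field_simp
  have key := norm_charFn_sub_le_of_multilinear (μ := fun _ : ι => labelLaw ν)
    (Y := fun _ y => ind y - ν) (L := fun k x => nnSlope f (ctr ν x) k / S)
    (W := fun x => nnForm f (ctr ν x) / S) (c := 2) (η := 26 / (v * √n)) (ε := 1000 / (v * √n))
    (by norm_num) (by positivity) (by positivity) ?_ ?_ ?_ (fun k => integral_ind_sub h0 h1) ?_
    hV t
  · exact key
  · intro k x y
    rw [ctr_update, nnSlope_update, hf.nnAdj_self]
    ring
  · intro k x y
    have h := hf.nnForm_update (ctr ν x) k (ind y - ν)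
    rw [ctr_update, mul_div_assoc', mul_div_assoc', ← sub_div, ← sub_div, h]
    rfl
  · intro x
    simp_rw [mul_div_assoc']
    rw [← Finset.sum_div]
    congr 1
    exact (sum_mul_nnSlope (ctr ν x)).symm
  · intro k x
    rw [mul_div_assoc', abs_div, abs_mul, abs_of_pos hS0]
    have h2 : |ind (x k) - ν| * |nnSlope f (ctr ν x) k| ≤ 26 :=
      (mul_le_mul (abs_ind_sub_le h0 h1 _) (hf.abs_nnSlope_le (hctr x) k) (abs_nonneg _)
        zero_le_one).trans (by norm_num)
    gcongr

lemma norm_cexp_sub_cexp_le (a b : ℝ) :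
    ‖Complex.exp (a * Complex.I) - Complex.exp (b * Complex.I)‖ ≤ |a - b| := by
  have : Complex.exp (a * Complex.I) - Complex.exp (b * Complex.I) =
      Complex.exp (b * Complex.I) * (Complex.exp ((a - b : ℝ) * Complex.I) - 1) := by
    rw [mul_sub, ← Complex.exp_add, mul_one]
    congr 2
    push_cast
    ring
  rw [this, norm_mul, Complex.norm_exp_ofReal_mul_I, one_mul]
  exact norm_cexp_mul_I_sub_one_le _

lemma isProbabilityMeasure_labelUniform {m : ℕ} (hm : m ≤ Fintype.card ι) :
    IsProbabilityMeasure (labelUniform ι m) := by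
  obtain ⟨a, ha, -⟩ := exists_countZero_eq hm (fun _ : ι => 0)
  rw [← map_permLaw_eq_labelUniform ha]
  exact Measure.isProbabilityMeasure_map Measurable.of_discrete.aemeasurable

/-- The quadratic form has nearly the same characteristic function under random labelling and for
independent labels. -/
theorem norm_charFn_labelUniform_sub_le (hf : GoodMap f) {m : ℕ} (hm : m ≤ Fintype.card ι)
    (hn : 6 ≤ Fintype.card ι) (hν : ν = m / Fintype.card ι) {S : ℝ} (hS0 : 0 < S) (t : ℝ) :
    ‖charFn (labelUniform ι m) (fun x => nnForm f (ctr ν x) / S) t -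
      charFn (Measure.pi fun _ : ι => labelLaw ν) (fun x => nnForm f (ctr ν x) / S) t‖ ≤
      |t| / S * (2 * √(52 * √(Fintype.card ι) + 12) + 2) := by
  have hn' : (6 : ℝ) ≤ Fintype.card ι := by exact_mod_cast hn
  set n : ℝ := (Fintype.card ι : ℝ) with hndef
  have hmn : (m : ℝ) ≤ n := by rw [hndef]; exact_mod_cast hm
  have h0 : 0 ≤ ν := by rw [hν]; positivity
  have h1 : ν ≤ 1 := by rw [hν]; exact div_le_one_of_le₀ hmn (by linarith)
  have hνn : n * ν = m := by rw [hν, mul_div_cancel₀ _ (by linarith)]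
  have := isProbabilityMeasure_labelLaw h0 h1
  have := isProbabilityMeasure_labelUniform (ι := ι) hm
  set P := Measure.pi fun _ : ι => labelLaw ν with hP
  -- The coupling: `b` is i.i.d., `a b` is a closest labelling with the prescribed class size, and
  -- both are shuffled by the same random permutation, which makes the first i.i.d. again and the
  -- second a random labelling.
  choose a ha hab using exists_countZero_eq (ι := ι) hm
  set e : (ι → Fin 2) → ℂ := fun x =>
    Complex.exp (t * (nnForm f (ctr ν x) / S : ℝ) * Complex.I) with he
  have c1 : charFn (labelUniform ι m) (fun x => nnForm f (ctr ν x) / S) t =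
      ∫ b, ∫ π, e (a b ∘ π) ∂(permLaw ι) ∂P := by
    have h : ∀ b, ∫ π, e (a b ∘ π) ∂(permLaw ι) =
        charFn (labelUniform ι m) (fun x => nnForm f (ctr ν x) / S) t := fun b =>
      (integral_labelUniform (ha b) e).symm
    simp_rw [h]
    simp
  have c2 : charFn P (fun x => nnForm f (ctr ν x) / S) t =
      ∫ b, ∫ π, e (b ∘ π) ∂(permLaw ι) ∂P := by
    rw [integral_integral_swap Integrable.of_finite]
    exact integral_pi_comp_perm (labelLaw ν) Integrable.of_finite
  rw [c1, c2, ← integral_sub Integrable.of_finite Integrable.of_finite]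
  simp_rw [← integral_sub (Integrable.of_finite (μ := permLaw ι))
    (Integrable.of_finite (μ := permLaw ι))]
  set d : (ι → Fin 2) → ℝ := fun b => ∑ i, |ind (a b i) - ind (b i)| with hd
  -- The number of changed labels is the distance of a binomial count from its mean `m`, so its
  -- second moment is n ν (1 - ν).
  have hd2 : ∫ b, d b ^ 2 ∂P ≤ n := by
    have h := integral_sum_mul_ctr_sq (ι := ι) h0 h1 (fun _ => 1)
    simp only [one_mul, one_pow, Finset.sum_const, Finset.card_univ, nsmul_eq_mul, mul_one,
      ← hndef] at h
    have h2 : ∀ b, d b ^ 2 = (∑ k, ctr ν b k) ^ 2 := by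
      intro b
      simp only [hd]
      rw [hab, sq_abs]
      simp only [ctr]
      rw [Finset.sum_sub_distrib, Finset.sum_const, Finset.card_univ, nsmul_eq_mul, ← hndef, hνn]
    simp_rw [h2]
    rw [h]
    nlinarith
  have hd1 : ∫ b, d b ∂P ≤ √n :=
    Real.le_sqrt_of_sq_le ((sq_integral_le (BddMeas.of_finite d) P).trans hd2)
  set q : (ι → Fin 2) → ℝ := fun b => 52 * d b + 12 * d b ^ 2 / n with hq
  have hd0 : ∀ b, 0 ≤ d b := fun b => Finset.sum_nonneg fun i _ => abs_nonneg _
  have hq0 : ∀ b, 0 ≤ q b := fun b => by have := hd0 b; positivity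
  have hdn : (∫ b, d b ^ 2 ∂P) / n ≤ 1 := div_le_one_of_le₀ hd2 (by linarith)
  have hqE : ∫ b, √(q b) ∂P ≤ √(52 * √n + 12) := by
    refine Real.le_sqrt_of_sq_le ((sq_integral_le (BddMeas.of_finite _) P).trans ?_)
    simp_rw [Real.sq_sqrt (hq0 _)]
    simp only [hq]
    rw [integral_add Integrable.of_finite Integrable.of_finite, integral_const_mul]
    simp_rw [mul_div_assoc]
    rw [integral_const_mul, integral_div]
    linarith
  have hinner : ∀ b, ‖∫ π, (e (a b ∘ π) - e (b ∘ π)) ∂(permLaw ι)‖ ≤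
      |t| / S * (2 * √(q b) + 2 * (d b ^ 2 / n)) := by
    intro b
    have h2 : ∀ π : Equiv.Perm ι, ‖e (a b ∘ π) - e (b ∘ π)‖ ≤ |t| / S *
        |nnForm f (fun i => ctr ν (a b) (π i)) - nnForm f (fun i => ctr ν b (π i))| := by
      intro π
      simp only [he]
      rw [← Complex.ofReal_mul, ← Complex.ofReal_mul]
      refine (norm_cexp_sub_cexp_le _ _).trans (le_of_eq ?_)
      rw [← mul_sub, ← sub_div, abs_mul, abs_div, abs_of_pos hS0]
      change |t| * (|nnForm f (fun i => ctr ν (a b) (π i)) -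
        nnForm f (fun i => ctr ν b (π i))| / S) = _
      ring
    refine (norm_integral_le_of_norm_le Integrable.of_finite (Eventually.of_forall h2)).trans ?_
    rw [integral_const_mul]
    have h3 := integral_permLaw_abs_nnForm_sub_le hf (a := ctr ν (a b)) (b := ctr ν b) ?_
      (fun i => abs_ind_sub_le h0 h1 _) ?_ hn (d := d b) ?_
    · rw [← hndef, mul_div_assoc 2] at h3
      gcongr
    · simp only [ctr]
      rw [Finset.sum_sub_distrib, ← countZero_eq_sum, ha, Finset.sum_const, Finset.card_univ,
        nsmul_eq_mul, ← hndef, hνn, sub_self]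
    · intro i
      simp only [ctr]
      rw [abs_le]
      constructor <;>
      linarith [ind_nonneg (a b i), ind_le_one (a b i), ind_nonneg (b i), ind_le_one (b i)]
    · simp [hd, ctr]
  refine (norm_integral_le_of_norm_le Integrable.of_finite (Eventually.of_forall hinner)).trans ?_
  rw [integral_const_mul, integral_add Integrable.of_finite Integrable.of_finite,
    integral_const_mul, integral_const_mul, integral_div]
  gcongr
  linarith

end IID

/-! ### Random samples of (base, NN) pairs -/

lemma variance_le_integral_sub_sq {β : Type*} [MeasurableSpace β] {h : β → ℝ} (hh : BddMeas h)
    (P : Measure β) [IsProbabilityMeasure P] (c : ℝ) : variance h P ≤ ∫ x, (h x - c) ^ 2 ∂P := by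
  rw [← variance_sub_const hh.1.aestronglyMeasurable c]
  exact variance_le_expectation_sq (hh.1.sub_const c).aestronglyMeasurable

/-- A chi-factor `√(v / (c (1 - c)))` tends to one if `c` tends to `p` and `v = p (1 - p)`. -/
lemma TendstoInProb.sqrt_factor {κ : Type*} {l : Filter κ} {Ω : κ → Type*}
    [∀ k, MeasurableSpace (Ω k)] {P : ∀ k, Measure (Ω k)} [∀ k, IsProbabilityMeasure (P k)]
    {C : ∀ k, Ω k → ℝ} {p : ℝ} (hC : TendstoInProb l P C p) (h0 : 0 < p) (h1 : p < 1) :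
    TendstoInProb l P (fun k ω => √(p * (1 - p) / (C k ω * (1 - C k ω)))) 1 := by
  have hv : 0 < p * (1 - p) := mul_pos h0 (by linarith)
  have hg : ContinuousAt (fun c : ℝ => √(p * (1 - p) / (c * (1 - c)))) p := by
    refine ContinuousAt.sqrt (ContinuousAt.div ?_ ?_ hv.ne') <;> fun_prop
  have := hC.comp_continuousAt hg
  simpa [div_self hv.ne'] using this

/-! ### The row-wise binomial framework -/

section Rowwise

variable {n₁ n₂ : ℕ} {p₁ p₂ : ℝ}

lemma isProbabilityMeasure_rowwiseLaw (h0 : 0 ≤ p₁) (h1 : p₁ ≤ 1) (h0' : 0 ≤ p₂) (h1' : p₂ ≤ 1) :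
    IsProbabilityMeasure (rowwiseLaw n₁ n₂ p₁ p₂) := by
  have := isProbabilityMeasure_labelLaw h0 h1
  have := isProbabilityMeasure_labelLaw h0' h1'
  unfold rowwiseLaw
  infer_instance

/-- The law of the NN label of a pair in the row-wise framework. -/
def rowwiseLabelLaw (n₁ n₂ : ℕ) (p₁ p₂ : ℝ) : Fin n₁ ⊕ Fin n₂ → Measure (Fin 2) :=
  Sum.elim (fun _ => labelLaw p₁) fun _ => labelLaw p₂

lemma isProbabilityMeasure_rowwiseLabelLaw (h0 : 0 ≤ p₁) (h1 : p₁ ≤ 1) (h0' : 0 ≤ p₂)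
    (h1' : p₂ ≤ 1) (k : Fin n₁ ⊕ Fin n₂) : IsProbabilityMeasure (rowwiseLabelLaw n₁ n₂ p₁ p₂ k) := by
  rcases k with k | k
  · exact isProbabilityMeasure_labelLaw h0 h1
  · exact isProbabilityMeasure_labelLaw h0' h1'

lemma integral_rowwiseLaw {E : Type*} [NormedAddCommGroup E] [NormedSpace ℝ E]
    (h0 : 0 ≤ p₁) (h1 : p₁ ≤ 1) (h0' : 0 ≤ p₂)
    (h1' : p₂ ≤ 1) (g : (Fin n₁ → Fin 2) × (Fin n₂ → Fin 2) → E) :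
    ∫ s, g s ∂(rowwiseLaw n₁ n₂ p₁ p₂) =
      ∫ x, g (fun i => x (.inl i), fun j => x (.inr j))
        ∂(Measure.pi (rowwiseLabelLaw n₁ n₂ p₁ p₂)) := by
  have := isProbabilityMeasure_rowwiseLabelLaw (n₁ := n₁) (n₂ := n₂) h0 h1 h0' h1'
  have h := measurePreserving_sumPiEquivProdPi (rowwiseLabelLaw n₁ n₂ p₁ p₂)
  exact (h.integral_comp (MeasurableEquiv.measurableEmbedding _) g).symm

lemma rowwiseTable_rowSum_zero (s : (Fin n₁ → Fin 2) × (Fin n₂ → Fin 2)) :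
    (rowwiseTable s).rowSum 0 = n₁ := by
  have : ((rowwiseTable s).rowSum 0 : ℝ) = n₁ := by
    rw [rowwiseTable, nnct_rowSum_zero, Fintype.sum_sum_type]; simp
  exact_mod_cast this

lemma rowwiseTable_rowSum_one (s : (Fin n₁ → Fin 2) × (Fin n₂ → Fin 2)) :
    (rowwiseTable s).rowSum 1 = n₂ := by
  have : ((rowwiseTable s).rowSum 1 : ℝ) = n₂ := by
    rw [rowwiseTable, nnct_rowSum_one, Fintype.sum_sum_type]; simp
  exact_mod_cast this

lemma diffT_rowwiseTable (s : (Fin n₁ → Fin 2) × (Fin n₂ → Fin 2)) :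
    (rowwiseTable s).diffT = (∑ i, ind (s.1 i)) / n₁ - (∑ j, ind (s.2 j)) / n₂ := by
  rw [Table.diffT, rowwiseTable_rowSum_zero, rowwiseTable_rowSum_one, rowwiseTable, nnct_zero_zero,
    nnct_one_zero, Fintype.sum_sum_type, Fintype.sum_sum_type]
  simp

lemma rowwiseTable_total (s : (Fin n₁ → Fin 2) × (Fin n₂ → Fin 2)) :
    ((rowwiseTable s).total : ℝ) = n₁ + n₂ := by
  rw [rowwiseTable, nnct_total]; simp

lemma rowwiseTable_colSum_zero (s : (Fin n₁ → Fin 2) × (Fin n₂ → Fin 2)) :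
    ((rowwiseTable s).colSum 0 : ℝ) = ∑ i, ind (s.1 i) + ∑ j, ind (s.2 j) := by
  rw [rowwiseTable, nnct_colSum_zero, Fintype.sum_sum_type]; simp

/-- The centered contribution of a pair to `T`. -/
def rowwiseTerm (n₁ n₂ : ℕ) (p₁ p₂ : ℝ) : Fin n₁ ⊕ Fin n₂ → Fin 2 → ℝ :=
  Sum.elim (fun _ y => (ind y - p₁) / n₁) fun _ y => -((ind y - p₂) / n₂)

lemma integral_rowwiseTerm (h0 : 0 ≤ p₁) (h1 : p₁ ≤ 1) (h0' : 0 ≤ p₂) (h1' : p₂ ≤ 1)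
    (k : Fin n₁ ⊕ Fin n₂) :
    ∫ y, rowwiseTerm n₁ n₂ p₁ p₂ k y ∂(rowwiseLabelLaw n₁ n₂ p₁ p₂ k) = 0 := by
  rcases k with k | k
  · simp only [rowwiseTerm, rowwiseLabelLaw, Sum.elim_inl]
    rw [integral_div, integral_ind_sub h0 h1, zero_div]
  · simp only [rowwiseTerm, rowwiseLabelLaw, Sum.elim_inr]
    rw [integral_neg, integral_div, integral_ind_sub h0' h1', zero_div, neg_zero]

lemma sum_integral_rowwiseTerm_sq (h0 : 0 ≤ p₁) (h1 : p₁ ≤ 1) (h0' : 0 ≤ p₂) (h1' : p₂ ≤ 1)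
    (hn₁ : 0 < n₁) (hn₂ : 0 < n₂) :
    ∑ k, ∫ y, rowwiseTerm n₁ n₂ p₁ p₂ k y ^ 2 ∂(rowwiseLabelLaw n₁ n₂ p₁ p₂ k) =
      p₁ * (1 - p₁) / n₁ + p₂ * (1 - p₂) / n₂ := by
  rw [Fintype.sum_sum_type]
  simp only [rowwiseTerm, rowwiseLabelLaw, Sum.elim_inr, Sum.elim_inl, neg_sq, div_pow]
  rw [integral_div, integral_div, integral_ind_sub_sq h0 h1, integral_ind_sub_sq h0' h1']
  simp only [Finset.sum_const, Finset.card_univ, Fintype.card_fin, nsmul_eq_mul]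
  field_simp

lemma diffT_rowwiseTable_sub (x : Fin n₁ ⊕ Fin n₂ → Fin 2) (hn₁ : 0 < n₁) (hn₂ : 0 < n₂) :
    (rowwiseTable (fun i : Fin n₁ => x (.inl i), fun j : Fin n₂ => x (.inr j))).diffT - (p₁ - p₂) =
      ∑ k, rowwiseTerm n₁ n₂ p₁ p₂ k (x k) := by
  rw [diffT_rowwiseTable, Fintype.sum_sum_type]
  simp only [rowwiseTerm, Sum.elim_inl, Sum.elim_inr, Finset.sum_neg_distrib]
  rw [← Finset.sum_div, ← Finset.sum_div, Finset.sum_sub_distrib, Finset.sum_sub_distrib]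
  simp only [Finset.sum_const, Finset.card_univ, Fintype.card_fin, nsmul_eq_mul]
  field_simp
  ring

lemma integral_rowwise_diffT_sub_sq (h0 : 0 ≤ p₁) (h1 : p₁ ≤ 1) (h0' : 0 ≤ p₂) (h1' : p₂ ≤ 1)
    (hn₁ : 0 < n₁) (hn₂ : 0 < n₂) :
    ∫ s, ((rowwiseTable s).diffT - (p₁ - p₂)) ^ 2 ∂(rowwiseLaw n₁ n₂ p₁ p₂) =
      p₁ * (1 - p₁) / n₁ + p₂ * (1 - p₂) / n₂ := by
  have := isProbabilityMeasure_rowwiseLabelLaw (n₁ := n₁) (n₂ := n₂) h0 h1 h0' h1'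
  rw [integral_rowwiseLaw h0 h1 h0' h1']
  simp_rw [diffT_rowwiseTable_sub _ hn₁ hn₂]
  rw [integral_sum_coord_sq (integral_rowwiseTerm h0 h1 h0' h1'),
    sum_integral_rowwiseTerm_sq h0 h1 h0' h1' hn₁ hn₂]

/-- With p = n₁/n the product p (1 - p) cancels 1/n₁ + 1/n₂ up to 1/n. This is the benchmark that
the spatial variances have to exceed. -/
lemma variance_rowwise_diffT_le (hn₁ : 0 < n₁) (hn₂ : 0 < n₂) {p : ℝ} (hp : p = n₁ / (n₁ + n₂)) :
    variance (fun s => (rowwiseTable s).diffT) (rowwiseLaw n₁ n₂ p p) ≤ 1 / ((n₁ : ℝ) + n₂) := by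
  have a : (0 : ℝ) < n₁ := by exact_mod_cast hn₁
  have b : (0 : ℝ) < n₂ := by exact_mod_cast hn₂
  have h0 : 0 ≤ p := by rw [hp]; positivity
  have h1 : p ≤ 1 := by rw [hp]; exact div_le_one_of_le₀ (by linarith) (by positivity)
  have := isProbabilityMeasure_rowwiseLaw (n₁ := n₁) (n₂ := n₂) h0 h1 h0 h1
  refine (variance_le_integral_sub_sq (BddMeas.of_finite _) _ (p - p)).trans ?_
  rw [integral_rowwise_diffT_sub_sq h0 h1 h0 h1 hn₁ hn₂, hp]
  refine le_of_eq ?_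
  field_simp
  ring

lemma tendsto_cast_fst : Tendsto (fun m : ℕ × ℕ => (m.1 : ℝ)) atTop atTop := by
  rw [← prod_atTop_atTop_eq]
  exact tendsto_natCast_atTop_atTop.comp tendsto_fst

lemma tendsto_cast_snd : Tendsto (fun m : ℕ × ℕ => (m.2 : ℝ)) atTop atTop := by
  rw [← prod_atTop_atTop_eq]
  exact tendsto_natCast_atTop_atTop.comp tendsto_snd

/-- Consistency in the row-wise binomial framework. -/
theorem tendsto_rowwise_reject (α : ℝ) (h0 : 0 ≤ p₁) (h1 : p₁ ≤ 1) (h0' : 0 ≤ p₂) (h1' : p₂ ≤ 1) :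
    (p₂ < p₁ → Tendsto (fun m : ℕ × ℕ => (rowwiseLaw m.1 m.2 p₁ p₂).real
      {s | rowwiseTable s ∈ rejectSeg Table.pielouZ α}) atTop (𝓝 1)) ∧
    (p₁ < p₂ → Tendsto (fun m : ℕ × ℕ => (rowwiseLaw m.1 m.2 p₁ p₂).real
      {s | rowwiseTable s ∈ rejectAssoc Table.pielouZ α}) atTop (𝓝 1)) := by
  have hP : ∀ m : ℕ × ℕ, IsProbabilityMeasure (rowwiseLaw m.1 m.2 p₁ p₂) := fun m =>
    isProbabilityMeasure_rowwiseLaw h0 h1 h0' h1'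
  have hlim : Tendsto (fun m : ℕ × ℕ => p₁ * (1 - p₁) / (m.1 : ℝ) + p₂ * (1 - p₂) / (m.2 : ℝ))
      atTop (𝓝 0) := by
    simpa using (tendsto_cast_fst.const_div_atTop (p₁ * (1 - p₁))).add
      (tendsto_cast_snd.const_div_atTop (p₂ * (1 - p₂)))
  have hpos : ∀ᶠ m : ℕ × ℕ in atTop, 0 < m.1 ∧ 0 < m.2 := by
    filter_upwards [tendsto_cast_fst.eventually_gt_atTop 0,
      tendsto_cast_snd.eventually_gt_atTop 0] with m h h'
    exact ⟨by exact_mod_cast h, by exact_mod_cast h'⟩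
  have hT : TendstoInProb atTop (fun m : ℕ × ℕ => rowwiseLaw m.1 m.2 p₁ p₂)
      (fun m s => (rowwiseTable s).diffT) (p₁ - p₂) := by
    intro δ hδ
    have h1 : Tendsto (fun m : ℕ × ℕ => (p₁ * (1 - p₁) / (m.1 : ℝ) + p₂ * (1 - p₂) / (m.2 : ℝ)) /
      δ ^ 2) atTop (𝓝 0) := by simpa using hlim.div_const (δ ^ 2)
    refine squeeze_zero' (Eventually.of_forall fun k => measureReal_nonneg) (hpos.mono fun m hm => ?_) h1
    rw [← integral_rowwise_diffT_sub_sq h0 ‹_› h0' h1' hm.1 hm.2]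
    have := measureReal_ge_le (BddMeas.of_finite fun s : (Fin m.1 → Fin 2) × (Fin m.2 → Fin 2) =>
      ((rowwiseTable s).diffT - (p₁ - p₂)) ^ 2) (fun _ => sq_nonneg _)
      (rowwiseLaw m.1 m.2 p₁ p₂) (sq_pos_of_pos hδ)
    refine le_trans (measureReal_mono fun ω hω => ?_) this
    simp only [Set.mem_ofPred_eq] at hω ⊢
    rw [← sq_abs ((rowwiseTable ω).diffT - _)]
    gcongr
  constructor
  · intro h
    have hδ : 0 < (p₁ - p₂) / 2 := by linarith
    refine tendsto_rejectSeg_of_diffT (Or.inl rfl) α hδ fun K => ?_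
    refine squeeze_zero' (Eventually.of_forall fun k => measureReal_nonneg) ?_ (hT _ hδ)
    filter_upwards [tendsto_cast_fst.eventually_ge_atTop K,
      tendsto_cast_snd.eventually_ge_atTop K] with m a b
    refine measureReal_mono fun s hs => ?_
    simp only [Set.mem_ofPred_eq, rowwiseTable_rowSum_zero, rowwiseTable_rowSum_one, a, b, and_true,
      not_le] at hs ⊢
    rw [le_abs]; right; linarith
  · intro h
    have hδ : 0 < (p₂ - p₁) / 2 := by linarith
    refine tendsto_rejectAssoc_of_diffT (Or.inl rfl) α hδ fun K => ?_
    refine squeeze_zero' (Eventually.of_forall fun k => measureReal_nonneg) ?_ (hT _ hδ)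
    filter_upwards [tendsto_cast_fst.eventually_ge_atTop K,
      tendsto_cast_snd.eventually_ge_atTop K] with m a b
    refine measureReal_mono fun s hs => ?_
    simp only [Set.mem_ofPred_eq, rowwiseTable_rowSum_zero, rowwiseTable_rowSum_one, a, b, and_true,
      not_le] at hs ⊢
    rw [le_abs]; left; linarith

/-- Asymptotic size in the row-wise binomial framework. -/
theorem tendsto_rowwise_size {α p : ℝ} (hα0 : 0 < α) (hα1 : α < 1) (h0 : 0 < p) (h1 : p < 1) :
    Tendsto (fun m : ℕ × ℕ => (rowwiseLaw m.1 m.2 p p).real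
      {s | rowwiseTable s ∈ rejectSeg Table.pielouZ α}) atTop (𝓝 α) ∧
    Tendsto (fun m : ℕ × ℕ => (rowwiseLaw m.1 m.2 p p).real
      {s | rowwiseTable s ∈ rejectAssoc Table.pielouZ α}) atTop (𝓝 α) := by
  have hP : ∀ m : ℕ × ℕ, IsProbabilityMeasure (rowwiseLaw m.1 m.2 p p) := fun m =>
    isProbabilityMeasure_rowwiseLaw h0.le h1.le h0.le h1.le
  have hv : 0 < p * (1 - p) := mul_pos h0 (by linarith)
  set v := p * (1 - p) with hvdef
  have hpos : ∀ᶠ m : ℕ × ℕ in atTop, 0 < m.1 ∧ 0 < m.2 := by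
    filter_upwards [tendsto_cast_fst.eventually_gt_atTop 0,
      tendsto_cast_snd.eventually_gt_atTop 0] with m h h'
    exact ⟨by exact_mod_cast h, by exact_mod_cast h'⟩
  -- the central limit theorem
  have hW : AsympNormal atTop (fun m : ℕ × ℕ => rowwiseLaw m.1 m.2 p p) fun m s =>
      (rowwiseTable s).diffT / √(v * (((m.1 : ℝ) + m.2) / (m.1 * m.2))) := by
    refine asympNormal_of_tendsto_charFun (fun k => Measurable.of_discrete) fun t => ?_
    rw [tendsto_iff_norm_sub_tendsto_zero]
    have hb : Tendsto (fun m : ℕ × ℕ => 2 * (1 / √(v * m.1) + 1 / √(v * m.2)) * t ^ 2 * |t|)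
        atTop (𝓝 0) := by
      have a := (Real.tendsto_sqrt_atTop.comp
        (tendsto_cast_fst.const_mul_atTop hv)).const_div_atTop 1
      have b := (Real.tendsto_sqrt_atTop.comp
        (tendsto_cast_snd.const_mul_atTop hv)).const_div_atTop 1
      simpa using (((a.add b).const_mul 2).mul_const (t ^ 2)).mul_const |t|
    refine squeeze_zero' (Eventually.of_forall fun _ => norm_nonneg _)
      (hpos.mono fun m hm => ?_) hb
    have a : (0 : ℝ) < m.1 := by exact_mod_cast hm.1
    have b : (0 : ℝ) < m.2 := by exact_mod_cast hm.2
    set S := √(v * (((m.1 : ℝ) + m.2) / (m.1 * m.2))) with hS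
    have hS2 : S ^ 2 = v * (((m.1 : ℝ) + m.2) / (m.1 * m.2)) := Real.sq_sqrt (by positivity)
    have hS0 : 0 < S := Real.sqrt_pos.2 (by positivity)
    rw [integral_rowwiseLaw h0.le h1.le h0.le h1.le]
    have hprob := isProbabilityMeasure_rowwiseLabelLaw (n₁ := m.1) (n₂ := m.2) h0.le h1.le h0.le h1.le
    have e : ∀ x : Fin m.1 ⊕ Fin m.2 → Fin 2,
        (rowwiseTable (fun i : Fin m.1 => x (.inl i), fun j : Fin m.2 => x (.inr j))).diffT / S =
        ∑ k, rowwiseTerm m.1 m.2 p p k (x k) / S := fun x => by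
      rw [← Finset.sum_div, ← diffT_rowwiseTable_sub _ hm.1 hm.2, sub_self, sub_zero]
    simp_rw [e]
    -- The size of a normalized summand: q² S² = v q (1 + q/r) is at least v q. Both sample sizes
    -- have to grow, but at no prescribed relative rate.
    have hη : ∀ q r : ℝ, 0 < q → 0 < r → S ^ 2 = v * ((q + r) / (q * r)) →
        1 / q / S ≤ 1 / √(v * q) := by
      intro q r hq hr hs
      rw [div_div]
      refine one_div_le_one_div_of_le (Real.sqrt_pos.2 (by positivity)) ?_
      rw [Real.sqrt_le_left (by positivity), mul_pow, hs]
      have : q ^ 2 * (v * ((q + r) / (q * r))) = v * q + v * q * (q / r) := by field_simp; ring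
      rw [this]
      have : 0 ≤ v * q * (q / r) := by positivity
      linarith
    refine norm_charFn_sum_sub_le (μ := rowwiseLabelLaw m.1 m.2 p p)
      (Y := fun k y => rowwiseTerm m.1 m.2 p p k y / S) (by positivity) (fun k => ?_)
      (fun k y => ?_) ?_ t
    · rw [integral_div, integral_rowwiseTerm h0.le h1.le h0.le h1.le, zero_div]
    · have hi := abs_ind_sub_le h0.le h1.le y
      have h1' := hη m.1 m.2 a b hS2
      have h2' := hη m.2 m.1 b a (by rw [hS2]; ring)
      have p1 : 0 ≤ 1 / √(v * m.1) := by positivity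
      have p2 : 0 ≤ 1 / √(v * m.2) := by positivity
      rcases k with k | k
      · simp only [rowwiseTerm, Sum.elim_inl, abs_div, abs_of_pos hS0, abs_of_pos a]
        have : |ind y - p| / m.1 / S ≤ 1 / m.1 / S := by gcongr
        linarith
      · simp only [rowwiseTerm, Sum.elim_inr, abs_div, abs_neg, abs_of_pos hS0, abs_of_pos b]
        have : |ind y - p| / m.2 / S ≤ 1 / m.2 / S := by gcongr
        linarith
    · simp_rw [div_pow, integral_div]
      rw [← Finset.sum_div, sum_integral_rowwiseTerm_sq h0.le h1.le h0.le h1.le hm.1 hm.2, hS2,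
        ← hvdef]
      field_simp
      ring
  have hC : TendstoInProb atTop (fun m : ℕ × ℕ => rowwiseLaw m.1 m.2 p p) (fun m s =>
      ((rowwiseTable s).colSum 0 : ℝ) / (rowwiseTable s).total) p := by
    -- A bound is required at every index; for the finally excluded degenerate sizes the integral
    -- serves as its own bound.
    have hlim : Tendsto (fun m : ℕ × ℕ => if 0 < m.1 ∧ 0 < m.2 then v / ((m.1 : ℝ) + m.2) else
        ∫ s, (((rowwiseTable s).colSum 0 : ℝ) / (rowwiseTable s).total - p) ^ 2
          ∂(rowwiseLaw m.1 m.2 p p)) atTop (𝓝 0) := by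
      refine (((tendsto_cast_fst.atTop_add_nonneg (fun m => Nat.cast_nonneg m.2)).const_div_atTop v)).congr' ?_
      filter_upwards [hpos] with m hm
      rw [if_pos hm]
    refine tendstoInProb_of_sq (fun k => BddMeas.of_finite _) (fun m => ?_) hlim
    split_ifs with hm
    · have a : (0 : ℝ) < m.1 := by exact_mod_cast hm.1
      have b : (0 : ℝ) < m.2 := by exact_mod_cast hm.2
      have hprob := isProbabilityMeasure_rowwiseLabelLaw (n₁ := m.1) (n₂ := m.2) h0.le h1.le h0.le h1.le
      rw [integral_rowwiseLaw h0.le h1.le h0.le h1.le]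
      have e : ∀ x : Fin m.1 ⊕ Fin m.2 → Fin 2,
          ((rowwiseTable (fun i : Fin m.1 => x (.inl i), fun j : Fin m.2 => x (.inr j))).colSum 0 : ℝ)
          / (rowwiseTable (fun i : Fin m.1 => x (.inl i), fun j : Fin m.2 => x (.inr j))).total - p =
          ∑ k, (1 / ((m.1 : ℝ) + m.2)) * ctr p x k := fun x => by
        simp only [ctr]
        rw [rowwiseTable_colSum_zero, rowwiseTable_total, ← Finset.mul_sum, Finset.sum_sub_distrib,
          Fintype.sum_sum_type]
        simp only [Finset.sum_const, Finset.card_univ, Fintype.card_sum, Fintype.card_fin,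
          nsmul_eq_mul, Nat.cast_add]
        field_simp
      simp_rw [e]
      have hl : rowwiseLabelLaw m.1 m.2 p p = fun _ => labelLaw p := by
        funext k; rcases k with k | k <;> rfl
      rw [hl, integral_sum_mul_ctr_sq h0.le h1.le (fun _ => 1 / ((m.1 : ℝ) + m.2))]
      simp only [Finset.sum_const, Finset.card_univ, Fintype.card_sum, Fintype.card_fin,
          nsmul_eq_mul, Nat.cast_add]
      rw [← hvdef]
      refine le_of_eq ?_
      field_simp
    · exact le_rfl
  refine AsympNormal.tendsto_reject (S := Table.pielouZ) (T := fun (m : ℕ × ℕ) s => rowwiseTable s)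
    (hW.mul_of_tendstoInProb (hC.sqrt_factor h0 h1) ?_) hα0 hα1
  filter_upwards [hpos] with m hm s
  rw [Table.pielouZ_eq_of_pos _ hv (by rw [rowwiseTable_rowSum_zero]; exact hm.1.ne')
    (by rw [rowwiseTable_rowSum_one]; exact hm.2.ne'), rowwiseTable_rowSum_zero,
    rowwiseTable_rowSum_one, rowwiseTable_total]

end Rowwise

/-! ### The overall multinomial framework -/

section Pairs

variable {μ : Measure (Fin 2 × Fin 2)} [IsProbabilityMeasure μ] {ν κ : ℝ}

/-- The second moment of a sum of independent, identically distributed centered variables. -/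
lemma integral_iid_sum_sq_le {α ι : Type*} [Fintype ι] [DecidableEq ι] [MeasurableSpace α]
    [Finite α] [MeasurableSingletonClass α] {μ : Measure α} [IsProbabilityMeasure μ] {Y : α → ℝ}
    (hY : ∫ y, Y y ∂μ = 0) {c : ℝ} (hc : ∀ y, |Y y| ≤ c) :
    ∫ s, (∑ k, Y (s k)) ^ 2 ∂(Measure.pi fun _ : ι => μ) ≤ Fintype.card ι * c ^ 2 := by
  rw [integral_sum_coord_sq (μ := fun _ : ι => μ) (Y := fun _ => Y) fun _ => hY, Finset.sum_const,
    Finset.card_univ, nsmul_eq_mul]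
  gcongr
  have : ∫ y, Y y ^ 2 ∂μ ≤ ∫ _, c ^ 2 ∂μ :=
    integral_mono Integrable.of_finite Integrable.of_finite fun y => by
      simp only
      rw [← sq_abs]
      exact pow_le_pow_left₀ (abs_nonneg _) (hc y) 2
  simpa using this

lemma integral_ind_comp {α : Type*} [MeasurableSpace α] [Finite α] [MeasurableSingletonClass α]
    {μ : Measure α} [IsProbabilityMeasure μ] (g : α → Fin 2) :
    ∫ u, ind (g u) ∂μ = μ.real {u | g u = 0} := by
  have : (fun u => ind (g u)) = Set.indicator {u | g u = 0} fun _ => 1 := by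
    funext u; simp [ind, Set.indicator]
  rw [this, integral_indicator (Set.toFinite _).measurableSet]
  simp

lemma integral_ind_mul_ind : ∫ u, ind u.1 * ind u.2 ∂μ = μ.real {((0, 0) : Fin 2 × Fin 2)} := by
  have : (fun u : Fin 2 × Fin 2 => ind u.1 * ind u.2) = fun u => ind (if u = (0, 0) then 0 else 1) := by
    funext ⟨a, b⟩; fin_cases a <;> fin_cases b <;> simp
  rw [this, integral_ind_comp]
  congr 1
  ext u; simp

lemma integral_comb (a b c d : ℝ) (hν : ν = μ.real {u | u.1 = 0}) (hκ : κ = μ.real {u | u.2 = 0}) :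
    ∫ u, (a * (ind u.1 * ind u.2) + b * ind u.1 + c * ind u.2 + d) ∂μ =
      a * μ.real {((0, 0) : Fin 2 × Fin 2)} + b * ν + c * κ + d := by
  rw [integral_add Integrable.of_finite Integrable.of_finite,
    integral_add Integrable.of_finite Integrable.of_finite,
    integral_add Integrable.of_finite Integrable.of_finite, integral_const_mul, integral_const_mul,
    integral_const_mul, integral_ind_mul_ind, integral_ind_comp, integral_ind_comp, ← hν, ← hκ]
  simp

lemma integral_pair_cov (hν : ν = μ.real {u | u.1 = 0}) (hκ : κ = μ.real {u | u.2 = 0}) (d : ℝ) :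
    ∫ u, ((ind u.1 - ν) * (ind u.2 - κ) - d) ∂μ = μ.real {((0, 0) : Fin 2 × Fin 2)} - ν * κ - d := by
  have h := integral_comb (μ := μ) 1 (-κ) (-ν) (ν * κ - d) hν hκ
  rw [show μ.real {((0, 0) : Fin 2 × Fin 2)} - ν * κ - d = _ from (h.trans (by ring)).symm]
  congr 1; funext u; ring

/-- Squares of indicators are indicators, so each squared centred indicator is affine in it, and the
condition on a single cell is all the independence needed. -/
lemma integral_pair_cov_sq (hν : ν = μ.real {u | u.1 = 0}) (hκ : κ = μ.real {u | u.2 = 0})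
    (h : μ.real {((0, 0) : Fin 2 × Fin 2)} = ν * κ) :
    ∫ u, ((ind u.1 - ν) * (ind u.2 - κ)) ^ 2 ∂μ = ν * (1 - ν) * (κ * (1 - κ)) := by
  have := integral_comb (μ := μ) ((1 - 2 * ν) * (1 - 2 * κ)) ((1 - 2 * ν) * κ ^ 2)
    ((1 - 2 * κ) * ν ^ 2) (ν ^ 2 * κ ^ 2) hν hκ
  rw [h] at this
  rw [show ν * (1 - ν) * (κ * (1 - κ)) = _ from (this.trans (by ring)).symm]
  congr 1; funext u
  have e1 : (ind u.1 - ν) ^ 2 = (1 - 2 * ν) * ind u.1 + ν ^ 2 := by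
    have := ind_sq u.1; linear_combination this
  have e2 : (ind u.2 - κ) ^ 2 = (1 - 2 * κ) * ind u.2 + κ ^ 2 := by
    have := ind_sq u.2; linear_combination this
  rw [mul_pow, e1, e2]; ring

variable {n : ℕ}

lemma pairsTable_total (s : Fin n → Fin 2 × Fin 2) : ((pairsTable s).total : ℝ) = n := by
  rw [pairsTable, nnct_total, Fintype.card_fin]

/-- `N₁₁ - n₁ C₁ / n` is the empirical covariance of the base and NN labels. -/
lemma pairsTable_cov (s : Fin n → Fin 2 × Fin 2) (hn : 0 < n) (ν κ : ℝ) :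
    (pairsTable s 0 0 : ℝ) - (pairsTable s).rowSum 0 * (pairsTable s).colSum 0 /
      (pairsTable s).total = ∑ k, (ind (s k).1 - ν) * (ind (s k).2 - κ) -
        (∑ k, (ind (s k).1 - ν)) * (∑ k, (ind (s k).2 - κ)) / n := by
  have hn' : (n : ℝ) ≠ 0 := by exact_mod_cast hn.ne'
  have e : ∀ k, (ind (s k).1 - ν) * (ind (s k).2 - κ) = ind (s k).1 * ind (s k).2 -
      κ * ind (s k).1 - ν * ind (s k).2 + ν * κ := fun k => by ring
  rw [pairsTable_total, pairsTable, nnct_zero_zero, nnct_rowSum_zero, nnct_colSum_zero]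
  simp_rw [e]
  simp only [Finset.sum_add_distrib, Finset.sum_sub_distrib, ← Finset.mul_sum, Finset.sum_const,
    Finset.card_univ, Fintype.card_fin, nsmul_eq_mul]
  field_simp
  ring

lemma abs_sum_le_card {β : Type*} (s : Fin n → β) {Y : β → ℝ} (hY : ∀ y, |Y y| ≤ 1) :
    |∑ k, Y (s k)| ≤ n := by
  refine (Finset.abs_sum_le_sum_abs _ _).trans ((Finset.sum_le_sum fun k _ => hY _).trans ?_)
  simp

lemma abs_ind_sub_real_le {α : Type*} [MeasurableSpace α] {μ : Measure α} [IsProbabilityMeasure μ]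
    {A : Set α} (y : Fin 2) : |ind y - μ.real A| ≤ 1 :=
  abs_ind_sub_le measureReal_nonneg measureReal_le_one y

lemma integral_ind_sub_real {α : Type*} [MeasurableSpace α] [Finite α] [MeasurableSingletonClass α]
    {μ : Measure α} [IsProbabilityMeasure μ] (g : α → Fin 2) :
    ∫ u, (ind (g u) - μ.real {u | g u = 0}) ∂μ = 0 := by
  rw [integral_sub Integrable.of_finite Integrable.of_finite, integral_ind_comp]; simp

lemma tendstoInProb_pairs_mean (g : Fin 2 × Fin 2 → Fin 2) :
    TendstoInProb atTop (fun n : ℕ => pairsLaw n μ)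
      (fun n s => (∑ k, ind (g (s k))) / n) (μ.real {u | g u = 0}) := by
  have hprob : ∀ n : ℕ, IsProbabilityMeasure (pairsLaw n μ) := fun n => by
    unfold pairsLaw; infer_instance
  intro δ hδ
  have hlim : Tendsto (fun n : ℕ => 1 / δ ^ 2 / (n : ℝ)) atTop (𝓝 0) :=
    tendsto_natCast_atTop_atTop.const_div_atTop _
  refine squeeze_zero' (Eventually.of_forall fun k => measureReal_nonneg)
    ((eventually_gt_atTop 0).mono fun n hn => ?_) hlim
  have hn' : (0 : ℝ) < n := by exact_mod_cast hn
  have h1 := integral_iid_sum_sq_le (ι := Fin n) (integral_ind_sub_real (μ := μ) g) (c := 1)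
    fun y => abs_ind_sub_real_le _
  have h2 := measureReal_ge_le (BddMeas.of_finite fun s : Fin n → Fin 2 × Fin 2 =>
    (∑ k, (ind (g (s k)) - μ.real {u | g u = 0})) ^ 2) (fun _ => sq_nonneg _)
    (pairsLaw n μ) (sq_pos_of_pos (mul_pos hn' hδ))
  refine (measureReal_mono fun s hs => ?_).trans (h2.trans ?_)
  · simp only [Set.mem_ofPred_eq] at hs ⊢
    rw [← sq_abs (∑ k, _)]
    refine pow_le_pow_left₀ (by positivity) ?_ 2
    rw [Finset.sum_sub_distrib, Finset.sum_const, Finset.card_univ, Fintype.card_fin, nsmul_eq_mul]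
    calc n * δ ≤ n * |(∑ k, ind (g (s k))) / n - μ.real {u | g u = 0}| := by gcongr
      _ = |∑ k, ind (g (s k)) - n * μ.real {u | g u = 0}| := by
        rw [← abs_of_pos hn', ← abs_mul, abs_of_pos hn']
        congr 1; field_simp
  · rw [Fintype.card_fin] at h1
    calc _ ≤ ((n : ℝ) * 1 ^ 2) / (n * δ) ^ 2 := by gcongr; exact h1
      _ = _ := by field_simp

/-- Asymptotic size in the overall multinomial framework. -/
theorem tendsto_pairs_size {α : ℝ} (hα0 : 0 < α) (hα1 : α < 1) (hν : ν = μ.real {u | u.1 = 0})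
    (hκ : κ = μ.real {u | u.2 = 0}) (hν0 : 0 < ν) (hν1 : ν < 1) (hκ0 : 0 < κ) (hκ1 : κ < 1)
    (h : μ.real {((0, 0) : Fin 2 × Fin 2)} = ν * κ) :
    Tendsto (fun n : ℕ => (pairsLaw n μ).real {s | pairsTable s ∈ rejectSeg Table.pielouZtilde α})
      atTop (𝓝 α) ∧
    Tendsto (fun n : ℕ => (pairsLaw n μ).real {s | pairsTable s ∈ rejectAssoc Table.pielouZtilde α})
      atTop (𝓝 α) := by
  have hprob : ∀ n : ℕ, IsProbabilityMeasure (pairsLaw n μ) := fun n => by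
    unfold pairsLaw; infer_instance
  have hv1 : 0 < ν * (1 - ν) := mul_pos hν0 (by linarith)
  have hv2 : 0 < κ * (1 - κ) := mul_pos hκ0 (by linarith)
  set V := ν * (1 - ν) * (κ * (1 - κ)) with hV
  have hV0 : 0 < V := mul_pos hv1 hv2
  have hξ : ∀ u : Fin 2 × Fin 2, |ind u.1 - ν| ≤ 1 := fun u => by
    rw [hν]; exact abs_ind_sub_real_le _
  have hη : ∀ u : Fin 2 × Fin 2, |ind u.2 - κ| ≤ 1 := fun u => by
    rw [hκ]; exact abs_ind_sub_real_le _
  have hξη : ∀ u : Fin 2 × Fin 2, |(ind u.1 - ν) * (ind u.2 - κ)| ≤ 1 := fun u => by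
    rw [abs_mul]; exact mul_le_one₀ (hξ u) (abs_nonneg _) (hη u)
  have hS : Tendsto (fun n : ℕ => √(n * V)) atTop atTop :=
    Real.tendsto_sqrt_atTop.comp (tendsto_natCast_atTop_atTop.atTop_mul_const hV0)
  have hW : AsympNormal atTop (fun n : ℕ => pairsLaw n μ) fun n s =>
      (∑ k, (ind (s k).1 - ν) * (ind (s k).2 - κ)) / √(n * V) := by
    refine asympNormal_of_tendsto_charFun (fun k => Measurable.of_discrete) fun t => ?_
    rw [tendsto_iff_norm_sub_tendsto_zero]
    have hb : Tendsto (fun n : ℕ => 2 * (1 / √(n * V)) * t ^ 2 * |t|) atTop (𝓝 0) := by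
      simpa using (((hS.const_div_atTop 1).const_mul 2).mul_const (t ^ 2)).mul_const |t|
    refine squeeze_zero' (Eventually.of_forall fun _ => norm_nonneg _)
      ((eventually_gt_atTop 0).mono fun n hn => ?_) hb
    have hn' : (0 : ℝ) < n := by exact_mod_cast hn
    have hS0 : 0 < √(n * V) := Real.sqrt_pos.2 (by positivity)
    simp_rw [Finset.sum_div]
    refine norm_charFn_sum_sub_le (μ := fun _ : Fin n => μ)
      (Y := fun k u => (ind u.1 - ν) * (ind u.2 - κ) / √(n * V)) (by positivity) (fun k => ?_)
      (fun k u => ?_) ?_ t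
    · have := integral_pair_cov (μ := μ) hν hκ 0
      simp only [sub_zero, h, sub_self] at this
      rw [integral_div, this, zero_div]
    · rw [abs_div, abs_of_pos hS0]
      have := hξη u
      gcongr
    · simp_rw [div_pow, integral_div, integral_pair_cov_sq (μ := μ) hν hκ h]
      rw [Real.sq_sqrt (by positivity), ← hV]
      simp only [Finset.sum_const, Finset.card_univ, Fintype.card_fin, nsmul_eq_mul]
      field_simp
  -- Centring at the empirical means costs the product of two centred sums over n. By 2|ab| ≤ a² +
  -- b² its mean is of order 1, negligible against √n.
  have hU : TendstoInProb atTop (fun n : ℕ => pairsLaw n μ) (fun n s =>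
      -((∑ k, (ind (s k).1 - ν)) * (∑ k, (ind (s k).2 - κ)) / n / √(n * V))) 0 := by
    refine tendstoInProb_of_tendsto_integral (fun n => BddMeas.of_finite _) rfl ?_
    refine squeeze_zero' (Eventually.of_forall fun _ => integral_nonneg fun _ => abs_nonneg _)
      ((eventually_gt_atTop 0).mono fun n hn => ?_) (hS.const_div_atTop 1)
    have hn' : (0 : ℝ) < n := by exact_mod_cast hn
    have hS0 : 0 < √(n * V) := Real.sqrt_pos.2 (by positivity)
    have i1 := integral_iid_sum_sq_le (ι := Fin n) (integral_ind_sub_real (μ := μ) Prod.fst) (c := 1)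
      fun y => abs_ind_sub_real_le _
    have i2 := integral_iid_sum_sq_le (ι := Fin n) (integral_ind_sub_real (μ := μ) Prod.snd) (c := 1)
      fun y => abs_ind_sub_real_le _
    rw [← hν] at i1
    rw [← hκ] at i2
    calc ∫ s, |-((∑ k, (ind (s k).1 - ν)) * (∑ k, (ind (s k).2 - κ)) / n / √(n * V))| ∂(pairsLaw n μ)
        ≤ ∫ s, ((∑ k, (ind (s k).1 - ν)) ^ 2 + (∑ k, (ind (s k).2 - κ)) ^ 2) / (2 * n * √(n * V))
            ∂(pairsLaw n μ) := by
          refine integral_mono Integrable.of_finite Integrable.of_finite fun s => ?_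
          simp only
          rw [abs_neg, abs_div, abs_div, abs_of_pos hS0, abs_of_pos hn', div_div,
            div_le_div_iff₀ (by positivity) (by positivity)]
          have h2 : 2 * |(∑ k, (ind (s k).1 - ν)) * (∑ k, (ind (s k).2 - κ))| ≤
              (∑ k, (ind (s k).1 - ν)) ^ 2 + (∑ k, (ind (s k).2 - κ)) ^ 2 := by
            rw [abs_mul, ← sq_abs (∑ k, (ind (s k).1 - ν)), ← sq_abs (∑ k, (ind (s k).2 - κ))]
            nlinarith [sq_nonneg (|∑ k, (ind (s k).1 - ν)| - |∑ k, (ind (s k).2 - κ)|)]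
          have h3 : 0 ≤ n * √(n * V) := by positivity
          nlinarith [mul_le_mul_of_nonneg_right h2 h3]
      _ ≤ (n * 1 ^ 2 + n * 1 ^ 2) / (2 * n * √(n * V)) := by
          rw [integral_div, integral_add Integrable.of_finite Integrable.of_finite]
          rw [Fintype.card_fin] at i1 i2
          gcongr
          · exact i1
          · exact i2
      _ = 1 / √(n * V) := by field_simp; ring
  have hA := tendstoInProb_pairs_mean (μ := μ) Prod.fst
  have hC := tendstoInProb_pairs_mean (μ := μ) Prod.snd
  rw [← hν] at hA
  rw [← hκ] at hC
  have hWU := hW.add_of_tendstoInProb hU (V := fun n s => _) (Eventually.of_forall fun n s => rfl)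
  -- The statistic is the covariance over √(n V), times one correction for the row margins and one
  -- for the column margins, both tending to 1.
  refine AsympNormal.tendsto_reject (S := Table.pielouZtilde) (T := fun n s => pairsTable s)
    (hWU.mul_of_tendstoInProb ((hA.sqrt_factor hν0 hν1).mul_one (hC.sqrt_factor hκ0 hκ1)) ?_)
    hα0 hα1
  filter_upwards [eventually_gt_atTop 0] with n hn s
  have hn' : (0 : ℝ) < n := by exact_mod_cast hn
  have hS0 : 0 < √(n * V) := Real.sqrt_pos.2 (by positivity)
  have r0 := nnct_rowSum_zero (fun k => (s k).1) (fun k => (s k).2)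
  have r1 := nnct_rowSum_one (fun k => (s k).1) (fun k => (s k).2)
  have c0 := nnct_colSum_zero (fun k => (s k).1) (fun k => (s k).2)
  have c1 := (nnct (fun k => (s k).1) (fun k => (s k).2)).total_eq_colSum
  rw [nnct_total, c0] at c1
  rw [Fintype.card_fin] at c1 r1
  change ((pairsTable s).rowSum 0 : ℝ) = _ at r0
  change ((pairsTable s).rowSum 1 : ℝ) = _ at r1
  change ((pairsTable s).colSum 0 : ℝ) = _ at c0
  change _ = _ + ((pairsTable s).colSum 1 : ℝ) at c1
  rw [Table.pielouZtilde, pairsTable_cov s hn ν κ]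
  have e1 : (1 : ℝ) - (∑ k, ind (s k).1) / n = (pairsTable s).rowSum 1 / n := by
    rw [r1]; field_simp
  have e2 : (1 : ℝ) - (∑ k, ind (s k).2) / n = (pairsTable s).colSum 1 / n := by
    rw [eq_div_iff hn'.ne', sub_mul, div_mul_cancel₀ _ hn'.ne', c1]; ring
  rw [e1, e2, ← r0, ← c0, pairsTable_total, ← sub_eq_add_neg, ← sub_div]
  generalize ∑ k, (ind (s k).1 - ν) * (ind (s k).2 - κ) - _ = A
  rw [div_mul_eq_mul_div, mul_div_assoc A]
  congr 1
  rw [← Real.sqrt_mul' _ (by positivity), ← Real.sqrt_div' _ (by positivity)]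
  congr 1
  rw [hV]
  generalize ((pairsTable s).rowSum 0 : ℝ) = a
  generalize ((pairsTable s).rowSum 1 : ℝ) = b
  generalize ((pairsTable s).colSum 0 : ℝ) = c
  generalize ((pairsTable s).colSum 1 : ℝ) = d
  have hn0 := hn'.ne'
  have hv1' := hv1.ne'
  have hv2' := hv2.ne'
  generalize ν * (1 - ν) = v at *
  generalize κ * (1 - κ) = w at *
  simp only [div_eq_mul_inv, mul_inv, inv_inv]
  field_simp

/-- The normalized empirical covariance of the labels is consistent. -/
lemma tendstoInProb_pairs_cov (hν : ν = μ.real {u | u.1 = 0}) (hκ : κ = μ.real {u | u.2 = 0}) :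
    TendstoInProb atTop (fun n : ℕ => pairsLaw n μ) (fun n s =>
      ((pairsTable s 0 0 : ℝ) - (pairsTable s).rowSum 0 * (pairsTable s).colSum 0 /
      (pairsTable s).total) / n) (μ.real {((0, 0) : Fin 2 × Fin 2)} - ν * κ) := by
  have hprob : ∀ n : ℕ, IsProbabilityMeasure (pairsLaw n μ) := fun n => by
    unfold pairsLaw; infer_instance
  set D := μ.real {((0, 0) : Fin 2 × Fin 2)} - ν * κ with hD
  have hξ : ∀ u : Fin 2 × Fin 2, |ind u.1 - ν| ≤ 1 := fun u => by
    rw [hν]; exact abs_ind_sub_real_le _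
  have hη : ∀ u : Fin 2 × Fin 2, |ind u.2 - κ| ≤ 1 := fun u => by
    rw [hκ]; exact abs_ind_sub_real_le _
  have hD2 : |D| ≤ 1 := by
    have a0 : 0 ≤ ν := hν ▸ measureReal_nonneg
    have a1 : ν ≤ 1 := hν ▸ measureReal_le_one
    have b0 : 0 ≤ κ := hκ ▸ measureReal_nonneg
    have b1 : κ ≤ 1 := hκ ▸ measureReal_le_one
    have c0 : 0 ≤ μ.real {((0, 0) : Fin 2 × Fin 2)} := measureReal_nonneg
    have c1 : μ.real {((0, 0) : Fin 2 × Fin 2)} ≤ 1 := measureReal_le_one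
    rw [abs_le]; constructor <;> nlinarith
  have hξη : ∀ u : Fin 2 × Fin 2, |(ind u.1 - ν) * (ind u.2 - κ) - D| ≤ 2 := fun u => by
    refine (abs_sub _ _).trans ?_
    rw [abs_mul]
    linarith [mul_le_one₀ (hξ u) (abs_nonneg _) (hη u)]
  intro δ hδ
  -- 10 = 2 · 2² + 2 · 1²: the deviation is X - Ξ b with |b| ≤ 1, its square is at most 2 X² + 2 Ξ²,
  -- and the summands of X and Ξ are bounded by 2 and 1.
  have hlim : Tendsto (fun n : ℕ => 10 / δ ^ 2 / (n : ℝ)) atTop (𝓝 0) :=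
    tendsto_natCast_atTop_atTop.const_div_atTop _
  refine squeeze_zero' (Eventually.of_forall fun k => measureReal_nonneg)
    ((eventually_gt_atTop 0).mono fun n hn => ?_) hlim
  have hn' : (0 : ℝ) < n := by exact_mod_cast hn
  have i1 := integral_iid_sum_sq_le (ι := Fin n) (integral_ind_sub_real (μ := μ) Prod.fst) (c := 1)
    fun y => abs_ind_sub_real_le _
  have i2 := integral_iid_sum_sq_le (ι := Fin n) (μ := μ)
    ((integral_pair_cov hν hκ D).trans (by rw [hD, sub_self])) hξη
  rw [← hν] at i1
  rw [Fintype.card_fin] at i1 i2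
  set X : (Fin n → Fin 2 × Fin 2) → ℝ := fun s => ∑ k, ((ind (s k).1 - ν) * (ind (s k).2 - κ) - D)
  set Ξ : (Fin n → Fin 2 × Fin 2) → ℝ := fun s => ∑ k, (ind (s k).1 - ν)
  have h2 := measureReal_ge_le (BddMeas.of_finite fun s : Fin n → Fin 2 × Fin 2 =>
    2 * X s ^ 2 + 2 * Ξ s ^ 2) (fun _ => by positivity)
    (pairsLaw n μ) (sq_pos_of_pos (mul_pos hn' hδ))
  refine (measureReal_mono fun s hs => ?_).trans (h2.trans ?_)
  · simp only [Set.mem_ofPred_eq] at hs ⊢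
    have e : ((pairsTable s 0 0 : ℝ) - (pairsTable s).rowSum 0 * (pairsTable s).colSum 0 /
      (pairsTable s).total) / n - D = (X s - Ξ s * ((∑ k, (ind (s k).2 - κ)) / n)) / n := by
      rw [pairsTable_cov s hn ν κ]
      simp only [X, Ξ]
      rw [Finset.sum_sub_distrib (f := fun k => (ind (s k).1 - ν) * (ind (s k).2 - κ)),
        Finset.sum_const, Finset.card_univ, Fintype.card_fin, nsmul_eq_mul]
      field_simp
      ring
    have hb : |(∑ k, (ind (s k).2 - κ)) / n| ≤ 1 := by
      rw [abs_div, abs_of_pos hn']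
      exact div_le_one_of_le₀ (abs_sum_le_card s hη) hn'.le
    generalize (∑ k, (ind (s k).2 - κ)) / n = b at *
    rw [e, abs_div, abs_of_pos hn', le_div_iff₀ hn'] at hs
    have : (n * δ) ^ 2 ≤ (X s - Ξ s * b) ^ 2 := by
      rw [← sq_abs (X s - _)]
      exact pow_le_pow_left₀ (by positivity) (by linarith) 2
    have hb2 : b ^ 2 ≤ 1 := by rw [← sq_abs]; exact pow_le_one₀ (abs_nonneg _) hb
    nlinarith [sq_nonneg (X s + Ξ s * b), mul_le_mul_of_nonneg_left hb2 (sq_nonneg (Ξ s))]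
  · rw [integral_add Integrable.of_finite Integrable.of_finite, integral_const_mul,
      integral_const_mul]
    calc _ ≤ (2 * ((n : ℝ) * 2 ^ 2) + 2 * (n * 1 ^ 2)) / (n * δ) ^ 2 := by
          gcongr
          · exact i2
          · exact i1
      _ = _ := by field_simp; ring

/-- Consistency in the overall multinomial framework. -/
theorem tendsto_pairs_reject (α : ℝ) (hν : ν = μ.real {u | u.1 = 0})
    (hκ : κ = μ.real {u | u.2 = 0}) :
    (ν * κ < μ.real {((0, 0) : Fin 2 × Fin 2)} → Tendsto (fun n : ℕ => (pairsLaw n μ).real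
      {s | pairsTable s ∈ rejectSeg Table.pielouZtilde α}) atTop (𝓝 1)) ∧
    (μ.real {((0, 0) : Fin 2 × Fin 2)} < ν * κ → Tendsto (fun n : ℕ => (pairsLaw n μ).real
      {s | pairsTable s ∈ rejectAssoc Table.pielouZtilde α}) atTop (𝓝 1)) := by
  have hprob : ∀ n : ℕ, IsProbabilityMeasure (pairsLaw n μ) := fun n => by
    unfold pairsLaw; infer_instance
  have hU := tendstoInProb_pairs_cov (μ := μ) hν hκ
  -- deterministic consequences of a large covariance
  have key : ∀ (N : Table) (δ : ℝ), 0 < δ → 0 < (N.total : ℝ) → N.total * δ ≤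
      |(N 0 0 : ℝ) - N.rowSum 0 * N.colSum 0 / N.total| →
      N.total * δ ≤ N.rowSum 0 ∧ N.total * δ ≤ N.rowSum 1 ∧
      N.diffT = ((N 0 0 : ℝ) - N.rowSum 0 * N.colSum 0 / N.total) *
        (N.total / (N.rowSum 0 * N.rowSum 1)) ∧ 1 / (N.total : ℝ) ≤ N.total /
          (N.rowSum 0 * N.rowSum 1) := by
    intro N δ hδ hn h
    have p : ∀ i j, (0 : ℝ) ≤ N i j := fun i j => by positivity
    have e0 := N.rowSum_eq 0
    have e1 := N.rowSum_eq 1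
    have e2 := N.colSum_eq 0
    have e3 := N.total_eq
    have hx : N.rowSum 0 * N.colSum 0 / N.total ≤ (N.rowSum 0 : ℝ) := by
      rw [div_le_iff₀ hn]
      have : (N.colSum 0 : ℝ) ≤ N.total := by
        rw [e2, e3, e0, e1]; linarith [p 0 1, p 1 1]
      gcongr
    have hx0 : 0 ≤ (N.rowSum 0 : ℝ) * N.colSum 0 / N.total := by positivity
    -- The covariance is also minus the one computed from the second row, hence bounded by each of
    -- the two row sums: a large covariance by itself makes both rows large.
    have hy : (N.rowSum 0 : ℝ) * N.colSum 0 / N.total = N.colSum 0 - N.rowSum 1 * N.colSum 0 / N.total := by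
      field_simp
      rw [e3]; ring
    have hz : N.rowSum 1 * N.colSum 0 / N.total ≤ (N.rowSum 1 : ℝ) := by
      rw [div_le_iff₀ hn]
      have : (N.colSum 0 : ℝ) ≤ N.total := by
        rw [e2, e3, e0, e1]; linarith [p 0 1, p 1 1]
      gcongr
    have hz0 : 0 ≤ (N.rowSum 1 : ℝ) * N.colSum 0 / N.total := by positivity
    have r0 : N.total * δ ≤ N.rowSum 0 := by
      refine h.trans (abs_le.2 ⟨?_, ?_⟩) <;> linarith [p 0 0, p 0 1]
    have r1 : N.total * δ ≤ N.rowSum 1 := by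
      refine h.trans (abs_le.2 ⟨?_, ?_⟩) <;> rw [hy] <;> linarith [p 1 0, p 1 1]
    have q0 : (0 : ℝ) < N.rowSum 0 := lt_of_lt_of_le (by positivity) r0
    have q1 : (0 : ℝ) < N.rowSum 1 := lt_of_lt_of_le (by positivity) r1
    refine ⟨r0, r1, N.diffT_eq (by exact_mod_cast q0.ne') (by exact_mod_cast q1.ne'), ?_⟩
    · rw [div_le_div_iff₀ hn (by positivity), e3]
      nlinarith
  constructor
  · intro h
    have hδ : 0 < (μ.real {((0, 0) : Fin 2 × Fin 2)} - ν * κ) / 2 := by linarith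
    set δ := (μ.real {((0, 0) : Fin 2 × Fin 2)} - ν * κ) / 2 with hδdef
    refine tendsto_rejectSeg_of_diffT (Or.inr rfl) α hδ fun K => ?_
    refine squeeze_zero' (Eventually.of_forall fun k => measureReal_nonneg) ?_ (hU _ hδ)
    filter_upwards [(tendsto_natCast_atTop_atTop.atTop_mul_const hδ).eventually_ge_atTop K,
      eventually_gt_atTop 0] with n hK hn
    have hn' : (0 : ℝ) < n := by exact_mod_cast hn
    refine measureReal_mono fun s hs => ?_
    simp only [Set.mem_ofPred_eq] at hs ⊢
    by_contra hc
    apply hs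
    rw [not_le, abs_lt] at hc
    have h1 : δ < ((pairsTable s 0 0 : ℝ) - (pairsTable s).rowSum 0 * (pairsTable s).colSum 0 /
      (pairsTable s).total) / n := by linarith [hc.1]
    rw [lt_div_iff₀ hn'] at h1
    obtain ⟨a, b, c, d⟩ := key (pairsTable s) δ hδ (by rw [pairsTable_total]; exact hn')
      (by rw [pairsTable_total] at *; exact (le_abs_self _).trans' (by linarith))
    rw [pairsTable_total] at *
    refine ⟨?_, hK.trans a, hK.trans b⟩
    rw [c]
    calc δ = (δ * n) * (1 / n) := by field_simp
      _ ≤ _ := by gcongr; exact (by positivity : (0:ℝ) ≤ δ * n).trans h1.le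
  · intro h
    have hδ : 0 < (ν * κ - μ.real {((0, 0) : Fin 2 × Fin 2)}) / 2 := by linarith
    set δ := (ν * κ - μ.real {((0, 0) : Fin 2 × Fin 2)}) / 2 with hδdef
    refine tendsto_rejectAssoc_of_diffT (Or.inr rfl) α hδ fun K => ?_
    refine squeeze_zero' (Eventually.of_forall fun k => measureReal_nonneg) ?_ (hU _ hδ)
    filter_upwards [(tendsto_natCast_atTop_atTop.atTop_mul_const hδ).eventually_ge_atTop K,
      eventually_gt_atTop 0] with n hK hn
    have hn' : (0 : ℝ) < n := by exact_mod_cast hn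
    refine measureReal_mono fun s hs => ?_
    simp only [Set.mem_ofPred_eq] at hs ⊢
    by_contra hc
    apply hs
    rw [not_le, abs_lt] at hc
    have h1 : ((pairsTable s 0 0 : ℝ) - (pairsTable s).rowSum 0 * (pairsTable s).colSum 0 /
      (pairsTable s).total) / n < -δ := by linarith [hc.2]
    rw [div_lt_iff₀ hn'] at h1
    obtain ⟨a, b, c, d⟩ := key (pairsTable s) δ hδ (by rw [pairsTable_total]; exact hn')
      (by rw [pairsTable_total] at *; exact (neg_le_abs _).trans' (by linarith))
    rw [pairsTable_total] at *
    refine ⟨?_, hK.trans a, hK.trans b⟩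
    rw [c]
    have : δ ≤ -((pairsTable s 0 0 : ℝ) - (pairsTable s).rowSum 0 * (pairsTable s).colSum 0 / n) *
        (n / ((pairsTable s).rowSum 0 * (pairsTable s).rowSum 1)) := by
      calc δ = (δ * n) * (1 / n) := by field_simp
        _ ≤ _ := by
          have : δ * n ≤ -((pairsTable s 0 0 : ℝ) - (pairsTable s).rowSum 0 *
            (pairsTable s).colSum 0 / n) := by linarith
          gcongr
          exact (by positivity : (0:ℝ) ≤ δ * n).trans this
    linarith

end Pairs

/-! ### Nearest neighbours in the plane -/

/-- Comparing |a - b|² with the longer of the two vectors leaves twice the inner product bounded by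
the square of the shorter one. -/
lemma two_mul_inner_le_mul_norm {E : Type*} [NormedAddCommGroup E] [InnerProductSpace ℝ E] {a b : E}
    (ha : ‖a‖ ≤ ‖a - b‖) (hb : ‖b‖ ≤ ‖a - b‖) : 2 * inner ℝ a b ≤ ‖a‖ * ‖b‖ := by
  have h := norm_sub_sq_real a b
  have h1 : ‖a‖ ^ 2 ≤ ‖a - b‖ ^ 2 := by gcongr
  have h2 : ‖b‖ ^ 2 ≤ ‖a - b‖ ^ 2 := by gcongr
  rcases le_total ‖a‖ ‖b‖ with h3 | h3
  · nlinarith [norm_nonneg a]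
  · nlinarith [norm_nonneg b]

/-- Two points with a common nearest neighbour are seen from it under an angle of at least 60
degrees. -/
lemma one_le_norm_sub_normalize {E : Type*} [NormedAddCommGroup E] [InnerProductSpace ℝ E] {a b : E}
    (ha0 : a ≠ 0) (hb0 : b ≠ 0) (ha : ‖a‖ ≤ ‖a - b‖) (hb : ‖b‖ ≤ ‖a - b‖) :
    1 ≤ ‖‖a‖⁻¹ • a - ‖b‖⁻¹ • b‖ ^ 2 := by
  have ha' := norm_pos_iff.2 ha0
  have hb' := norm_pos_iff.2 hb0
  rw [norm_sub_sq_real, norm_smul, norm_smul, norm_inv, norm_inv, norm_norm, norm_norm,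
    inv_mul_cancel₀ ha'.ne', inv_mul_cancel₀ hb'.ne', inner_smul_left, inner_smul_right]
  have h := two_mul_inner_le_mul_norm ha hb
  have : 2 * (‖a‖⁻¹ * (‖b‖⁻¹ * inner ℝ a b)) ≤ 1 := by
    calc 2 * (‖a‖⁻¹ * (‖b‖⁻¹ * inner ℝ a b)) = ‖a‖⁻¹ * ‖b‖⁻¹ * (2 * inner ℝ a b) := by ring
      _ ≤ ‖a‖⁻¹ * ‖b‖⁻¹ * (‖a‖ * ‖b‖) := by gcongr
      _ = 1 := by field_simp
  simp only [conj_trivial]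
  linarith

/-- Pigeonhole on squares of side 1/2: the coordinates of 2u have integer parts between -2 and 2,
and two points in one square are at squared distance below 1/2. Any absolute constant would do in
place of 25. -/
lemma card_le_of_separated {ι : Type*} (A : Finset ι) (u : ι → Plane) (h1 : ∀ i ∈ A, ‖u i‖ ≤ 1)
    (h2 : ∀ i ∈ A, ∀ j ∈ A, i ≠ j → 1 ≤ ‖u i - u j‖ ^ 2) : A.card ≤ 25 := by
  have hc : ((Finset.Icc (-2 : ℤ) 2) ×ˢ (Finset.Icc (-2 : ℤ) 2)).card = 25 := by decide
  rw [← hc]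
  refine Finset.card_le_card_of_injOn (fun i => (⌊2 * u i 0⌋, ⌊2 * u i 1⌋)) ?_ ?_
  · intro i hi
    have h : ∀ c : Fin 2, -2 ≤ ⌊2 * u i c⌋ ∧ ⌊2 * u i c⌋ ≤ 2 := by
      intro c
      have h3 : |u i c| ≤ 1 := (PiLp.norm_apply_le (u i) c).trans (h1 i hi)
      rw [abs_le] at h3
      refine ⟨Int.le_floor.2 (by push_cast; linarith), ?_⟩
      have : (⌊2 * u i c⌋ : ℝ) ≤ 2 := (Int.floor_le _).trans (by linarith)
      exact_mod_cast this
    simp only [Finset.coe_product, Set.mem_prod, Finset.coe_Icc, Set.mem_Icc]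
    exact ⟨h 0, h 1⟩
  · intro i hi j hj hij
    by_contra hne
    simp only [Prod.mk.injEq] at hij
    have h3 := h2 i hi j hj hne
    rw [EuclideanSpace.norm_sq_eq, Fin.sum_univ_two] at h3
    simp only [PiLp.sub_apply, Real.norm_eq_abs, sq_abs] at h3
    have h4 := Int.abs_sub_lt_one_of_floor_eq_floor hij.1
    have h5 := Int.abs_sub_lt_one_of_floor_eq_floor hij.2
    rw [abs_lt] at h4 h5
    nlinarith [h4.1, h4.2, h5.1, h5.2]

section NN

variable {n : ℕ} {x : Fin n → Plane}

/-- A point is a nearest neighbour of boundedly many others. -/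
lemma card_filter_isNN_le (hx : Function.Injective x) (j : Fin n) (A : Finset (Fin n))
    (hA : ∀ i ∈ A, IsNN x i j) : A.card ≤ 25 := by
  have h0 : ∀ i ∈ A, x i - x j ≠ 0 := fun i hi h =>
    (hA i hi).1 (hx (sub_eq_zero.1 h)).symm
  refine card_le_of_separated A (fun i => ‖x i - x j‖⁻¹ • (x i - x j)) (fun i hi => ?_)
    fun i hi i' hi' hne => ?_
  · rw [norm_smul, norm_inv, norm_norm, inv_mul_cancel₀ (norm_ne_zero_iff.2 (h0 i hi))]
  · refine one_le_norm_sub_normalize (h0 i hi) (h0 i' hi') ?_ ?_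
    · have := (hA i hi).2 i' hne.symm
      rw [sub_sub_sub_cancel_right, ← dist_eq_norm, ← dist_eq_norm]
      exact this
    · have := (hA i' hi').2 i hne
      rw [sub_sub_sub_cancel_right, ← dist_eq_norm, ← dist_eq_norm, dist_comm (x i)]
      exact this

lemma IsNNMap.goodMap {f : Fin n → Fin n} (hf : IsNNMap x f) (hx : Function.Injective x) :
    GoodMap f where
  ne i := (hf i).1
  card_fiber_le j := card_filter_isNN_le hx j _ fun i hi => by
    rw [← (Finset.mem_filter.1 hi).2]; exact hf i

lemma exists_isNN (hn : 2 ≤ n) (i : Fin n) : ∃ j, IsNN x i j := by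
  have : Nontrivial (Fin n) := Fin.nontrivial_iff_two_le.2 hn
  obtain ⟨k, hk⟩ := exists_ne i
  obtain ⟨j, hj, hmin⟩ := (Finset.univ.erase i).exists_min_image (fun l => dist (x i) (x l))
    ⟨k, by simpa using hk⟩
  exact ⟨j, by simpa using hj, fun l hl => hmin l (by simpa using hl)⟩

lemma isNN_nnMap {i j : Fin n} (h : IsNN x i j) : IsNN x i (nnMap x i) := by
  classical
  have hne : (Finset.univ.filter fun j => IsNN x i j).Nonempty := ⟨j, by simpa using h⟩
  rw [nnMap, dif_pos hne]
  have := Finset.min'_mem _ hne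
  simpa using this

lemma nnMap_le {i j : Fin n} (h : IsNN x i j) : nnMap x i ≤ j := by
  classical
  have hne : (Finset.univ.filter fun j => IsNN x i j).Nonempty := ⟨j, by simpa using h⟩
  rw [nnMap, dif_pos hne]
  exact Finset.min'_le _ _ (by simpa using h)

lemma isNNMap_nnMap (hn : 2 ≤ n) (x : Fin n → Plane) : IsNNMap x (nnMap x) := fun i =>
  isNN_nnMap (exists_isNN hn i).choose_spec

lemma goodMap_nnMap (hn : 2 ≤ n) (hx : Function.Injective x) : GoodMap (nnMap x) :=
  (isNNMap_nnMap hn x).goodMap hx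

/-- Moving a point affects only its own nearest neighbour and those of the points which had it or
have it as their nearest neighbour. -/
lemma nnMap_update_eq (hn : 2 ≤ n) {k b : Fin n} (y : Plane) (hb : b ≠ k) (h1 : nnMap x b ≠ k)
    (h2 : nnMap (Function.update x k y) b ≠ k) :
    nnMap (Function.update x k y) b = nnMap x b := by
  set x' := Function.update x k y with hx'
  have e : ∀ l, l ≠ k → x' l = x l := fun l hl => Function.update_of_ne hl _ _
  have hN := isNNMap_nnMap hn x b
  have hN' := isNNMap_nnMap hn x' b
  have d1 := hN.2 _ hN'.1
  have d2 := hN'.2 _ hN.1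
  rw [e b hb, e _ h1, e _ h2] at d2
  -- Neither neighbour is the moved point, so each competes in both patterns and both are at the
  -- minimal distance. Breaking ties by the smallest index then makes them equal.
  refine le_antisymm (nnMap_le ⟨hN.1, fun l hl => ?_⟩) (nnMap_le ⟨hN'.1, fun l hl => ?_⟩)
  · refine le_trans ?_ (hN'.2 l hl)
    rw [e b hb, e _ h1, e _ h2]; exact d1
  · exact d2.trans (hN.2 l hl)

/-- The map factors through the truth values of finitely many distance comparisons, a finite
discrete space. -/
lemma measurable_nnMap : Measurable fun x : Fin n → Plane => nnMap x := by
  classical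
  refine measurable_pi_lambda _ fun i => ?_
  have h : Measurable fun x : Fin n → Plane => fun j : Fin n => IsNN x i j := by
    refine measurable_pi_lambda _ fun j => measurable_to_prop ?_
    have e : (fun x : Fin n → Plane => IsNN x i j) ⁻¹' {True} = {x | IsNN x i j} := by
      ext x; simp
    rw [e]
    have : {x : Fin n → Plane | IsNN x i j} = {_x : Fin n → Plane | j ≠ i} ∩
        ⋂ l : Fin n, {x | l ≠ i → dist (x i) (x j) ≤ dist (x i) (x l)} := by
      ext x; simp [IsNN]
    rw [this]
    refine (MeasurableSet.const _).inter (MeasurableSet.iInter fun l => ?_)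
    by_cases hl : l = i
    · simp [hl]
    · simp only [ne_eq, hl, not_false_eq_true, forall_const]
      exact measurableSet_le ((measurable_pi_apply i).dist (measurable_pi_apply j))
        ((measurable_pi_apply i).dist (measurable_pi_apply l))
  let F : (Fin n → Prop) → Fin n := fun p =>
    if h : (Finset.univ.filter fun j => p j).Nonempty then (Finset.univ.filter fun j => p j).min' h
    else i
  have hF : Measurable F := Measurable.of_discrete
  exact hF.comp h

lemma measurable_spatialTable_nnMap (lab : Fin n → Fin 2) :
    Measurable fun x : Fin n → Plane => spatialTable (nnMap x) lab :=
  (Measurable.of_discrete (f := fun f : Fin n → Fin n => spatialTable f lab)).comp measurable_nnMap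

lemma measurable_spatialTable_nnMap_prod :
    Measurable fun w : (Fin n → Plane) × (Fin n → Fin 2) => spatialTable (nnMap w.1) w.2 :=
  (Measurable.of_discrete (f := fun w : (Fin n → Fin n) × (Fin n → Fin 2) =>
    spatialTable w.1 w.2)).comp ((measurable_nnMap.comp measurable_fst).prodMk measurable_snd)

end NN

/-- Consistency under an arbitrary joint law of locations and labels. -/
theorem tendsto_reject_of_joint_law {S : Table → ℝ}
    (hS : S = Table.pielouZ ∨ S = Table.pielouZtilde) (α : ℝ) {ε : ℝ} (hε : 0 < ε) {n₁ n₂ : ℕ → ℕ}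
    (h₁ : Tendsto n₁ atTop atTop) (h₂ : Tendsto n₂ atTop atTop)
    (P : ∀ k, Measure ((Fin (n₁ k + n₂ k) → Plane) × (Fin (n₁ k + n₂ k) → Fin 2)))
    (hP : ∀ k, IsProbabilityMeasure (P k))
    (hc : ∀ k, ∀ᵐ w ∂(P k), (Finset.univ.filter fun j => w.2 j = 0).card = n₁ k)
    (hvar : Tendsto (fun k => variance (fun w => (spatialTable (nnMap w.1) w.2).diffT) (P k))
      atTop (𝓝 0)) :
    ((∀ᶠ k in atTop, ε ≤ ∫ w, (spatialTable (nnMap w.1) w.2).diffT ∂(P k)) →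
      Tendsto (fun k => (P k).real {w | spatialTable (nnMap w.1) w.2 ∈ rejectSeg S α})
        atTop (𝓝 1)) ∧
    ((∀ᶠ k in atTop, ∫ w, (spatialTable (nnMap w.1) w.2).diffT ∂(P k) ≤ -ε) →
      Tendsto (fun k => (P k).real {w | spatialTable (nnMap w.1) w.2 ∈ rejectAssoc S α})
        atTop (𝓝 1)) := by
  refine tendsto_reject_of_variance (P := P) (T := fun k w => spatialTable (nnMap w.1) w.2) hS α hε
    (fun k => measurable_spatialTable_nnMap_prod) hvar
    (m := ![fun k => (n₁ k : ℝ), fun k => (n₂ k : ℝ)]) ?_ fun k => ?_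
  · simp only [Fin.forall_fin_two]
    exact ⟨tendsto_natCast_atTop_atTop.comp h₁, tendsto_natCast_atTop_atTop.comp h₂⟩
  · filter_upwards [hc k] with w hw
    have h0 : ((spatialTable (nnMap w.1) w.2).rowSum 0 : ℝ) = n₁ k := by
      rw [spatialTable, nnct_rowSum, hw]
    have h1 := (spatialTable (nnMap w.1) w.2).total_eq
    rw [h0, spatialTable, nnct_total, Fintype.card_fin] at h1
    simp only [Fin.forall_fin_two]
    refine ⟨h0, ?_⟩
    push_cast at h1
    change (((spatialTable (nnMap w.1) w.2).rowSum 1 : ℕ) : ℝ) = n₂ k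
    rw [spatialTable]
    linarith

/-! ### Independent labels at fixed locations -/

section IndependentLabels

variable {ι : Type*} [Fintype ι] [DecidableEq ι] {f : ι → ι} {p : ι → ℝ}

/-- A label occurs in its own pair and in the at most 25 pairs for which it is the neighbour. -/
lemma sum_abs_update_le (hf : GoodMap f) {h : Fin 2 → Fin 2 → ℝ}
    (hh : ∀ a b a' b', |h a b - h a' b'| ≤ 1) (x : ι → Fin 2) (k : ι) (y : Fin 2) :
    |∑ b, h (x b) (x (f b)) - ∑ b, h (Function.update x k y b) (Function.update x k y (f b))| ≤
      26 := by
  rw [← Finset.sum_sub_distrib]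
  refine (Finset.abs_sum_le_sum_abs _ _).trans ?_
  have : ∀ b, |h (x b) (x (f b)) - h (Function.update x k y b) (Function.update x k y (f b))| ≤
      (if b = k then 1 else 0) + if f b = k then (1 : ℝ) else 0 := by
    intro b
    by_cases h1 : b = k
    · rw [if_pos h1]
      refine (hh _ _ _ _).trans ?_
      split_ifs <;> norm_num
    · by_cases h2 : f b = k
      · rw [if_pos h2]
        refine (hh _ _ _ _).trans ?_
        split_ifs; norm_num
      · simp [h1, h2]
  refine (Finset.sum_le_sum fun b _ => this b).trans ?_
  rw [Finset.sum_add_distrib, ← Finset.natCast_card_filter (fun b => f b = k)]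
  have h1 : ((Finset.univ.filter fun b => f b = k).card : ℝ) ≤ 25 := by
    exact_mod_cast hf.card_fiber_le k
  simp
  linarith

/-- The variance of a count of labelled (base, NN) pairs. -/
lemma variance_pairCount_le (hf : GoodMap f) (hp : ∀ k, 0 ≤ p k ∧ p k ≤ 1) {h : Fin 2 → Fin 2 → ℝ}
    (hh : ∀ a b a' b', |h a b - h a' b'| ≤ 1) :
    variance (fun x : ι → Fin 2 => ∑ b, h (x b) (x (f b))) (Measure.pi fun k => labelLaw (p k)) ≤
      676 * ∑ k, p k * (1 - p k) := by
  have hprob : ∀ k, IsProbabilityMeasure (labelLaw (p k)) := fun k =>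
    isProbabilityMeasure_labelLaw (hp k).1 (hp k).2
  refine (variance_pi_le_sum_influence (BddMeas.of_finite _)).trans ?_
  rw [Finset.mul_sum, Finset.mul_sum]
  refine Finset.sum_le_sum fun k _ => ?_
  -- Resampling has an effect only if the label changes, with probability 2p(1 - p), and then at
  -- most 26² = 676 in square; the factor 1/2 in Efron–Stein absorbs the 2.
  have key : influence (fun k => labelLaw (p k)) k (fun x : ι → Fin 2 => ∑ b, h (x b) (x (f b))) ≤
      ∫ x, (∫ y, 676 * (if x k = y then 0 else 1) ∂(labelLaw (p k)))
        ∂(Measure.pi fun k => labelLaw (p k)) := by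
    refine integral_mono Integrable.of_finite Integrable.of_finite fun x => ?_
    refine integral_mono Integrable.of_finite Integrable.of_finite fun y => ?_
    simp only
    split_ifs with hxy
    · rw [← hxy, Function.update_eq_self]; simp
    · have := sum_abs_update_le hf hh x k y
      rw [← sq_abs]
      nlinarith [abs_nonneg (∑ b, h (x b) (x (f b)) -
        ∑ b, h (Function.update x k y b) (Function.update x k y (f b)))]
  rw [integral_coord (μ := fun k => labelLaw (p k)) k
    (fun a => ∫ y, 676 * (if a = y then 0 else 1) ∂(labelLaw (p k)))] at key
  rw [integral_labelLaw (hp k).1 (hp k).2, integral_labelLaw (hp k).1 (hp k).2,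
    integral_labelLaw (hp k).1 (hp k).2] at key
  simp at key
  linarith

/-- Since p (1 - p) is at most both p and 1 - p, the variance of the counts is controlled by the
expected size of either class, however unbalanced the classes are. -/
lemma integral_rowSum (f : ι → ι) (hp : ∀ k, 0 ≤ p k ∧ p k ≤ 1) (i : Fin 2) :
    ∑ k, p k * (1 - p k) ≤ ∫ x, ((nnct x fun k => x (f k)).rowSum i : ℝ)
      ∂(Measure.pi fun k => labelLaw (p k)) := by
  have hprob : ∀ k, IsProbabilityMeasure (labelLaw (p k)) := fun k =>
    isProbabilityMeasure_labelLaw (hp k).1 (hp k).2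
  simp_rw [nnct_rowSum, Finset.natCast_card_filter]
  rw [integral_finsetSum _ fun _ _ => Integrable.of_finite]
  refine Finset.sum_le_sum fun k _ => ?_
  rw [integral_coord (μ := fun k => labelLaw (p k)) k (fun a => if a = i then (1 : ℝ) else 0),
    integral_labelLaw (hp k).1 (hp k).2]
  have h0 := (hp k).1
  have h1 := (hp k).2
  fin_cases i <;> simp <;> nlinarith

lemma abs_div_sub_div_le {N r c e η : ℝ} (hN0 : 0 ≤ N) (hNr : N ≤ r) (he : 0 < e) (hη1 : η ≤ 1 / 2)
    (h1 : |N - c| ≤ η * e) (h2 : |r - e| ≤ η * e) : |N / r - c / e| ≤ 2 * η := by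
  have hr : 0 < r := by
    have := (abs_le.1 h2).1
    nlinarith
  have e1 : N / r - c / e = (N / r * (e - r) + (N - c)) / e := by field_simp; ring
  have h3 : N / r ≤ 1 := div_le_one_of_le₀ hNr hr.le
  have h4 : |N / r * (e - r)| ≤ η * e := by
    rw [abs_mul, abs_of_nonneg (by positivity), abs_sub_comm]
    exact (mul_le_of_le_one_left (abs_nonneg _) h3).trans h2
  rw [e1, abs_div, abs_of_pos he, div_le_iff₀ he]
  linarith [abs_add_le (N / r * (e - r)) (N - c)]

end IndependentLabels

/-- If the cell counts and the row sums concentrate around `c` and `e`, then so does `T`. -/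
theorem tendsto_reject_of_concentration {κ : Type*} {l : Filter κ} {Ω : κ → Type*}
    [∀ k, MeasurableSpace (Ω k)] {P : ∀ k, Measure (Ω k)} [∀ k, IsProbabilityMeasure (P k)]
    {T : ∀ k, Ω k → Table} {S : Table → ℝ} (hS : S = Table.pielouZ ∨ S = Table.pielouZtilde) (α : ℝ)
    {ε : ℝ} (hε : 0 < ε) {e c : κ → Fin 2 → ℝ} (he : ∀ i, Tendsto (fun k => e k i) l atTop)
    (h1 : ∀ i η, 0 < η → Tendsto (fun k => (P k).real {ω | η * e k i ≤ |(T k ω i 0 : ℝ) - c k i|}) l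
      (𝓝 0))
    (h2 : ∀ i η, 0 < η → Tendsto (fun k => (P k).real
      {ω | η * e k i ≤ |((T k ω).rowSum i : ℝ) - e k i|}) l (𝓝 0)) :
    ((∀ᶠ k in l, ε ≤ c k 0 / e k 0 - c k 1 / e k 1) →
      Tendsto (fun k => (P k).real {ω | T k ω ∈ rejectSeg S α}) l (𝓝 1)) ∧
    ((∀ᶠ k in l, c k 0 / e k 0 - c k 1 / e k 1 ≤ -ε) →
      Tendsto (fun k => (P k).real {ω | T k ω ∈ rejectAssoc S α}) l (𝓝 1)) := by
  have hε2 : 0 < ε / 2 := by positivity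
  -- Each of the two quotients in T is then off by at most 2η ≤ ε/4, and a row sum is at least half
  -- its expectation.
  set η := min (ε / 8) (1 / 2) with hη
  have hη0 : 0 < η := by positivity
  have hη1 : η ≤ 1 / 2 := min_le_right _ _
  have hη2 : η ≤ ε / 8 := min_le_left _ _
  have hsum := ((h1 0 η hη0).add (h2 0 η hη0)).add ((h1 1 η hη0).add (h2 1 η hη0))
  simp only [add_zero] at hsum
  have key : ∀ (A : ∀ k, Set (Ω k)) (K : ℝ), (∀ᶠ k in l, ∀ ω, (∀ i, K ≤ (T k ω).rowSum i) →
      |(T k ω).diffT - (c k 0 / e k 0 - c k 1 / e k 1)| ≤ ε / 2 → ω ∉ A k) →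
      Tendsto (fun k => (P k).real (A k)) l (𝓝 0) := by
    intro A K hA
    refine squeeze_zero' (Eventually.of_forall fun k => measureReal_nonneg) ?_ hsum
    have hK := fun i => (he i).eventually_ge_atTop (max 1 (2 * K))
    filter_upwards [hA, hK 0, hK 1] with k hk hK0 hK1
    refine le_trans (measureReal_mono ?_) ((measureReal_union_le _ _).trans
      (add_le_add (measureReal_union_le _ _) (measureReal_union_le _ _)))
    intro ω hω
    by_contra hn
    simp only [Set.mem_union, Set.mem_ofPred_eq, not_or, not_le] at hn
    obtain ⟨⟨a0, b0⟩, a1, b1⟩ := hn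
    have p : ∀ i, (T k ω i 0 : ℝ) ≤ (T k ω).rowSum i := fun i => by
      rw [Table.rowSum_eq]; linarith [(by positivity : (0 : ℝ) ≤ T k ω i 1)]
    have e0 : 0 < e k 0 := by linarith [le_max_left 1 (2 * K)]
    have e1 : 0 < e k 1 := by linarith [le_max_left 1 (2 * K)]
    have t0 := abs_div_sub_div_le (by positivity) (p 0) e0 hη1 a0.le b0.le
    have t1 := abs_div_sub_div_le (by positivity) (p 1) e1 hη1 a1.le b1.le
    refine hk ω (Fin.forall_fin_two.2 ⟨?_, ?_⟩) ?_ hω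
    · have := (abs_lt.1 b0).1
      nlinarith [le_max_right 1 (2 * K)]
    · have := (abs_lt.1 b1).1
      nlinarith [le_max_right 1 (2 * K)]
    · rw [Table.diffT]
      rw [abs_le] at t0 t1 ⊢
      constructor <;> linarith [t0.1, t0.2, t1.1, t1.2]
  constructor
  · intro hm
    refine tendsto_rejectSeg_of_diffT hS α hε2 fun K => key _ K (hm.mono fun k hk ω hr hT hω => ?_)
    rw [abs_le] at hT
    exact hω ⟨by linarith [hT.1], hr 0, hr 1⟩
  · intro hm
    refine tendsto_rejectAssoc_of_diffT hS α hε2 fun K => key _ K (hm.mono fun k hk ω hr hT hω => ?_)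
    rw [abs_le] at hT
    exact hω ⟨by linarith [hT.2], hr 0, hr 1⟩

lemma tendsto_measureReal_abs_sub_of_variance {κ : Type*} {l : Filter κ} {Ω : κ → Type*}
    [∀ k, MeasurableSpace (Ω k)] {P : ∀ k, Measure (Ω k)} [∀ k, IsProbabilityMeasure (P k)]
    {g : ∀ k, Ω k → ℝ} (hg : ∀ k, BddMeas (g k)) {e m : κ → ℝ} (he : Tendsto e l atTop) {C : ℝ}
    (hm : ∀ k, m k = ∫ ω, g k ω ∂(P k)) (hv : ∀ k, variance (g k) (P k) ≤ C * e k) {η : ℝ}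
    (hη : 0 < η) : Tendsto (fun k => (P k).real {ω | η * e k ≤ |g k ω - m k|}) l (𝓝 0) := by
  refine squeeze_zero' (Eventually.of_forall fun k => measureReal_nonneg) ?_
    (he.const_div_atTop (C / η ^ 2))
  filter_upwards [he.eventually_gt_atTop 0] with k hk
  rw [hm k]
  refine (measureReal_abs_sub_ge_le (hg k) (P k) (mul_pos hη hk)).trans ?_
  calc _ ≤ C * e k / (η * e k) ^ 2 := by gcongr; exact hv k
    _ = _ := by field_simp

/-- Consistency under independent labels at fixed locations. -/
theorem tendsto_reject_of_independent_labels {κ : Type*} {l : Filter κ} {ι : κ → Type*}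
    [∀ k, Fintype (ι k)] [∀ k, DecidableEq (ι k)] {f : ∀ k, ι k → ι k} (hf : ∀ k, GoodMap (f k))
    {p : ∀ k, ι k → ℝ} (hp : ∀ k i, 0 ≤ p k i ∧ p k i ≤ 1) {S : Table → ℝ}
    (hS : S = Table.pielouZ ∨ S = Table.pielouZtilde) (α : ℝ) {ε : ℝ} (hε : 0 < ε)
    {e c : κ → Fin 2 → ℝ} (he : ∀ k i, e k i = ∫ x, ((nnct x fun b => x (f k b)).rowSum i : ℝ)
      ∂(Measure.pi fun j => labelLaw (p k j)))
    (hc : ∀ k i, c k i = ∫ x, (nnct x (fun b => x (f k b)) i 0 : ℝ)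
      ∂(Measure.pi fun j => labelLaw (p k j)))
    (hlim : ∀ i, Tendsto (fun k => e k i) l atTop) :
    ((∀ᶠ k in l, ε ≤ c k 0 / e k 0 - c k 1 / e k 1) →
      Tendsto (fun k => (Measure.pi fun j => labelLaw (p k j)).real
        {x | nnct x (fun b => x (f k b)) ∈ rejectSeg S α}) l (𝓝 1)) ∧
    ((∀ᶠ k in l, c k 0 / e k 0 - c k 1 / e k 1 ≤ -ε) →
      Tendsto (fun k => (Measure.pi fun j => labelLaw (p k j)).real
        {x | nnct x (fun b => x (f k b)) ∈ rejectAssoc S α}) l (𝓝 1)) := by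
  have hprob : ∀ k j, IsProbabilityMeasure (labelLaw (p k j)) := fun k j =>
    isProbabilityMeasure_labelLaw (hp k j).1 (hp k j).2
  have hvar : ∀ k i, 676 * ∑ j, p k j * (1 - p k j) ≤ 676 * e k i := fun k i => by
    rw [he]; gcongr; exact integral_rowSum (f k) (hp k) i
  refine tendsto_reject_of_concentration (P := fun k => Measure.pi fun j => labelLaw (p k j))
    (T := fun k x => nnct x fun b => x (f k b)) hS α hε hlim (fun i η hη => ?_) fun i η hη => ?_
  · refine tendsto_measureReal_abs_sub_of_variance (C := 676) (fun k => BddMeas.of_finite _) (hlim i)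
      (fun k => hc k i) (fun k => ?_) hη
    refine le_trans ?_ (hvar k i)
    have h : (fun x : ι k → Fin 2 => (nnct x (fun b => x (f k b)) i 0 : ℝ)) =
        fun x => ∑ b, if x b = i ∧ x (f k b) = 0 then (1 : ℝ) else 0 :=
      funext fun x => nnct_apply _ _ _ _
    rw [h]
    refine variance_pairCount_le (hf k) (hp k)
      (h := fun a b => if a = i ∧ b = 0 then (1 : ℝ) else 0) fun a b a' b' => ?_
    split_ifs <;> norm_num
  · refine tendsto_measureReal_abs_sub_of_variance (C := 676) (fun k => BddMeas.of_finite _) (hlim i)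
      (fun k => he k i) (fun k => ?_) hη
    refine le_trans ?_ (hvar k i)
    have h : (fun x : ι k → Fin 2 => ((nnct x (fun b => x (f k b))).rowSum i : ℝ)) =
        fun x => ∑ b, if x b = i then (1 : ℝ) else 0 :=
      funext fun x => by rw [nnct_rowSum, Finset.natCast_card_filter]
    rw [h]
    refine variance_pairCount_le (hf k) (hp k)
      (h := fun a b => if a = i then (1 : ℝ) else 0) fun a b a' b' => ?_
    split_ifs <;> norm_num

/-! ### Independent locations -/

lemma BddMeas.const {α : Type*} [MeasurableSpace α] (a : ℝ) : BddMeas fun _ : α => a :=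
  ⟨measurable_const, |a|, fun _ => le_rfl⟩

lemma BddMeas.const_mul {α : Type*} [MeasurableSpace α] {g : α → ℝ} (hg : BddMeas g) (a : ℝ) :
    BddMeas fun x => a * g x := (BddMeas.const a).mul hg

lemma BddMeas.add {α : Type*} [MeasurableSpace α] {g h : α → ℝ} (hg : BddMeas g)
    (hh : BddMeas h) : BddMeas fun x => g x + h x := by
  obtain ⟨C, hC⟩ := hg.2
  obtain ⟨D, hD⟩ := hh.2
  exact ⟨hg.1.add hh.1, C + D, fun x => (abs_add_le _ _).trans (add_le_add (hC x) (hD x))⟩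

/-- A measurable set is null under a product law if its sections in one coordinate are. -/
lemma measure_pi_eq_zero_of_section {ι α : Type*} [Fintype ι] [DecidableEq ι] [MeasurableSpace α]
    (μ : ι → Measure α) [∀ i, IsProbabilityMeasure (μ i)] (k : ι) {A : Set (ι → α)}
    (hA : MeasurableSet A) (h : ∀ x, μ k {y | Function.update x k y ∈ A} = 0) :
    Measure.pi μ A = 0 := by
  have hp := measurePreserving_update_prod μ k
  rw [← hp.measure_preimage hA.nullMeasurableSet,
    Measure.measure_prod_null (hp.measurable hA)]
  exact Eventually.of_forall h

lemma ae_injective_pi {ι α : Type*} [Fintype ι] [DecidableEq ι] [MeasurableSpace α]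
    [MeasurableEq α] (μ : ι → Measure α) [∀ i, IsProbabilityMeasure (μ i)]
    (h0 : ∀ i y, μ i {y} = 0) : ∀ᵐ x ∂(Measure.pi μ), Function.Injective x := by
  have h : ∀ i j, i ≠ j → ∀ᵐ x ∂(Measure.pi μ), x i ≠ x j := by
    intro i j hij
    rw [ae_iff]
    refine measure_pi_eq_zero_of_section μ i ?_ fun x => ?_
    · simpa using measurableSet_eq_fun (measurable_pi_apply i) (measurable_pi_apply j)
    · have : {y | Function.update x i y ∈ {a : ι → α | ¬a i ≠ a j}} = {x j} := by
        ext y; simp [Function.update_of_ne hij.symm]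
      rw [this, h0]
  filter_upwards [ae_all_iff.2 fun i => ae_all_iff.2 fun j => eventually_imp_distrib_left.2 (h i j)]
    with x hx i j hij
  by_contra hne
  exact hx i j hne hij

lemma variance_sub_le {β : Type*} [MeasurableSpace β] {g h : β → ℝ} (hg : BddMeas g)
    (hh : BddMeas h) (P : Measure β) [IsProbabilityMeasure P] :
    variance (fun x => g x - h x) P ≤ 2 * variance g P + 2 * variance h P := by
  refine (variance_le_integral_sub_sq (hg.sub hh) P (∫ x, g x ∂P - ∫ x, h x ∂P)).trans ?_
  rw [variance_eq_integral hg.1.aemeasurable, variance_eq_integral hh.1.aemeasurable,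
    ← integral_const_mul, ← integral_const_mul]
  have ig := ((hg.sub (.const (∫ x, g x ∂P))).sq.integrable P).const_mul 2
  have ih := ((hh.sub (.const (∫ x, h x ∂P))).sq.integrable P).const_mul 2
  rw [← integral_add ig ih]
  refine integral_mono (((hg.sub hh).sub (.const _)).sq.integrable P) (ig.add ih) fun x => ?_
  simp only
  nlinarith [sq_nonneg ((g x - ∫ x, g x ∂P) + (h x - ∫ x, h x ∂P))]

/-- Bounding an influence by a dominating function `d`. -/
lemma influence_le_of_dominated {ι α : Type*} [Fintype ι] [DecidableEq ι] [MeasurableSpace α]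
    {μ : ι → Measure α} [∀ i, IsProbabilityMeasure (μ i)] {k : ι} {g d : (ι → α) → ℝ}
    (hg : BddMeas g) (hd : BddMeas d) (hd0 : ∀ x, 0 ≤ d x) {C : ℝ}
    (hdC : ∀ᵐ x ∂(Measure.pi μ), d x ≤ C) {a : ℝ} (ha : a ^ 2 = a)
    (h : ∀ x y, |g x - g (Function.update x k y)| ≤ a + d x + d (Function.update x k y)) :
    influence μ k g ≤ 3 * a + 6 * C * ∫ x, d x ∂(Measure.pi μ) := by
  have hu : BddMeas fun z : (ι → α) × α => d (Function.update z.1 k z.2) :=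
    hd.comp (measurable_update_prod k)
  have hu' : ∀ x, BddMeas fun y => d (Function.update x k y) := fun x =>
    hu.comp (measurable_const.prodMk measurable_id)
  have hb : BddMeas fun z : (ι → α) × α => 3 * a + 3 * C * d z.1 +
      3 * C * d (Function.update z.1 k z.2) :=
    ((BddMeas.const (3 * a)).add ((hd.comp measurable_fst).const_mul (3 * C))).add
      (hu.const_mul (3 * C))
  have hG : BddMeas fun z : (ι → α) × α => (g z.1 - g (Function.update z.1 k z.2)) ^ 2 :=
    ((hg.comp measurable_fst).sub (hg.comp (measurable_update_prod k))).sq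
  -- The bound by C holds only almost surely, so it has to be transported to the resampled point by
  -- the measure preserving update.
  have hae : ∀ᵐ x ∂(Measure.pi μ), ∀ᵐ y ∂(μ k), d (Function.update x k y) ≤ C :=
    Measure.ae_ae_of_ae_prod ((measurePreserving_update_prod μ k).quasiMeasurePreserving.ae hdC)
  calc influence μ k g
      ≤ ∫ x, ∫ y, (3 * a + 3 * C * d x + 3 * C * d (Function.update x k y)) ∂(μ k)
          ∂(Measure.pi μ) := by
        refine integral_mono_ae ((hG.integral_right (μ k)).integrable _)
          ((hb.integral_right (μ k)).integrable _) ?_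
        filter_upwards [hdC, hae] with x hx hx'
        refine integral_mono_ae
          ((hG.comp (measurable_const.prodMk measurable_id)).integrable _)
          ((hb.comp (measurable_const.prodMk measurable_id)).integrable _) ?_
        filter_upwards [hx'] with y hy
        have h1 := h x y
        have h2 := hd0 x
        have h3 := hd0 (Function.update x k y)
        rw [← sq_abs]
        -- Cauchy–Schwarz for three terms, then a² = a and d² ≤ C d: the influence becomes linear in
        -- d, so it can be summed over k without loss.
        calc _ ≤ (a + d x + d (Function.update x k y)) ^ 2 := by gcongr
          _ ≤ 3 * (a ^ 2 + d x ^ 2 + d (Function.update x k y) ^ 2) := by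
            nlinarith [sq_nonneg (a - d x), sq_nonneg (a - d (Function.update x k y)),
              sq_nonneg (d x - d (Function.update x k y))]
          _ ≤ _ := by rw [ha]; nlinarith
    _ = ∫ x, ((3 * a + 3 * C * d x) +
          3 * C * ∫ y, d (Function.update x k y) ∂(μ k)) ∂(Measure.pi μ) := by
        congr 1; funext x
        rw [integral_add (integrable_const _) (((hu' x).integrable _).const_mul (3 * C)),
          integral_const_mul]
        simp
    _ = _ := by
        have b1 : BddMeas fun x => 3 * a + 3 * C * d x := (BddMeas.const _).add (hd.const_mul _)
        have b2 : BddMeas fun x => 3 * C * ∫ y, d (Function.update x k y) ∂(μ k) :=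
          (hu.integral_right (μ k)).const_mul _
        rw [integral_add (b1.integrable _) (b2.integrable _),
          integral_add (integrable_const _) ((hd.integrable _).const_mul (3 * C)),
          integral_const_mul, integral_const_mul, integral_const_mul,
          integral_update μ k (hd.integrable _)]
        simp
        ring

section Locations

variable {n : ℕ} {μ : Fin n → Measure Plane} [∀ k, IsProbabilityMeasure (μ k)]

lemma bddMeas_nnMap (Φ : (Fin n → Fin n) → ℝ) : BddMeas fun x : Fin n → Plane => Φ (nnMap x) :=
  (BddMeas.of_finite Φ).comp measurable_nnMap

/-- The number of class `i` points whose nearest neighbour is the point `k`. -/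
def classDegree (lab : Fin n → Fin 2) (i : Fin 2) (k : Fin n) (f : Fin n → Fin n) : ℝ :=
  ∑ b, if lab b = i ∧ f b = k then 1 else 0

lemma classDegree_nonneg (lab : Fin n → Fin 2) (i : Fin 2) (k : Fin n) (f : Fin n → Fin n) :
    0 ≤ classDegree lab i k f := Finset.sum_nonneg fun b _ => by split_ifs <;> norm_num

lemma classDegree_le (lab : Fin n → Fin 2) (i : Fin 2) (k : Fin n) {f : Fin n → Fin n}
    (hf : GoodMap f) : classDegree lab i k f ≤ 25 := by
  have h : ((Finset.univ.filter fun i => f i = k).card : ℝ) ≤ 25 := by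
    exact_mod_cast hf.card_fiber_le k
  refine le_trans ?_ h
  rw [classDegree, ← Finset.natCast_card_filter]
  exact_mod_cast Finset.card_le_card fun b hb => by simp_all

lemma sum_classDegree (lab : Fin n → Fin 2) (i : Fin 2) (f : Fin n → Fin n) :
    ∑ k, classDegree lab i k f = (Finset.univ.filter fun b => lab b = i).card := by
  simp only [classDegree]
  rw [Finset.sum_comm, Finset.natCast_card_filter]
  refine Finset.sum_congr rfl fun b _ => ?_
  by_cases h : lab b = i <;> simp [h]

/-- A class `i` pair can change only if its base is the moved point, or if its neighbour was or
becomes the moved point. -/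
lemma abs_cell_update_le (hn : 2 ≤ n) (lab : Fin n → Fin 2) (i : Fin 2) (x : Fin n → Plane)
    (k : Fin n) (y : Plane) :
    |(spatialTable (nnMap x) lab i 0 : ℝ) -
      spatialTable (nnMap (Function.update x k y)) lab i 0| ≤
      (if lab k = i then 1 else 0) + classDegree lab i k (nnMap x) +
        classDegree lab i k (nnMap (Function.update x k y)) := by
  set x' := Function.update x k y with hx'
  simp only [spatialTable, nnct_apply, classDegree]
  rw [← Finset.sum_sub_distrib]
  have e : (if lab k = i then (1 : ℝ) else 0) = ∑ b, if lab b = i ∧ b = k then 1 else 0 := by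
    rw [Finset.sum_eq_single k (fun b _ hb => by simp [hb]) (by simp)]
    simp
  rw [e, ← Finset.sum_add_distrib, ← Finset.sum_add_distrib]
  refine (Finset.abs_sum_le_sum_abs _ _).trans (Finset.sum_le_sum fun b _ => ?_)
  by_cases hi : lab b = i
  swap
  · simp [hi]
  by_cases hb : b = k
  · have hk : lab k = i := hb ▸ hi
    simp only [hb, hk, true_and, if_true]
    split_ifs <;> norm_num
  by_cases h1 : nnMap x b = k
  · simp only [hi, hb, h1, true_and]
    split_ifs <;> norm_num
  by_cases h2 : nnMap x' b = k
  · simp only [hi, hb, h1, h2, true_and]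
    split_ifs <;> norm_num
  · rw [nnMap_update_eq hn y hb h1 h2]
    simp [hb, h1]

/-- The variance of a cell count for independent locations. -/
theorem variance_cell_le (hn : 2 ≤ n) (h0 : ∀ k y, μ k {y} = 0) (lab : Fin n → Fin 2) (i : Fin 2) :
    variance (fun x => (spatialTable (nnMap x) lab i 0 : ℝ)) (Measure.pi μ) ≤
      77 * (Finset.univ.filter fun b => lab b = i).card := by
  have hg : BddMeas fun x : Fin n → Plane => (spatialTable (nnMap x) lab i 0 : ℝ) :=
    bddMeas_nnMap fun f => (spatialTable f lab i 0 : ℝ)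
  have hinj := ae_injective_pi μ h0
  have hd : ∀ k, BddMeas fun x : Fin n → Plane => classDegree lab i k (nnMap x) := fun k =>
    bddMeas_nnMap _
  have hgood : ∀ᵐ x ∂(Measure.pi μ), ∀ k, classDegree lab i k (nnMap x) ≤ 25 := by
    filter_upwards [hinj] with x hx k
    exact classDegree_le lab i k (goodMap_nnMap hn hx)
  have key : ∀ k, influence μ k (fun x => (spatialTable (nnMap x) lab i 0 : ℝ)) ≤
      3 * (if lab k = i then 1 else 0) +
        6 * 25 * ∫ x, classDegree lab i k (nnMap x) ∂(Measure.pi μ) := by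
    intro k
    refine influence_le_of_dominated hg (hd k) (fun x => classDegree_nonneg _ _ _ _)
      (hgood.mono fun x hx => hx k) (by split_ifs <;> norm_num) fun x y => ?_
    exact abs_cell_update_le hn lab i x k y
  refine (variance_pi_le_sum_influence hg).trans ?_
  -- The class degrees add up to the size of class `i`, so the variance is bounded by that class
  -- size and not by n. Half of 3 + 150 is at most 77.
  have h1 : ∑ k, influence μ k (fun x => (spatialTable (nnMap x) lab i 0 : ℝ)) ≤
      3 * ((Finset.univ.filter fun b => lab b = i).card : ℝ) +
        6 * 25 * (Finset.univ.filter fun b => lab b = i).card := by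
    refine (Finset.sum_le_sum fun k _ => key k).trans (le_of_eq ?_)
    rw [Finset.sum_add_distrib, ← Finset.mul_sum, ← Finset.mul_sum, ← Finset.natCast_card_filter,
      ← integral_finsetSum _ fun k _ => (hd k).integrable _]
    simp_rw [sum_classDegree]
    simp
  linarith [(by positivity : (0 : ℝ) ≤ (Finset.univ.filter fun b => lab b = i).card)]

end Locations

lemma countZero_blockLabels (n₁ n₂ : ℕ) : countZero (blockLabels n₁ n₂) = n₁ := by
  have : (countZero (blockLabels n₁ n₂) : ℝ) = n₁ := by
    rw [countZero_eq_sum, Fin.sum_univ_add]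
    simp [blockLabels]
  exact_mod_cast this

lemma card_blockLabels_one (n₁ n₂ : ℕ) :
    (Finset.univ.filter fun b => blockLabels n₁ n₂ b = 1).card = n₂ := by
  have h : ((Finset.univ.filter fun b => blockLabels n₁ n₂ b = 1).card : ℝ) = n₂ := by
    rw [Finset.natCast_card_filter, Fin.sum_univ_add]
    simp [blockLabels]
  exact_mod_cast h

lemma blockTable_rowSum_zero {n₁ n₂ : ℕ} (x : Fin (n₁ + n₂) → Plane) :
    (blockTable x).rowSum 0 = n₁ := by
  rw [blockTable, spatialTable, nnct_rowSum]; exact countZero_blockLabels n₁ n₂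

lemma blockTable_rowSum_one {n₁ n₂ : ℕ} (x : Fin (n₁ + n₂) → Plane) :
    (blockTable x).rowSum 1 = n₂ := by
  rw [blockTable, spatialTable, nnct_rowSum]; exact card_blockLabels_one n₁ n₂

lemma measurable_blockTable {n₁ n₂ : ℕ} :
    Measurable fun x : Fin (n₁ + n₂) → Plane => blockTable x :=
  measurable_spatialTable_nnMap _

lemma variance_blockTable_diffT_le {n₁ n₂ : ℕ} (hn₁ : 1 ≤ n₁) (hn₂ : 1 ≤ n₂)
    {μ : Fin (n₁ + n₂) → Measure Plane} [∀ k, IsProbabilityMeasure (μ k)]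
    (h0 : ∀ k y, μ k {y} = 0) :
    variance (fun x => (blockTable x).diffT) (Measure.pi μ) ≤ 154 / n₁ + 154 / n₂ := by
  have a : (0 : ℝ) < n₁ := by exact_mod_cast hn₁
  have b : (0 : ℝ) < n₂ := by exact_mod_cast hn₂
  have v0 := variance_cell_le (μ := μ) (by omega) h0 (blockLabels n₁ n₂) 0
  have v1 := variance_cell_le (μ := μ) (by omega) h0 (blockLabels n₁ n₂) 1
  rw [card_blockLabels_one] at v1
  have hc : (Finset.univ.filter fun b => blockLabels n₁ n₂ b = 0).card = n₁ :=
    countZero_blockLabels n₁ n₂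
  rw [hc] at v0
  have hT : (fun x : Fin (n₁ + n₂) → Plane => (blockTable x).diffT) = fun x =>
      (n₁ : ℝ)⁻¹ * (spatialTable (nnMap x) (blockLabels n₁ n₂) 0 0 : ℝ) -
        (n₂ : ℝ)⁻¹ * (spatialTable (nnMap x) (blockLabels n₁ n₂) 1 0 : ℝ) := by
    funext x
    rw [Table.diffT, blockTable_rowSum_zero, blockTable_rowSum_one, blockTable]
    ring
  have hg : ∀ (i : Fin 2) (c : ℝ), BddMeas fun x : Fin (n₁ + n₂) → Plane =>
      c * (spatialTable (nnMap x) (blockLabels n₁ n₂) i 0 : ℝ) := fun i c =>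
    bddMeas_nnMap fun f => c * (spatialTable f (blockLabels n₁ n₂) i 0 : ℝ)
  rw [hT]
  refine (variance_sub_le (hg 0 _) (hg 1 _) _).trans ?_
  rw [variance_const_mul, variance_const_mul]
  calc _ ≤ 2 * ((n₁ : ℝ)⁻¹ ^ 2 * (77 * n₁)) + 2 * ((n₂ : ℝ)⁻¹ ^ 2 * (77 * n₂)) := by gcongr
    _ = _ := by field_simp; norm_num

/-- Consistency against departures from CSR independence. -/
theorem tendsto_reject_of_independent_locations {S : Table → ℝ}
    (hS : S = Table.pielouZ ∨ S = Table.pielouZtilde) (α : ℝ) {ε : ℝ} (hε : 0 < ε) {n₁ n₂ : ℕ → ℕ}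
    (h₁ : Tendsto n₁ atTop atTop) (h₂ : Tendsto n₂ atTop atTop) {μ₁ μ₂ : ℕ → Measure Plane}
    (hμ₁ : ∀ k, IsProbabilityMeasure (μ₁ k) ∧ ∀ y, μ₁ k {y} = 0)
    (hμ₂ : ∀ k, IsProbabilityMeasure (μ₂ k) ∧ ∀ y, μ₂ k {y} = 0) :
    ((∀ᶠ k in atTop,
        ε ≤ ∫ x, (blockTable x).diffT ∂(locationLaw (n₁ k) (n₂ k) (μ₁ k) (μ₂ k))) →
      Tendsto (fun k => (locationLaw (n₁ k) (n₂ k) (μ₁ k) (μ₂ k)).real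
        {x | blockTable x ∈ rejectSeg S α}) atTop (𝓝 1)) ∧
    ((∀ᶠ k in atTop,
        ∫ x, (blockTable x).diffT ∂(locationLaw (n₁ k) (n₂ k) (μ₁ k) (μ₂ k)) ≤ -ε) →
      Tendsto (fun k => (locationLaw (n₁ k) (n₂ k) (μ₁ k) (μ₂ k)).real
        {x | blockTable x ∈ rejectAssoc S α}) atTop (𝓝 1)) := by
  have hp : ∀ k (b : Fin (n₁ k + n₂ k)),
      IsProbabilityMeasure (if b.val < n₁ k then μ₁ k else μ₂ k) := fun k b => by
    split_ifs
    · exact (hμ₁ k).1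
    · exact (hμ₂ k).1
  have hP : ∀ k, IsProbabilityMeasure (locationLaw (n₁ k) (n₂ k) (μ₁ k) (μ₂ k)) := fun k => by
    unfold locationLaw; infer_instance
  have c₁ : Tendsto (fun k => (n₁ k : ℝ)) atTop atTop := tendsto_natCast_atTop_atTop.comp h₁
  have c₂ : Tendsto (fun k => (n₂ k : ℝ)) atTop atTop := tendsto_natCast_atTop_atTop.comp h₂
  refine tendsto_reject_of_variance (P := fun k => locationLaw (n₁ k) (n₂ k) (μ₁ k) (μ₂ k))
    (T := fun k x => blockTable x) hS α hε (fun k => measurable_blockTable) ?_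
    (m := ![fun k => (n₁ k : ℝ), fun k => (n₂ k : ℝ)]) ?_ fun k => ?_
  · have hlim := (c₁.const_div_atTop 154).add (c₂.const_div_atTop 154)
    rw [add_zero] at hlim
    refine squeeze_zero' (Eventually.of_forall fun k => variance_nonneg _ _) ?_ hlim
    filter_upwards [h₁.eventually_ge_atTop 1, h₂.eventually_ge_atTop 1] with k a b
    exact variance_blockTable_diffT_le a b fun b y => by
      split_ifs
      · exact (hμ₁ k).2 y
      · exact (hμ₂ k).2 y
  · simp only [Fin.forall_fin_two]
    exact ⟨c₁, c₂⟩
  · refine Eventually.of_forall fun x => ?_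
    simp only [Fin.forall_fin_two]
    exact ⟨by rw [blockTable_rowSum_zero]; rfl, by rw [blockTable_rowSum_one]; rfl⟩

/-! ### Random labelling -/

section RandomLabelling

variable {ι : Type*} [Fintype ι] [DecidableEq ι] {f : ι → ι} {m : ℕ} {ν v n : ℝ}

lemma sum_ctr_eq_zero {lab : ι → Fin 2} (hlab : countZero lab = m) (hn0 : 0 < Fintype.card ι)
    (hν : ν = m / Fintype.card ι) : ∑ i, ctr ν lab i = 0 := by
  have hn : (Fintype.card ι : ℝ) ≠ 0 := by exact_mod_cast hn0.ne'
  simp only [ctr]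
  rw [Finset.sum_sub_distrib, ← countZero_eq_sum, hlab, hν]
  simp
  field_simp
  ring

lemma sum_ctr_sq {lab : ι → Fin 2} (hlab : countZero lab = m) (hn0 : 0 < Fintype.card ι)
    (hν : ν = m / Fintype.card ι) : ∑ i, ctr ν lab i ^ 2 = Fintype.card ι * (ν * (1 - ν)) := by
  have hn : (Fintype.card ι : ℝ) ≠ 0 := by exact_mod_cast hn0.ne'
  have e : ∀ i, ctr ν lab i ^ 2 = (1 - 2 * ν) * ind (lab i) + ν ^ 2 := fun i => by
    have := ind_sq (lab i)
    simp only [ctr]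
    linear_combination this
  simp_rw [e]
  rw [Finset.sum_add_distrib, ← Finset.mul_sum, ← countZero_eq_sum, hlab]
  have : (m : ℝ) = ν * Fintype.card ι := by rw [hν]; field_simp
  rw [this]
  simp
  ring

lemma nnct_rowSum_of_countZero {lab : ι → Fin 2} (hlab : countZero lab = m) (nn : ι → Fin 2) :
    (nnct lab nn).rowSum 0 = m ∧ ((nnct lab nn).rowSum 1 : ℝ) = Fintype.card ι - m := by
  constructor
  · rw [nnct_rowSum]; exact hlab
  · rw [nnct_rowSum_one, ← countZero_eq_sum, hlab]

/-- The centred labels sum to 0 when the class size is exactly `m`, so the covariance N₁₁ - n₁ C₁ /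
n is the quadratic form, and n₁ n₂ / n = n ν (1 - ν). -/
lemma diffT_eq_nnForm {lab : ι → Fin 2} (hlab : countZero lab = m) (hm0 : 0 < m)
    (hm1 : m < Fintype.card ι) (hν : ν = m / Fintype.card ι) :
    (nnct lab fun i => lab (f i)).diffT = nnForm f (ctr ν lab) / (Fintype.card ι * (ν * (1 - ν))) := by
  have hn0 : 0 < Fintype.card ι := by omega
  have hn : (0 : ℝ) < Fintype.card ι := by exact_mod_cast hn0
  have hm : (0 : ℝ) < m := by exact_mod_cast hm0
  have hm' : (m : ℝ) < Fintype.card ι := by exact_mod_cast hm1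
  obtain ⟨r0, r1⟩ := nnct_rowSum_of_countZero hlab fun i => lab (f i)
  have h1 : (nnct lab fun i => lab (f i)).rowSum 1 ≠ 0 := by
    intro h
    rw [h] at r1
    push_cast at r1
    linarith
  have e : nnForm f (ctr ν lab) = ∑ i, ind (lab i) * ind (lab (f i)) - ν * ∑ i, ind (lab (f i)) := by
    have h2 : nnForm f (ctr ν lab) = ∑ i, (ind (lab i) * ind (lab (f i)) - ν * ind (lab (f i))) -
        ν * ∑ i, ctr ν lab i := by
      rw [Finset.mul_sum, ← Finset.sum_sub_distrib]
      exact Finset.sum_congr rfl fun i _ => by simp only [ctr]; ring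
    rw [h2, sum_ctr_eq_zero hlab hn0 hν, Finset.sum_sub_distrib, ← Finset.mul_sum]
    ring
  rw [Table.diffT_eq _ (by rw [r0]; exact hm0.ne') h1, r0, r1, nnct_total, nnct_zero_zero,
    nnct_colSum_zero, e, hν]
  have h3 : (Fintype.card ι : ℝ) - m ≠ 0 := by linarith
  field_simp

lemma ctr_comp (a : ι → Fin 2) (π : Equiv.Perm ι) :
    ctr ν (a ∘ π) = fun i => ctr ν a (π i) := rfl

lemma labelFraction_mem (hm0 : 0 < m) (hm1 : m < Fintype.card ι) (hν : ν = m / Fintype.card ι) :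
    0 < ν ∧ ν < 1 := by
  have hn0 : 0 < Fintype.card ι := by omega
  have hn : (0 : ℝ) < Fintype.card ι := by exact_mod_cast hn0
  have hm : (0 : ℝ) < m := by exact_mod_cast hm0
  have hm' : (m : ℝ) < Fintype.card ι := by exact_mod_cast hm1
  rw [hν]
  exact ⟨by positivity, (div_lt_one hn).2 hm'⟩

/-- Under random labelling, the mean of `T` does not depend on the locations. -/
lemma integral_labelUniform_diffT (hf : GoodMap f) (hm0 : 0 < m) (hm1 : m < Fintype.card ι) :
    ∫ lab, (nnct lab fun i => lab (f i)).diffT ∂(labelUniform ι m) =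
      -1 / ((Fintype.card ι : ℝ) - 1) := by
  obtain ⟨a, ha, -⟩ := exists_countZero_eq hm1.le (fun _ : ι => 0)
  have hν := labelFraction_mem (ι := ι) hm0 hm1 rfl
  have hn2 : 2 ≤ Fintype.card ι := by omega
  have hn2' : (2 : ℝ) ≤ Fintype.card ι := by exact_mod_cast hn2
  rw [integral_labelUniform ha]
  simp_rw [fun π : Equiv.Perm ι => diffT_eq_nnForm (f := f) ((countZero_comp a π).trans ha) hm0 hm1 rfl,
    ctr_comp]
  rw [integral_div, integral_nnForm hf (sum_ctr_eq_zero ha (by omega) rfl) hn2,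
    sum_ctr_sq ha (by omega) rfl]
  generalize (m : ℝ) / Fintype.card ι = ν at *
  have h1 : (1 : ℝ) - ν ≠ 0 := by linarith [hν.2]
  have h2 := hν.1.ne'
  have h3 : (Fintype.card ι : ℝ) - 1 ≠ 0 := by linarith
  field_simp

/-- The second moment bound for the form, divided by (n v)². The term R/n is the excess over the
row-wise variance 1/n. -/
lemma integral_labelUniform_diffT_sq_ge (hf : GoodMap f) (hm0 : 0 < m) (hm1 : m < Fintype.card ι)
    (hn : 6 ≤ Fintype.card ι) (hν : ν = m / Fintype.card ι) (hv : v = ν * (1 - ν)) :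
    (1 + ((Finset.univ.filter fun i => f (f i) = i).card : ℝ) / Fintype.card ι -
      400 / (Fintype.card ι * v ^ 2)) / Fintype.card ι ≤
      ∫ lab, (nnct lab fun i => lab (f i)).diffT ^ 2 ∂(labelUniform ι m) := by
  obtain ⟨a, ha, -⟩ := exists_countZero_eq hm1.le (fun _ : ι => 0)
  have hν' := labelFraction_mem (ι := ι) hm0 hm1 hν
  have hn' : (6 : ℝ) ≤ Fintype.card ι := by exact_mod_cast hn
  have hv0 : 0 < v := by rw [hv]; exact mul_pos hν'.1 (by linarith [hν'.2])
  rw [integral_labelUniform ha]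
  simp_rw [fun π : Equiv.Perm ι => diffT_eq_nnForm (f := f) ((countZero_comp a π).trans ha) hm0 hm1 hν,
    ctr_comp, div_pow]
  have h := integral_nnForm_sq_ge hf (sum_ctr_eq_zero ha (by omega) hν)
    (fun i => abs_ind_sub_le hν'.1.le hν'.2.le (a i)) hn (v := v)
    (by rw [sum_ctr_sq ha (by omega) hν, hv]; field_simp)
  rw [integral_div, ← hv, le_div_iff₀ (by positivity)]
  refine le_trans (le_of_eq ?_) h
  field_simp

/-- Under random labelling, the number of points with a class 1 nearest neighbour concentrates. -/
lemma integral_labelUniform_sum_ctr_sq_le (hf : GoodMap f) (hm : m ≤ Fintype.card ι)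
    (hn : 2 ≤ Fintype.card ι) (hν : ν = m / Fintype.card ι) :
    ∫ lab, (∑ i, ctr ν lab (f i)) ^ 2 ∂(labelUniform ι m) ≤ 25 * Fintype.card ι := by
  obtain ⟨a, ha, -⟩ := exists_countZero_eq hm (fun _ : ι => 0)
  have hn' : (2 : ℝ) ≤ Fintype.card ι := by exact_mod_cast hn
  have h0 : 0 ≤ ν := by rw [hν]; positivity
  have h1 : ν ≤ 1 := by rw [hν]; exact div_le_one_of_le₀ (by exact_mod_cast hm) (by positivity)
  rw [integral_labelUniform ha]
  simp_rw [ctr_comp, pow_two, Finset.sum_mul_sum]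
  rw [integral_finsetSum _ fun _ _ => Integrable.of_finite]
  -- Labels at distinct points are negatively correlated, so only pairs with a common neighbour
  -- count, at most 25 for each i.
  have key : ∀ i j, ∫ π : Equiv.Perm ι, ctr ν a (π (f i)) * ctr ν a (π (f j)) ∂(permLaw ι) ≤
      if f j = f i then 1 else 0 := by
    intro i j
    split_ifs with hij
    · refine (le_abs_self _).trans (abs_integral_le_of_abs_le fun π => ?_)
      rw [abs_mul]
      exact mul_le_one₀ (abs_ind_sub_le h0 h1 _) (abs_nonneg _) (abs_ind_sub_le h0 h1 _)
    · rw [integral_permLaw_mul_self (sum_ctr_eq_zero ha (by omega) hν) hij hn]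
      have : 0 ≤ (∑ i, ctr ν a i ^ 2) / Fintype.card ι := by positivity
      exact div_nonpos_of_nonpos_of_nonneg (by linarith) (by linarith)
  calc _ ≤ ∑ i : ι, (25 : ℝ) := by
        refine Finset.sum_le_sum fun i _ => ?_
        rw [integral_finsetSum _ fun _ _ => Integrable.of_finite]
        refine (Finset.sum_le_sum fun j _ => key i j).trans ?_
        rw [← Finset.natCast_card_filter]
        exact_mod_cast hf.card_fiber_le (f i)
    _ = _ := by simp [mul_comm]

lemma ae_labelUniform (hm : m ≤ Fintype.card ι) :
    ∀ᵐ lab ∂(labelUniform ι m), countZero lab = m := by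
  obtain ⟨a, ha, -⟩ := exists_countZero_eq hm (fun _ : ι => 0)
  rw [← map_permLaw_eq_labelUniform ha, ae_map_iff Measurable.of_discrete.aemeasurable
    (Set.toFinite _).measurableSet]
  exact Eventually.of_forall fun π => (countZero_comp a π).trans ha

end RandomLabelling

lemma TendstoInProb.of_tendsto {κ : Type*} {l : Filter κ} {Ω : κ → Type*}
    [∀ k, MeasurableSpace (Ω k)] {P : ∀ k, Measure (Ω k)} {a : κ → ℝ} {c : ℝ}
    (h : Tendsto a l (𝓝 c)) : TendstoInProb l P (fun k _ => a k) c := by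
  intro δ hδ
  refine tendsto_const_nhds.congr' ?_
  filter_upwards [Metric.tendsto_nhds.1 h δ hδ] with k hk
  rw [Real.dist_eq] at hk
  simp [not_le.2 hk]

/-! ### Limit law and rejection probabilities under random labelling -/

section RandomLabellingLimit

variable {κ : Type*} {l : Filter κ} {ι : κ → Type*} [∀ k, Fintype (ι k)] [∀ k, DecidableEq (ι k)]
  {f : ∀ k, ι k → ι k} {m : κ → ℕ} {ν : ℝ}

/-- Under random labelling, the quadratic form of the nearest neighbour map is asymptotically
normal. -/
theorem asympNormal_labelUniform [l.IsCountablyGenerated] (hf : ∀ k, GoodMap (f k))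
    (hm0 : ∀ k, 0 < m k) (hm1 : ∀ k, m k < Fintype.card (ι k)) (hn : ∀ k, 6 ≤ Fintype.card (ι k))
    (hlim : Tendsto (fun k => Fintype.card (ι k)) l atTop) (h0 : 0 < ν) (h1 : ν < 1)
    {q : κ → ℝ} (hq : ∀ k, q k = m k / Fintype.card (ι k)) (hν : Tendsto q l (𝓝 ν)) :
    AsympNormal l (fun k => labelUniform (ι k) (m k)) fun k lab =>
      nnForm (f k) (ctr (q k) lab) / (q k * (1 - q k) * √((Fintype.card (ι k) : ℝ) +
        (Finset.univ.filter fun i => f k (f k i) = i).card)) := by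
  have hP : ∀ k, IsProbabilityMeasure (labelUniform (ι k) (m k)) := fun k =>
    isProbabilityMeasure_labelUniform (hm1 k).le
  refine asympNormal_of_tendsto_charFun (fun k => Measurable.of_discrete) fun t => ?_
  rw [tendsto_iff_norm_sub_tendsto_zero]
  have hcast : Tendsto (fun k => (Fintype.card (ι k) : ℝ)) l atTop :=
    tendsto_natCast_atTop_atTop.comp hlim
  have hsqrt := Real.tendsto_sqrt_atTop.comp hcast
  have hv : Tendsto (fun k => q k * (1 - q k)) l (𝓝 (ν * (1 - ν))) := hν.mul (hν.const_sub 1)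
  have hv0 : 0 < ν * (1 - ν) := mul_pos h0 (by linarith)
  have hs : Tendsto (fun k => q k * (1 - q k) * √(Fintype.card (ι k))) l atTop :=
    hv.pos_mul_atTop hv0 hsqrt
  have hb1 : Tendsto (fun k => (1000 / (q k * (1 - q k) * √(Fintype.card (ι k))) * |t| +
      2 * (26 / (q k * (1 - q k) * √(Fintype.card (ι k)))) *
        (1 + 1000 / (q k * (1 - q k) * √(Fintype.card (ι k)))) * t ^ 2) * |t|) l (𝓝 0) := by
    have a := hs.const_div_atTop 1000
    have b := hs.const_div_atTop 26
    simpa using ((a.mul_const |t|).add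
      (((b.const_mul 2).mul (a.const_add 1)).mul_const (t ^ 2))).mul_const |t|
  have hb2 : Tendsto (fun k => |t| * ((2 * √(52 / √(Fintype.card (ι k)) + 12 / Fintype.card (ι k)) +
      2 / √(Fintype.card (ι k))) / (q k * (1 - q k)))) l (𝓝 0) := by
    have a := ((hsqrt.const_div_atTop 52).add (hcast.const_div_atTop 12)).sqrt
    have b := hsqrt.const_div_atTop 2
    simpa using (((a.const_mul 2).add b).div hv hv0.ne').const_mul |t|
  have hb := hb1.add hb2
  rw [add_zero] at hb
  refine squeeze_zero (fun _ => norm_nonneg _) (fun k => ?_) hb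
  obtain ⟨q0, q1⟩ := labelFraction_mem (hm0 k) (hm1 k) (hq k)
  have hn' : (6 : ℝ) ≤ Fintype.card (ι k) := by exact_mod_cast hn k
  have hvk : 0 < q k * (1 - q k) := mul_pos q0 (by linarith)
  set v := q k * (1 - q k) with hvdef
  set n : ℝ := (Fintype.card (ι k) : ℝ) with hndef
  set R : ℝ := ((Finset.univ.filter fun i => f k (f k i) = i).card : ℝ) with hR
  have hR0 : 0 ≤ R := by positivity
  have hsn : 0 < √n := Real.sqrt_pos.2 (by linarith)
  have hS0 : 0 < v * √(n + R) := mul_pos hvk (Real.sqrt_pos.2 (by linarith))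
  have e1 := norm_charFn_nnForm_sub_le (hf k) q0.le q1.le hvdef hvk (by have := hn k; omega) rfl t
  have e2 := norm_charFn_labelUniform_sub_le (hf k) (hm1 k).le (hn k) (hq k) hS0 t
  -- The coupling error of order n^(1/4) is divided by the scale, which is at least v√n, and put in
  -- a form that visibly tends to 0.
  have e3 : |t| / (v * √(n + R)) * (2 * √(52 * √n + 12) + 2) ≤
      |t| * ((2 * √(52 / √n + 12 / n) + 2 / √n) / v) := by
    have h3 : √(52 / √n + 12 / n) = √(52 * √n + 12) / √n := by
      rw [← Real.sqrt_div' _ (by linarith)]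
      congr 1
      have := Real.sq_sqrt (by linarith : 0 ≤ n)
      field_simp
      linear_combination (-52) * this
    rw [h3]
    calc _ ≤ |t| / (v * √n) * (2 * √(52 * √n + 12) + 2) := by
          gcongr
          linarith
      _ = _ := by field_simp
  refine (norm_sub_le_norm_sub_add_norm_sub _ _ _).trans ((add_le_add (e2.trans e3) e1).trans ?_)
  linarith

/-- Under random labelling with a share of at least `r` reflexive points, the rejection
probabilities of the tests are asymptotically at least those of an inflated normal variable. -/
theorem eventually_le_labelUniform_tail [l.IsCountablyGenerated] (hf : ∀ k, GoodMap (f k))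
    (hm0 : ∀ k, 0 < m k) (hm1 : ∀ k, m k < Fintype.card (ι k)) (hn : ∀ k, 6 ≤ Fintype.card (ι k))
    (hlim : Tendsto (fun k => Fintype.card (ι k)) l atTop) (h0 : 0 < ν) (h1 : ν < 1)
    (hν : Tendsto (fun k => (m k : ℝ) / Fintype.card (ι k)) l (𝓝 ν)) {r : ℝ} (hr : 0 ≤ r)
    (hR : ∀ k, r * Fintype.card (ι k) ≤ (Finset.univ.filter fun i => f k (f k i) = i).card)
    {x δ : ℝ} (hx : 0 < x) (hδ : 0 < δ) :
    ∀ᶠ k in l, 1 - stdCDF (x / √(1 + r)) - δ ≤ (labelUniform (ι k) (m k)).real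
        {lab | x < (nnct lab fun i => lab (f k i)).pielouZ} ∧
      1 - stdCDF (x / √(1 + r)) - δ ≤ (labelUniform (ι k) (m k)).real
        {lab | (nnct lab fun i => lab (f k i)).pielouZ < -x} := by
  have hP : ∀ k, IsProbabilityMeasure (labelUniform (ι k) (m k)) := fun k =>
    isProbabilityMeasure_labelUniform (hm1 k).le
  set q : κ → ℝ := fun k => (m k : ℝ) / Fintype.card (ι k) with hq
  have hcast : Tendsto (fun k => (Fintype.card (ι k) : ℝ)) l atTop :=
    tendsto_natCast_atTop_atTop.comp hlim
  have hv0 : 0 < ν * (1 - ν) := mul_pos h0 (by linarith)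
  have hW := asympNormal_labelUniform hf hm0 hm1 hn hlim h0 h1 (fun k => rfl) hν
  have hC : TendstoInProb l (fun k => labelUniform (ι k) (m k))
      (fun k lab => (∑ i, ind (lab (f k i))) / Fintype.card (ι k)) ν := by
    have hv : Tendsto (fun k => 2 * (25 / (Fintype.card (ι k) : ℝ)) + 2 * (q k - ν) ^ 2) l (𝓝 0) := by
      simpa using ((hcast.const_div_atTop 25).const_mul 2).add (((hν.sub_const ν).pow 2).const_mul 2)
    refine tendstoInProb_of_sq (fun k => BddMeas.of_finite _) (fun k => ?_) hv
    have hn' : (6 : ℝ) ≤ Fintype.card (ι k) := by exact_mod_cast hn k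
    have h2 := integral_labelUniform_sum_ctr_sq_le (hf k) (hm1 k).le (by have := hn k; omega)
      (rfl : q k = m k / Fintype.card (ι k))
    calc _ ≤ ∫ lab, (2 / (Fintype.card (ι k) : ℝ) ^ 2 * (∑ i, ctr (q k) lab (f k i)) ^ 2 +
            2 * (q k - ν) ^ 2) ∂(labelUniform (ι k) (m k)) := by
          refine integral_mono Integrable.of_finite Integrable.of_finite fun lab => ?_
          have e : (∑ i, ind (lab (f k i))) / Fintype.card (ι k) - ν =
              (∑ i, ctr (q k) lab (f k i)) / Fintype.card (ι k) + (q k - ν) := by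
            simp only [ctr]
            rw [Finset.sum_sub_distrib]
            simp
            field_simp
            ring
          simp only
          rw [e, div_mul_eq_mul_div, mul_div_assoc, ← div_pow]
          nlinarith [sq_nonneg ((∑ i, ctr (q k) lab (f k i)) / Fintype.card (ι k) - (q k - ν))]
      _ ≤ _ := by
          rw [integral_add Integrable.of_finite Integrable.of_finite, integral_const_mul]
          have : 2 / (Fintype.card (ι k) : ℝ) ^ 2 *
              ∫ lab, (∑ i, ctr (q k) lab (f k i)) ^ 2 ∂(labelUniform (ι k) (m k)) ≤
              2 / (Fintype.card (ι k) : ℝ) ^ 2 * (25 * Fintype.card (ι k)) := by gcongr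
          have e2 : 2 / (Fintype.card (ι k) : ℝ) ^ 2 * (25 * Fintype.card (ι k)) =
              2 * (25 / (Fintype.card (ι k) : ℝ)) := by field_simp
          simp only [integral_const, probReal_univ, one_smul]
          linarith
  -- The table identity is normalized by the limit ν (1 - ν), the form by the actual class fraction;
  -- this factor passes from one to the other.
  have hfac : TendstoInProb l (fun k => labelUniform (ι k) (m k))
      (fun k _ => √(q k * (1 - q k) / (ν * (1 - ν)))) 1 := by
    refine .of_tendsto ?_
    have := ((hν.mul (hν.const_sub 1)).div_const (ν * (1 - ν))).sqrt
    rwa [div_self hv0.ne', Real.sqrt_one] at this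
  have hWU := hW.mul_of_tendstoInProb (hfac.mul_one (hC.sqrt_factor h0 h1)) (V := fun k lab => _)
    (Eventually.of_forall fun k lab => rfl)
  -- The share R/n need not converge. Only its lower bound r is used, so the tails are bounded below
  -- instead of having a limit.
  have hmain := hWU.eventually_le_tail (c := fun k => √(1 +
    ((Finset.univ.filter fun i => f k (f k i) = i).card : ℝ) / Fintype.card (ι k))) (c₀ := √(1 + r))
    (V := fun k lab => _) (Real.sqrt_pos.2 (by linarith)) (Eventually.of_forall fun k => ?_)
    (Eventually.of_forall fun k lab => rfl) hx hδ
  swap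
  · have hn' : (6 : ℝ) ≤ Fintype.card (ι k) := by exact_mod_cast hn k
    refine Real.sqrt_le_sqrt ?_
    have := (le_div_iff₀ (by linarith)).2 (hR k)
    linarith
  -- The identity needs exactly `m k` labels of class 1 and therefore holds only almost surely.
  have heq : ∀ k, ∀ᵐ lab ∂(labelUniform (ι k) (m k)), √(1 +
      ((Finset.univ.filter fun i => f k (f k i) = i).card : ℝ) / Fintype.card (ι k)) *
      (nnForm (f k) (ctr (q k) lab) / (q k * (1 - q k) * √((Fintype.card (ι k) : ℝ) +
        (Finset.univ.filter fun i => f k (f k i) = i).card)) *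
      (√(q k * (1 - q k) / (ν * (1 - ν))) * √(ν * (1 - ν) /
        ((∑ i, ind (lab (f k i))) / Fintype.card (ι k) *
          (1 - (∑ i, ind (lab (f k i))) / Fintype.card (ι k)))))) =
      (nnct lab fun i => lab (f k i)).pielouZ := by
    intro k
    filter_upwards [ae_labelUniform (hm1 k).le] with lab hlab
    obtain ⟨q0, q1⟩ := labelFraction_mem (hm0 k) (hm1 k) rfl
    obtain ⟨r0, r1⟩ := nnct_rowSum_of_countZero hlab fun i => lab (f k i)
    have hn' : (6 : ℝ) ≤ Fintype.card (ι k) := by exact_mod_cast hn k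
    have hmk : (0 : ℝ) < m k := by exact_mod_cast hm0 k
    have hmk' : (m k : ℝ) < Fintype.card (ι k) := by exact_mod_cast hm1 k
    have hz1 : (nnct lab fun i => lab (f k i)).rowSum 1 ≠ 0 := by
      intro h
      rw [h] at r1
      push_cast at r1
      linarith
    rw [Table.pielouZ_eq_of_pos _ hv0 (by rw [r0]; exact (hm0 k).ne') hz1, r0, r1, nnct_total,
      nnct_colSum_zero, diffT_eq_nnForm hlab (hm0 k) (hm1 k) rfl, ← mul_assoc, ← mul_assoc]
    congr 1
    have hvk : 0 < q k * (1 - q k) := mul_pos q0 (by linarith)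
    have e1 : (Fintype.card (ι k) : ℝ) / (m k * (Fintype.card (ι k) - m k)) =
        1 / (Fintype.card (ι k) * (q k * (1 - q k))) := by
      simp only [hq]
      have : (Fintype.card (ι k) : ℝ) - m k ≠ 0 := by linarith
      field_simp
    rw [e1]
    change _ = nnForm (f k) (ctr (q k) lab) / (Fintype.card (ι k) * (q k * (1 - q k))) / _
    generalize q k * (1 - q k) = w at *
    generalize ν * (1 - ν) = v at *
    generalize nnForm (f k) (ctr (q k) lab) = A
    generalize (Fintype.card (ι k) : ℝ) = n at *
    have hR0 : (0 : ℝ) ≤ (Finset.univ.filter fun i => f k (f k i) = i).card := by positivity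
    generalize ((Finset.univ.filter fun i => f k (f k i) = i).card : ℝ) = R at *
    have hn0 : 0 < n := by linarith
    have a1 : √(1 + R / n) = √(n + R) / √n := by
      rw [← Real.sqrt_div' _ hn0.le]; congr 1; field_simp
    have a2 : √(v * (1 / (n * w))) = √v / (√n * √w) := by
      rw [← Real.sqrt_mul hn0.le, ← Real.sqrt_div' _ (by positivity)]; congr 1; field_simp
    have a3 : √(w / v) = √w / √v := Real.sqrt_div' _ hv0.le
    have b1 : 0 < √n := Real.sqrt_pos.2 hn0
    have b2 : 0 < √w := Real.sqrt_pos.2 hvk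
    have b3 : 0 < √v := Real.sqrt_pos.2 hv0
    have b4 : 0 < √(n + R) := Real.sqrt_pos.2 (by linarith)
    have b5 := Real.sq_sqrt hn0.le
    rw [a1, a2, a3]
    field_simp
    rw [b5]
  filter_upwards [hmain.1, hmain.2] with k ha hb
  refine ⟨ha.trans (le_of_eq (measureReal_congr ?_)), hb.trans (le_of_eq (measureReal_congr ?_))⟩
  · filter_upwards [heq k] with lab hlab
    exact congrArg (fun z : ℝ => x < z) hlab
  · filter_upwards [heq k] with lab hlab
    exact congrArg (fun z : ℝ => z < -x) hlab

end RandomLabellingLimit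

lemma lt_liminf_of_eventually_le {u : ℕ → ℝ} {a b : ℝ} (hu : ∀ k, u k ≤ 1) (hab : a < b)
    (h : ∀ᶠ k in atTop, b ≤ u k) : a < liminf u atTop :=
  hab.trans_le (le_liminf_of_le
    (isBoundedUnder_of ⟨1, hu⟩).isCoboundedUnder_ge h)

/-- The asymptotic rejection probability of a nominal level `α` test based on a normal variable
with variance `1 + r`. -/
def inflatedSize (r α : ℝ) : ℝ := 1 - stdCDF (normalQuantile (1 - α) / √(1 + r))

lemma inflatedSize_zero {α : ℝ} (h0 : 0 < α) (h1 : α < 1) : inflatedSize 0 α = α := by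
  rw [inflatedSize, add_zero, Real.sqrt_one, div_one,
    stdCDF_normalQuantile (by linarith) (by linarith), sub_sub_cancel]

/-- For α < 1/2 the critical value is positive, so dividing it by √(1 + r) > 1 lowers it strictly.
-/
lemma lt_inflatedSize {r α : ℝ} (hr : 0 < r) (h0 : 0 < α) (h1 : α < 1 / 2) :
    α < inflatedSize r α := by
  have hz := normalQuantile_one_sub_pos h0 h1
  have h2 : stdCDF (normalQuantile (1 - α) / √(1 + r)) < stdCDF (normalQuantile (1 - α)) := by
    refine stdCDF_strictMono (div_lt_self hz ?_)
    rw [Real.lt_sqrt (by norm_num)]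
    linarith
  rw [stdCDF_normalQuantile (by linarith) (by linarith)] at h2
  rw [inflatedSize]
  linarith

/-! ### Sequences of class sizes: variance comparison and liberality -/

section Sequences

variable {n₁ n₂ : ℕ → ℕ} {ν : ℝ}

lemma eventually_pos_sizes (h0 : 0 < ν) (h1 : ν < 1)
    (hlim : Tendsto (fun k => (n₁ k : ℝ) / ((n₁ k : ℝ) + n₂ k)) atTop (𝓝 ν)) :
    ∀ᶠ k in atTop, 0 < n₁ k ∧ 0 < n₂ k := by
  filter_upwards [(tendsto_order.1 hlim).1 0 h0, (tendsto_order.1 hlim).2 1 h1] with k a b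
  have ha : 0 < n₁ k := by
    by_contra hn
    have : n₁ k = 0 := by omega
    simp [this] at a
  refine ⟨ha, ?_⟩
  by_contra hn
  have : n₂ k = 0 := by omega
  have ha' : (n₁ k : ℝ) ≠ 0 := by exact_mod_cast ha.ne'
  simp [this, ha'] at b

/-- Lower bounds for the rejection probabilities under random labelling, uniformly in the
locations. -/
theorem eventually_le_rlLaw_reject (h0 : 0 < ν) (h1 : ν < 1)
    (hn : Tendsto (fun k => n₁ k + n₂ k) atTop atTop)
    (hlim : Tendsto (fun k => (n₁ k : ℝ) / ((n₁ k : ℝ) + n₂ k)) atTop (𝓝 ν)) {r : ℝ} (hr : 0 ≤ r)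
    {S : Table → ℝ} (hS : S = Table.pielouZ ∨ S = Table.pielouZtilde) {α δ : ℝ} (hα0 : 0 < α)
    (hα1 : α < 1 / 2) (hδ : 0 < δ) :
    ∀ᶠ k in atTop, ∀ f : Fin (n₁ k + n₂ k) → Fin (n₁ k + n₂ k), GoodMap f →
      r * ((n₁ k : ℝ) + n₂ k) ≤ reflexiveCount f →
      inflatedSize r α - δ ≤ (rlLaw (n₁ k) (n₂ k)).real {lab | spatialTable f lab ∈ rejectSeg S α} ∧
      inflatedSize r α - δ ≤
        (rlLaw (n₁ k) (n₂ k)).real {lab | spatialTable f lab ∈ rejectAssoc S α} := by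
  have hS' : S = Table.pielouZ := hS.elim id fun h => h.trans Table.pielouZtilde_eq_pielouZ
  subst hS'
  -- Uniformity in the map is obtained by making it part of the index: eventually along the filter
  -- pulled back from `k` means for all large `k` and every admissible `f`.
  let κ := {p : Σ k, (Fin (n₁ k + n₂ k) → Fin (n₁ k + n₂ k)) // GoodMap p.2 ∧
    r * ((n₁ p.1 : ℝ) + n₂ p.1) ≤ reflexiveCount p.2 ∧ 0 < n₁ p.1 ∧ 0 < n₂ p.1 ∧
    6 ≤ n₁ p.1 + n₂ p.1}
  have hfst : Tendsto (fun p : κ => p.1.1) (comap (fun p : κ => p.1.1) atTop) atTop := tendsto_comap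
  have key := eventually_le_labelUniform_tail (l := comap (fun p : κ => p.1.1) atTop)
    (ι := fun p : κ => Fin (n₁ p.1.1 + n₂ p.1.1)) (f := fun p => p.1.2) (m := fun p => n₁ p.1.1)
    (ν := ν) (fun p => p.2.1) (fun p => p.2.2.2.1)
    (fun p => by have := p.2.2.2.2.1; rw [Fintype.card_fin]; omega)
    (fun p => by rw [Fintype.card_fin]; exact p.2.2.2.2.2)
    (by simp_rw [Fintype.card_fin]; exact hn.comp hfst) h0 h1
    (by simp_rw [Fintype.card_fin, Nat.cast_add]; exact hlim.comp hfst) hr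
    (fun p => by rw [Fintype.card_fin, Nat.cast_add]; exact p.2.2.1)
    (normalQuantile_one_sub_pos hα0 hα1) hδ
  rw [eventually_comap] at key
  filter_upwards [key, eventually_pos_sizes h0 h1 hlim, hn.eventually_ge_atTop 6] with k hk hpos h6
    f hf hR
  have := hk ⟨⟨k, f⟩, hf, hR, hpos.1, hpos.2, h6⟩ rfl
  refine ⟨this.1, this.2.trans (le_of_eq ?_)⟩
  rw [normalQuantile_one_sub hα0 (by linarith), neg_neg]
  rfl

lemma tendsto_label_variance (hlim : Tendsto (fun k => (n₁ k : ℝ) / ((n₁ k : ℝ) + n₂ k)) atTop (𝓝 ν)) :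
    Tendsto (fun k => (n₁ k : ℝ) / ((n₁ k : ℝ) + n₂ k) * (1 - (n₁ k : ℝ) / ((n₁ k : ℝ) + n₂ k)))
      atTop (𝓝 (ν * (1 - ν))) := hlim.mul (hlim.const_sub 1)

/-- Comparison of the variance in the row-wise framework with a second moment that is inflated by
reflexive pairs. -/
lemma eventually_variance_rowwise_lt (h0 : 0 < ν) (h1 : ν < 1)
    (hn : Tendsto (fun k => n₁ k + n₂ k) atTop atTop)
    (hlim : Tendsto (fun k => (n₁ k : ℝ) / ((n₁ k : ℝ) + n₂ k)) atTop (𝓝 ν)) {r : ℝ} (hr : 0 < r) :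
    ∀ᶠ k in atTop, ∀ r' E : ℝ, r ≤ r' → (1 + r' - 400 / (((n₁ k : ℝ) + n₂ k) *
        ((n₁ k : ℝ) / ((n₁ k : ℝ) + n₂ k) * (1 - (n₁ k : ℝ) / ((n₁ k : ℝ) + n₂ k))) ^ 2)) /
        ((n₁ k : ℝ) + n₂ k) ≤ E →
      variance (fun s => (rowwiseTable s).diffT)
        (rowwiseLaw (n₁ k) (n₂ k) ((n₁ k : ℝ) / ((n₁ k : ℝ) + n₂ k))
          ((n₁ k : ℝ) / ((n₁ k : ℝ) + n₂ k))) < E - (-1 / ((n₁ k : ℝ) + n₂ k - 1)) ^ 2 := by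
  have hv0 : 0 < ν * (1 - ν) := mul_pos h0 (by linarith)
  have hcast : Tendsto (fun k => (n₁ k : ℝ) + n₂ k) atTop atTop := by
    exact (tendsto_natCast_atTop_atTop.comp hn).congr fun k => Nat.cast_add _ _
  have hv := tendsto_label_variance hlim
  -- After multiplication by n², the gain n r from reflexive pairs outgrows the bounded moment error
  -- 400/v² and the squared mean, which is at most 4/n².
  have hinf : Tendsto (fun k => ((n₁ k : ℝ) + n₂ k) * r - 400 / ((n₁ k : ℝ) / ((n₁ k : ℝ) + n₂ k) *
      (1 - (n₁ k : ℝ) / ((n₁ k : ℝ) + n₂ k))) ^ 2) atTop atTop := by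
    have h2 := (tendsto_const_nhds (x := (400 : ℝ))).div (hv.pow 2) (by positivity)
    simpa [sub_eq_add_neg] using (hcast.atTop_mul_const hr).atTop_add h2.neg
  filter_upwards [eventually_pos_sizes h0 h1 hlim, hinf.eventually_gt_atTop 4,
    hcast.eventually_ge_atTop 2, (tendsto_order.1 hv).1 0 hv0] with k hpos hk h2 hvk r' E hr' hE
  refine (variance_rowwise_diffT_le hpos.1 hpos.2 rfl).trans_lt ?_
  set n := (n₁ k : ℝ) + n₂ k with hndef
  set v := (n₁ k : ℝ) / n * (1 - (n₁ k : ℝ) / n) with hvdef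
  have hn0 : 0 < n := by linarith
  have e1 : (-1 / (n - 1)) ^ 2 ≤ 4 / n ^ 2 := by
    rw [div_pow, neg_one_sq, div_le_div_iff₀ (by nlinarith) (by positivity)]
    nlinarith
  have e2 : 1 / n + 4 / n ^ 2 < (1 + r' - 400 / (n * v ^ 2)) / n := by
    have : (1 + r' - 400 / (n * v ^ 2)) / n - (1 / n + 4 / n ^ 2) =
        (n * r' - 400 / v ^ 2 - 4) / n ^ 2 := by field_simp; ring
    have h3 : 0 < (n * r' - 400 / v ^ 2 - 4) / n ^ 2 := by
      have : n * r ≤ n * r' := by gcongr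
      exact div_pos (by linarith) (by positivity)
    linarith
  linarith

variable {f : ∀ k, Fin (n₁ k + n₂ k) → Fin (n₁ k + n₂ k)}

/-- Under random labelling, the variance of `T` exceeds that in the row-wise framework. -/
theorem eventually_variance_rowwise_lt_rlLaw (h0 : 0 < ν) (h1 : ν < 1)
    (hn : Tendsto (fun k => n₁ k + n₂ k) atTop atTop)
    (hlim : Tendsto (fun k => (n₁ k : ℝ) / ((n₁ k : ℝ) + n₂ k)) atTop (𝓝 ν)) {r : ℝ} (hr : 0 < r)
    (hf : ∀ k, GoodMap (f k))
    (hR : ∀ᶠ k in atTop, r * ((n₁ k : ℝ) + n₂ k) ≤ reflexiveCount (f k)) :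
    ∀ᶠ k in atTop, variance (fun s => (rowwiseTable s).diffT)
        (rowwiseLaw (n₁ k) (n₂ k) ((n₁ k : ℝ) / ((n₁ k : ℝ) + n₂ k))
          ((n₁ k : ℝ) / ((n₁ k : ℝ) + n₂ k))) <
      variance (fun lab => (spatialTable (f k) lab).diffT) (rlLaw (n₁ k) (n₂ k)) := by
  filter_upwards [eventually_variance_rowwise_lt h0 h1 hn hlim hr, hR,
    eventually_pos_sizes h0 h1 hlim, hn.eventually_ge_atTop 6] with k hk hRk hpos h6
  have hc : Fintype.card (Fin (n₁ k + n₂ k)) = n₁ k + n₂ k := Fintype.card_fin _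
  have hlt : n₁ k < Fintype.card (Fin (n₁ k + n₂ k)) := by omega
  have hprob : IsProbabilityMeasure (rlLaw (n₁ k) (n₂ k)) :=
    isProbabilityMeasure_labelUniform hlt.le
  have hmean := integral_labelUniform_diffT (hf k) hpos.1 hlt
  have hsq := integral_labelUniform_diffT_sq_ge (hf k) hpos.1 hlt (by omega) rfl rfl
  rw [hc, Nat.cast_add] at hmean hsq
  have hvar := variance_eq_sub (μ := rlLaw (n₁ k) (n₂ k)) ((BddMeas.of_finite fun
    lab : Fin (n₁ k + n₂ k) → Fin 2 => (spatialTable (f k) lab).diffT).memLp _ 2)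
  rw [hvar]
  have hpos' : (0 : ℝ) < (n₁ k : ℝ) + n₂ k := by
    have : 0 < n₁ k + n₂ k := by omega
    exact_mod_cast this
  have := hk _ _ ((le_div_iff₀ hpos').2 hRk) hsq
  rw [← hmean] at this
  exact this

/-- Under random labelling, the tests are liberal. -/
theorem lt_liminf_rlLaw_reject (h0 : 0 < ν) (h1 : ν < 1)
    (hn : Tendsto (fun k => n₁ k + n₂ k) atTop atTop)
    (hlim : Tendsto (fun k => (n₁ k : ℝ) / ((n₁ k : ℝ) + n₂ k)) atTop (𝓝 ν)) {r : ℝ} (hr : 0 < r)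
    (hf : ∀ k, GoodMap (f k))
    (hR : ∀ᶠ k in atTop, r * ((n₁ k : ℝ) + n₂ k) ≤ reflexiveCount (f k))
    {S : Table → ℝ} (hS : S = Table.pielouZ ∨ S = Table.pielouZtilde) {α : ℝ} (hα0 : 0 < α)
    (hα1 : α < 1 / 2) :
    α < liminf (fun k => (rlLaw (n₁ k) (n₂ k)).real
      {lab | spatialTable (f k) lab ∈ rejectSeg S α}) atTop ∧
    α < liminf (fun k => (rlLaw (n₁ k) (n₂ k)).real
      {lab | spatialTable (f k) lab ∈ rejectAssoc S α}) atTop := by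
  have hprob : ∀ k, IsProbabilityMeasure (rlLaw (n₁ k) (n₂ k)) := fun k =>
    isProbabilityMeasure_labelUniform (ι := Fin (n₁ k + n₂ k)) (by rw [Fintype.card_fin]; omega)
  have hgap := lt_inflatedSize hr hα0 hα1
  have hev := eventually_le_rlLaw_reject h0 h1 hn hlim hr.le hS hα0 hα1
    (δ := (inflatedSize r α - α) / 2) (by linarith)
  constructor
  · refine lt_liminf_of_eventually_le (fun k => measureReal_le_one)
      (b := inflatedSize r α - (inflatedSize r α - α) / 2) (by linarith) ?_
    filter_upwards [hev, hR] with k hk hRk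
    exact (hk _ (hf k) hRk).1
  · refine lt_liminf_of_eventually_le (fun k => measureReal_le_one)
      (b := inflatedSize r α - (inflatedSize r α - α) / 2) (by linarith) ?_
    filter_upwards [hev, hR] with k hk hRk
    exact (hk _ (hf k) hRk).2

end Sequences

/-! ### Exchangeable locations -/

section Exchangeable

variable {n : ℕ} {x : Fin n → Plane}

/-- No point has the same distance to two other points. -/
def NoTies (x : Fin n → Plane) : Prop :=
  ∀ i j l, j ≠ i → l ≠ i → j ≠ l → dist (x i) (x j) ≠ dist (x i) (x l)

lemma NoTies.isNN_unique (hx : NoTies x) {i j l : Fin n} (hj : IsNN x i j) (hl : IsNN x i l) :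
    j = l := by
  by_contra hne
  exact hx i j l hj.1 hl.1 hne (le_antisymm (hj.2 l hl.1) (hl.2 j hj.1))

/-- Equivariance under relabelling of the points relies on unique nearest neighbours, because ties
are broken by the index. -/
lemma NoTies.nnMap_comp (hx : NoTies x) (hn : 2 ≤ n) (π : Equiv.Perm (Fin n)) (i : Fin n) :
    nnMap (x ∘ π) i = π.symm (nnMap x (π i)) := by
  rw [Equiv.eq_symm_apply]
  have h := isNNMap_nnMap hn (x ∘ π) i
  refine hx.isNN_unique ⟨fun h' => h.1 (π.injective h'), fun l hl => ?_⟩ (isNNMap_nnMap hn x (π i))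
  have := h.2 (π.symm l) fun h' => hl (by rw [← h', Equiv.apply_symm_apply])
  simpa using this

lemma NoTies.spatialTable_comp (hx : NoTies x) (hn : 2 ≤ n) (π : Equiv.Perm (Fin n))
    (b : Fin n → Fin 2) :
    spatialTable (nnMap (x ∘ π)) b = spatialTable (nnMap x) (b ∘ ⇑π⁻¹) := by
  rw [spatialTable, spatialTable, ← nnct_comp_equiv (b ∘ ⇑π⁻¹) _ π]
  congr 1
  · funext i; simp
  · funext i; rw [hx.nnMap_comp hn]; rfl

lemma integral_permLaw_inv {ι : Type*} [Fintype ι] [DecidableEq ι] (F : Equiv.Perm ι → ℝ) :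
    ∫ π, F π⁻¹ ∂(permLaw ι) = ∫ π, F π ∂(permLaw ι) := by
  rw [integral_permLaw, integral_permLaw]
  congr 1
  exact Equiv.sum_comp (Equiv.inv _) F

/-- Given the exchangeable locations, labels by blocks are as good as random labels. -/
lemma integral_exchangeable {n₁ n₂ : ℕ} (hn : 2 ≤ n₁ + n₂) (μ : Measure Plane)
    [IsProbabilityMeasure μ]
    (hties : ∀ᵐ x ∂(Measure.pi fun _ : Fin (n₁ + n₂) => μ), NoTies x) (h : Table → ℝ) :
    ∫ x, h (blockTable x) ∂(Measure.pi fun _ : Fin (n₁ + n₂) => μ) =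
      ∫ x, ∫ lab, h (spatialTable (nnMap x) lab) ∂(rlLaw n₁ n₂)
        ∂(Measure.pi fun _ : Fin (n₁ + n₂) => μ) := by
  have hb : ∀ lab : Fin (n₁ + n₂) → Fin 2, BddMeas fun x : Fin (n₁ + n₂) → Plane =>
      h (spatialTable (nnMap x) lab) := fun lab => bddMeas_nnMap fun f => h (spatialTable f lab)
  have h0 := integral_pi_comp_perm μ ((hb (blockLabels n₁ n₂)).integrable _)
  refine h0.trans ?_
  have h1 : ∀ x : Fin (n₁ + n₂) → Plane, ∫ lab, h (spatialTable (nnMap x) lab) ∂(rlLaw n₁ n₂) =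
      ∫ π, h (spatialTable (nnMap x) (blockLabels n₁ n₂ ∘ π)) ∂(permLaw (Fin (n₁ + n₂))) := fun x =>
    integral_labelUniform (countZero_blockLabels n₁ n₂) _
  simp_rw [h1]
  -- Shuffling the locations under fixed labels amounts to shuffling the labels by the inverse
  -- permutation, which is again uniform.
  have h2 : ∀ π : Equiv.Perm (Fin (n₁ + n₂)),
      ∫ x, h (spatialTable (nnMap (x ∘ π)) (blockLabels n₁ n₂)) ∂(Measure.pi fun _ => μ) =
      ∫ x, h (spatialTable (nnMap x) (blockLabels n₁ n₂ ∘ ⇑π⁻¹)) ∂(Measure.pi fun _ => μ) := fun π => by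
    refine integral_congr_ae ?_
    filter_upwards [hties] with x hx
    rw [hx.spatialTable_comp hn]
  change ∫ π : Equiv.Perm (Fin (n₁ + n₂)),
      ∫ x, h (spatialTable (nnMap (x ∘ π)) (blockLabels n₁ n₂)) ∂(Measure.pi fun _ => μ)
        ∂(permLaw (Fin (n₁ + n₂))) = _
  simp_rw [h2]
  rw [integral_permLaw_inv fun π => ∫ x, h (spatialTable (nnMap x) (blockLabels n₁ n₂ ∘ π))
    ∂(Measure.pi fun _ => μ)]
  simp_rw [integral_permLaw]
  rw [integral_smul, integral_finsetSum _ fun π _ => (hb _).integrable _]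

end Exchangeable

/-! ### Reflexive pairs among independent points -/

/-- The indicator of two points being within distance `ρ`. -/
def closeInd (ρ : ℝ) (z : Plane × Plane) : ℝ := if dist z.1 z.2 ≤ ρ then 1 else 0

lemma closeInd_comm (ρ : ℝ) (y z : Plane) : closeInd ρ (y, z) = closeInd ρ (z, y) := by
  simp only [closeInd, dist_comm]

lemma closeInd_nonneg (ρ : ℝ) (z : Plane × Plane) : 0 ≤ closeInd ρ z := by
  unfold closeInd; split_ifs <;> norm_num

lemma bddMeas_closeInd (ρ : ℝ) : BddMeas (closeInd ρ) := by
  refine ⟨Measurable.ite (measurableSet_le (measurable_fst.dist measurable_snd) measurable_const)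
    measurable_const measurable_const, 1, fun z => ?_⟩
  unfold closeInd
  split_ifs <;> norm_num

section Reflexive

variable {n : ℕ}

/-- Two points that are close to each other, with all other points far away, form a reflexive
pair. -/
lemma sum_closeInd_le_reflexiveCount (hn : 2 ≤ n) (x : Fin n → Plane) (ρ : ℝ) :
    ∑ i, ∑ j ∈ Finset.univ.erase i, closeInd ρ (x i, x j) *
      (1 - ∑ l ∈ (Finset.univ.erase i).erase j, (closeInd ρ (x i, x l) + closeInd ρ (x j, x l))) ≤
      (reflexiveCount (nnMap x) : ℝ) := by
  rw [reflexiveCount, Finset.natCast_card_filter]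
  refine Finset.sum_le_sum fun i _ => ?_
  -- A positive term forces `j` to be close to `i` and every other point to be far from both. Then i
  -- and j are mutual neighbours, and the other terms of row `i` vanish, so each row contributes at
  -- most the indicator of reflexivity.
  by_cases hall : ∀ j ∈ Finset.univ.erase i, closeInd ρ (x i, x j) *
      (1 - ∑ l ∈ (Finset.univ.erase i).erase j, (closeInd ρ (x i, x l) + closeInd ρ (x j, x l))) ≤ 0
  · refine (Finset.sum_nonpos hall).trans ?_
    split_ifs <;> norm_num
  push Not at hall
  obtain ⟨j, hj, hpos⟩ := hall
  have hji : j ≠ i := Finset.ne_of_mem_erase hj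
  set s := ∑ l ∈ (Finset.univ.erase i).erase j, (closeInd ρ (x i, x l) + closeInd ρ (x j, x l))
    with hs
  have hd : dist (x i) (x j) ≤ ρ := by
    by_contra hc
    simp [closeInd, hc] at hpos
  have hK : closeInd ρ (x i, x j) = 1 := by simp [closeInd, hd]
  rw [hK, one_mul] at hpos
  have hnn : ∀ l ∈ (Finset.univ.erase i).erase j,
      0 ≤ closeInd ρ (x i, x l) + closeInd ρ (x j, x l) := fun l _ =>
    add_nonneg (closeInd_nonneg _ _) (closeInd_nonneg _ _)
  have hfar : ∀ l, l ≠ i → l ≠ j → ρ < dist (x i) (x l) ∧ ρ < dist (x j) (x l) := by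
    intro l hli hlj
    have hle := Finset.single_le_sum hnn (a := l)
      (Finset.mem_erase.2 ⟨hlj, Finset.mem_erase.2 ⟨hli, Finset.mem_univ _⟩⟩)
    have hlt : closeInd ρ (x i, x l) + closeInd ρ (x j, x l) < 1 := by linarith
    have a := closeInd_nonneg ρ (x i, x l)
    have b := closeInd_nonneg ρ (x j, x l)
    constructor
    · by_contra hc
      simp [closeInd, not_lt.1 hc] at hlt a b
      linarith
    · by_contra hc
      simp [closeInd, not_lt.1 hc] at hlt a b
      linarith
  have hN := isNNMap_nnMap hn x
  have hi : nnMap x i = j := by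
    by_contra hne
    have h1 := (hN i).2 j hji
    linarith [(hfar _ (hN i).1 hne).1]
  have hj' : nnMap x j = i := by
    by_contra hne
    have h1 := (hN j).2 i hji.symm
    rw [dist_comm (x j) (x i)] at h1
    linarith [(hfar _ hne (hN j).1).2]
  rw [if_pos (by rw [hi, hj'])]
  rw [Finset.sum_eq_single j]
  · rw [hK, one_mul]
    linarith [Finset.sum_nonneg hnn]
  · intro l hl hlj
    have := (hfar l (Finset.ne_of_mem_erase hl) hlj).1
    simp [closeInd, not_le.2 this]
  · intro h; exact absurd hj h

variable {μ : Measure Plane} [IsProbabilityMeasure μ]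

lemma integral_closeInd_pair (ρ : ℝ) {i j : Fin n} (hij : j ≠ i) :
    ∫ x, closeInd ρ (x i, x j) ∂(Measure.pi fun _ : Fin n => μ) =
      ∫ y, ∫ z, closeInd ρ (y, z) ∂μ ∂μ := by
  have hb := bddMeas_closeInd ρ
  have h1 : BddMeas fun x : Fin n → Plane => closeInd ρ (x i, x j) :=
    hb.comp ((measurable_pi_apply i).prodMk (measurable_pi_apply j))
  have h2 : BddMeas fun x : Fin n → Plane => ∫ z, closeInd ρ (x i, z) ∂μ :=
    (hb.integral_right μ).comp (measurable_pi_apply i)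
  rw [← integral_update (fun _ => μ) j (h1.integrable _)]
  simp_rw [Function.update_self, Function.update_of_ne hij.symm]
  rw [← integral_update (fun _ => μ) i (h2.integrable _)]
  simp

/-- The point `x l` is integrated out first, with the bound β uniform in the centre. -/
lemma integral_closeInd_triple_le {ρ β : ℝ} (hβ : ∀ y, ∫ z, closeInd ρ (y, z) ∂μ ≤ β)
    {i j l : Fin n} (hli : l ≠ i) (hlj : l ≠ j) :
    ∫ x, closeInd ρ (x i, x j) * closeInd ρ (x i, x l) ∂(Measure.pi fun _ : Fin n => μ) ≤
      β * ∫ x, closeInd ρ (x i, x j) ∂(Measure.pi fun _ : Fin n => μ) := by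
  have hb := bddMeas_closeInd ρ
  have h0 : ∀ j, BddMeas fun x : Fin n → Plane => closeInd ρ (x i, x j) := fun j =>
    hb.comp ((measurable_pi_apply i).prodMk (measurable_pi_apply j))
  have h2 : BddMeas fun x : Fin n → Plane => ∫ z, closeInd ρ (x i, z) ∂μ :=
    (hb.integral_right μ).comp (measurable_pi_apply i)
  rw [← integral_update (fun _ => μ) l (((h0 j).mul (h0 l)).integrable _)]
  simp_rw [Function.update_self, Function.update_of_ne hli.symm, Function.update_of_ne hlj.symm,
    integral_const_mul]
  rw [← integral_const_mul]
  refine integral_mono (((h0 j).mul h2).integrable _) (((h0 j).const_mul β).integrable _)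
    fun x => ?_
  simp only
  rw [mul_comm β]
  exact mul_le_mul_of_nonneg_left (hβ _) (closeInd_nonneg _ _)

/-- A lower bound for the expected number of points in reflexive pairs. -/
lemma le_integral_reflexiveCount (hn : 2 ≤ n) {ρ β : ℝ} (hβ : ∀ y, ∫ z, closeInd ρ (y, z) ∂μ ≤ β) :
    (n : ℝ) * (n - 1) * ((1 - 2 * n * β) * ∫ y, ∫ z, closeInd ρ (y, z) ∂μ ∂μ) ≤
      ∫ x, (reflexiveCount (nnMap x) : ℝ) ∂(Measure.pi fun _ : Fin n => μ) := by
  have hb := bddMeas_closeInd ρ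
  set p := ∫ y, ∫ z, closeInd ρ (y, z) ∂μ ∂μ with hp
  have hp0 : 0 ≤ p := integral_nonneg fun y => integral_nonneg fun z => closeInd_nonneg _ _
  have hβ0 : 0 ≤ β := (integral_nonneg fun z => closeInd_nonneg _ _).trans (hβ 0)
  have hc : ∀ i j, BddMeas fun x : Fin n → Plane => closeInd ρ (x i, x j) := fun i j =>
    hb.comp ((measurable_pi_apply i).prodMk (measurable_pi_apply j))
  have hsum : ∀ i j, BddMeas fun x : Fin n → Plane => ∑ l ∈ (Finset.univ.erase i).erase j,
      (closeInd ρ (x i, x j) * closeInd ρ (x i, x l) +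
        closeInd ρ (x i, x j) * closeInd ρ (x j, x l)) := by
    intro i j
    induction (Finset.univ.erase i).erase j using Finset.induction_on with
    | empty => simpa using BddMeas.const 0
    | insert a s ha ih =>
      simp_rw [Finset.sum_insert ha]
      exact (((hc i j).mul (hc i a)).add ((hc i j).mul (hc j a))).add ih
  have hterm : ∀ i j, BddMeas fun x : Fin n → Plane => closeInd ρ (x i, x j) *
      (1 - ∑ l ∈ (Finset.univ.erase i).erase j, (closeInd ρ (x i, x l) + closeInd ρ (x j, x l))) := by
    intro i j
    have := (hc i j).sub (hsum i j)
    simpa only [mul_sub, mul_one, Finset.mul_sum, mul_add] using this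
  have hpair : ∀ i, ∀ j ∈ Finset.univ.erase i, (1 - 2 * n * β) * p ≤
      ∫ x, closeInd ρ (x i, x j) * (1 - ∑ l ∈ (Finset.univ.erase i).erase j,
        (closeInd ρ (x i, x l) + closeInd ρ (x j, x l))) ∂(Measure.pi fun _ : Fin n => μ) := by
    intro i j hj
    have hji := Finset.ne_of_mem_erase hj
    have e : ∀ x : Fin n → Plane, closeInd ρ (x i, x j) * (1 - ∑ l ∈ (Finset.univ.erase i).erase j,
        (closeInd ρ (x i, x l) + closeInd ρ (x j, x l))) = closeInd ρ (x i, x j) -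
        ∑ l ∈ (Finset.univ.erase i).erase j, (closeInd ρ (x i, x j) * closeInd ρ (x i, x l) +
        closeInd ρ (x i, x j) * closeInd ρ (x j, x l)) := fun x => by
      simp only [mul_sub, mul_one, Finset.mul_sum, mul_add]
    simp_rw [e]
    rw [integral_sub ((hc i j).integrable _) ((hsum i j).integrable _),
      integral_closeInd_pair ρ hji, integral_finsetSum _ fun l _ =>
        (((hc i j).mul (hc i l)).add ((hc i j).mul (hc j l))).integrable _]
    -- A third point spoils a close pair with conditional probability at most 2β; there are fewer
    -- than n third points, whence the factor 1 - 2nβ.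
    have hl : ∀ l ∈ (Finset.univ.erase i).erase j, ∫ x, (closeInd ρ (x i, x j) * closeInd ρ (x i, x l) +
        closeInd ρ (x i, x j) * closeInd ρ (x j, x l)) ∂(Measure.pi fun _ : Fin n => μ) ≤
        2 * β * p := by
      intro l hl
      have hlj := Finset.ne_of_mem_erase hl
      have hli := Finset.ne_of_mem_erase (Finset.mem_of_mem_erase hl)
      rw [integral_add (((hc i j).mul (hc i l)).integrable _) (((hc i j).mul (hc j l)).integrable _)]
      have a := integral_closeInd_triple_le (μ := μ) hβ hli hlj
      have b := integral_closeInd_triple_le (μ := μ) hβ hlj hli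
      rw [integral_closeInd_pair ρ hji, ← hp] at a
      rw [integral_closeInd_pair ρ hji.symm, ← hp] at b
      have e : ∀ x : Fin n → Plane, closeInd ρ (x j, x i) = closeInd ρ (x i, x j) :=
        fun x => closeInd_comm ρ _ _
      simp_rw [e] at b
      linarith
    have hcard : (((Finset.univ.erase i).erase j).card : ℝ) ≤ n := by
      have : ((Finset.univ.erase i).erase j).card ≤ n := by
        simpa using Finset.card_le_univ ((Finset.univ.erase i).erase j)
      exact_mod_cast this
    have := (Finset.sum_le_sum hl).trans (le_of_eq (Finset.sum_const _))
    rw [nsmul_eq_mul] at this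
    have h2 : (((Finset.univ.erase i).erase j).card : ℝ) * (2 * β * p) ≤ n * (2 * β * p) := by
      gcongr
    linarith
  have hR : BddMeas fun x : Fin n → Plane => (reflexiveCount (nnMap x) : ℝ) :=
    bddMeas_nnMap fun f => (reflexiveCount f : ℝ)
  calc (n : ℝ) * (n - 1) * ((1 - 2 * n * β) * p)
      = ∑ i : Fin n, ∑ j ∈ Finset.univ.erase i, (1 - 2 * n * β) * p := by
        simp only [Finset.sum_const, Finset.card_erase_of_mem (Finset.mem_univ _), Finset.card_univ,
          Fintype.card_fin, nsmul_eq_mul]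
        rw [Nat.cast_sub (by omega)]
        push_cast
        ring
    _ ≤ ∑ i : Fin n, ∑ j ∈ Finset.univ.erase i, ∫ x, closeInd ρ (x i, x j) *
        (1 - ∑ l ∈ (Finset.univ.erase i).erase j,
        (closeInd ρ (x i, x l) + closeInd ρ (x j, x l))) ∂(Measure.pi fun _ : Fin n => μ) :=
        Finset.sum_le_sum fun i _ => Finset.sum_le_sum (hpair i)
    _ = ∫ x, ∑ i : Fin n, ∑ j ∈ Finset.univ.erase i, closeInd ρ (x i, x j) *
        (1 - ∑ l ∈ (Finset.univ.erase i).erase j,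
        (closeInd ρ (x i, x l) + closeInd ρ (x j, x l))) ∂(Measure.pi fun _ : Fin n => μ) := by
        rw [integral_finsetSum _ fun i _ => integrable_finsetSum _ fun j _ => (hterm i j).integrable _]
        refine Finset.sum_congr rfl fun i _ => ?_
        rw [integral_finsetSum _ fun j _ => (hterm i j).integrable _]
    _ ≤ _ := by
        refine integral_mono (integrable_finsetSum _ fun i _ => integrable_finsetSum _ fun j _ =>
          (hterm i j).integrable _) (hR.integrable _) fun x => ?_
        exact sum_closeInd_le_reflexiveCount hn x ρ

end Reflexive

/-! ### Uniform points on a measurable region of finite area -/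

section Region

variable {D : Set Plane}

lemma integral_closeInd_eq (μ : Measure Plane) [IsProbabilityMeasure μ] (ρ : ℝ) (y : Plane) :
    ∫ z, closeInd ρ (y, z) ∂μ = μ.real (Metric.closedBall y ρ) := by
  have : (fun z => closeInd ρ (y, z)) = Set.indicator (Metric.closedBall y ρ) fun _ => 1 := by
    funext z
    simp only [closeInd, Set.indicator, Metric.mem_closedBall, dist_comm]
  rw [this, integral_indicator Metric.isClosed_closedBall.measurableSet]
  simp

/-- The radius for which a disc has the `4 n`-th part of the area of the region `D`. -/
def discRadius (D : Set Plane) (n : ℕ) : ℝ :=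
  √(volume.real D / (4 * n * volume.real (Metric.ball (0 : Plane) 1)))

lemma volume_ball_pos : 0 < volume.real (Metric.ball (0 : Plane) 1) :=
  ENNReal.toReal_pos (Metric.measure_ball_pos _ _ one_pos).ne' measure_ball_lt_top.ne

lemma volume_real_closedBall_discRadius (n : ℕ) (y : Plane) :
    volume.real (Metric.closedBall y (discRadius D n)) = volume.real D / (4 * n) := by
  rw [Measure.addHaar_real_closedBall volume y (show 0 ≤ discRadius D n from Real.sqrt_nonneg _),
    discRadius]
  have h := volume_ball_pos
  have : Module.finrank ℝ Plane = 2 := by simp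
  rw [this, Real.sq_sqrt (by positivity)]
  rcases Nat.eq_zero_or_pos n with h0 | h0
  · simp [h0]
  · field_simp

lemma cond_real_closedBall (hD : MeasurableSet D) (y : Plane) (ρ : ℝ) :
    (cond volume D).real (Metric.closedBall y ρ) =
      volume.real (D ∩ Metric.closedBall y ρ) / volume.real D := by
  rw [measureReal_def, cond_apply hD, ENNReal.toReal_mul, ENNReal.toReal_inv, measureReal_def,
    measureReal_def]
  ring

lemma cond_real_closedBall_le (hD : MeasurableSet D) (h0 : 0 < volume D) (hfin : volume D < ⊤)
    (n : ℕ) (y : Plane) :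
    (cond volume D).real (Metric.closedBall y (discRadius D n)) ≤ 1 / (4 * n) := by
  have hV : 0 < volume.real D := ENNReal.toReal_pos h0.ne' hfin.ne
  rw [cond_real_closedBall hD, div_le_iff₀ hV]
  refine (measureReal_mono Set.inter_subset_right measure_closedBall_lt_top.ne).trans ?_
  rw [volume_real_closedBall_discRadius]
  exact le_of_eq (by ring)

/-- By the Lebesgue density theorem, two random points of `D` are within distance `discRadius D n`
with probability at least `1 / (8 n)`. -/
lemma eventually_le_integral_closeInd (hD : MeasurableSet D) (h0 : 0 < volume D)
    (hfin : volume D < ⊤) : ∀ᶠ n : ℕ in atTop, 1 / (8 * (n : ℝ)) ≤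
      ∫ y, ∫ z, closeInd (discRadius D n) (y, z) ∂(cond volume D) ∂(cond volume D) := by
  have hV : 0 < volume.real D := ENNReal.toReal_pos h0.ne' hfin.ne
  have hprob : IsProbabilityMeasure (cond (volume : Measure Plane) D) :=
    cond_isProbabilityMeasure_of_finite h0.ne' hfin.ne
  have hρ : Tendsto (fun n : ℕ => discRadius D n) atTop (𝓝[>] 0) := by
    rw [tendsto_nhdsWithin_iff]
    constructor
    · have h1 : Tendsto (fun n : ℕ => 4 * (n : ℝ) * volume.real (Metric.ball (0 : Plane) 1)) atTop
          atTop := (tendsto_natCast_atTop_atTop.const_mul_atTop (by norm_num)).atTop_mul_const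
            volume_ball_pos
      have h2 := (h1.const_div_atTop (volume.real D)).sqrt
      rw [Real.sqrt_zero] at h2
      exact h2
    · filter_upwards [eventually_gt_atTop 0] with n hn
      have hn' : (0 : ℝ) < n := by exact_mod_cast hn
      have := volume_ball_pos
      exact Real.sqrt_pos.2 (by positivity)
  -- By the choice of the radius, 4n times the probability of the disc is the relative density of D
  -- in it. This is at most 1 and tends to 1 at almost every point of D, so dominated convergence
  -- applies without regularity of the boundary.
  have hdens : ∀ᵐ y ∂(cond (volume : Measure Plane) D), Tendsto (fun n : ℕ => 4 * (n : ℝ) *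
      ∫ z, closeInd (discRadius D n) (y, z) ∂(cond volume D)) atTop (𝓝 1) := by
    have hac : cond (volume : Measure Plane) D ≪ volume.restrict D := by
      unfold ProbabilityTheory.cond
      exact Measure.smul_absolutelyContinuous
    filter_upwards [hac.ae_le (Besicovitch.ae_tendsto_measure_inter_div volume D)] with y hy
    have h1 := (ENNReal.tendsto_toReal ENNReal.one_ne_top).comp (hy.comp hρ)
    rw [ENNReal.toReal_one] at h1
    refine h1.congr' ?_
    filter_upwards [eventually_gt_atTop 0] with n hn
    have hn' : (0 : ℝ) < n := by exact_mod_cast hn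
    simp only [Function.comp]
    rw [integral_closeInd_eq, cond_real_closedBall hD, ENNReal.toReal_div, ← measureReal_def,
      ← measureReal_def, volume_real_closedBall_discRadius]
    field_simp
  have hlim := tendsto_integral_of_dominated_convergence (fun _ => (1 : ℝ)) (fun n =>
      (((bddMeas_closeInd (discRadius D n)).integral_right (cond volume D)).const_mul
        (4 * (n : ℝ))).1.aestronglyMeasurable) (integrable_const _)
    (fun n => Eventually.of_forall fun y => ?_) hdens
  swap
  · rw [integral_closeInd_eq, Real.norm_of_nonneg (by positivity)]
    have := cond_real_closedBall_le hD h0 hfin n y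
    rcases Nat.eq_zero_or_pos n with hn | hn
    · simp [hn]
    · have hn' : (0 : ℝ) < n := by exact_mod_cast hn
      rw [le_div_iff₀ (by positivity)] at this
      linarith
  simp only [integral_const, probReal_univ, one_smul] at hlim
  filter_upwards [(tendsto_order.1 hlim).1 (1 / 2) (by norm_num), eventually_gt_atTop 0] with n h hn
  have hn' : (0 : ℝ) < n := by exact_mod_cast hn
  rw [integral_const_mul] at h
  rw [div_le_iff₀ (by positivity)]
  linarith

/-- Among independent uniform points, the expected share of points in reflexive pairs does not
vanish. -/
theorem eventually_le_integral_reflexiveCount (hD : MeasurableSet D) (h0 : 0 < volume D)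
    (hfin : volume D < ⊤) : ∀ᶠ n : ℕ in atTop, (n : ℝ) / 32 ≤
      ∫ x, (reflexiveCount (nnMap x) : ℝ) ∂(Measure.pi fun _ : Fin n => cond volume D) := by
  have hprob : IsProbabilityMeasure (cond (volume : Measure Plane) D) :=
    cond_isProbabilityMeasure_of_finite h0.ne' hfin.ne
  filter_upwards [eventually_le_integral_closeInd hD h0 hfin, eventually_ge_atTop 2] with n hp hn
  have hn' : (2 : ℝ) ≤ n := by exact_mod_cast hn
  refine le_trans ?_ (le_integral_reflexiveCount hn (ρ := discRadius D n) (β := 1 / (4 * n))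
    fun y => by rw [integral_closeInd_eq]; exact cond_real_closedBall_le hD h0 hfin n y)
  -- With β = 1/(4n) half of the close pairs survive, leaving n(n - 1) · (1/2) · 1/(8n) = (n -
  -- 1)/16, at least n/32 for n ≥ 2.
  have e : 1 - 2 * (n : ℝ) * (1 / (4 * n)) = 1 / 2 := by field_simp; norm_num
  rw [e]
  calc (n : ℝ) / 32 ≤ n * (n - 1) * (1 / 2 * (1 / (8 * n))) := by
        have : (n : ℝ) * (n - 1) * (1 / 2 * (1 / (8 * n))) = (n - 1) / 16 := by field_simp; ring
        rw [this]; linarith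
    _ ≤ _ := by
        have : (0 : ℝ) ≤ n * (n - 1) := mul_nonneg (by linarith) (by linarith)
        gcongr

/-- With the other points fixed, a tie confines the point `x l` to a circle, which has area 0. -/
lemma ae_noTies {n : ℕ} (μ : Measure Plane) [IsProbabilityMeasure μ] (hμ : μ ≪ volume) :
    ∀ᵐ x ∂(Measure.pi fun _ : Fin n => μ), NoTies x := by
  have h : ∀ i j l : Fin n, j ≠ i → l ≠ i → j ≠ l → ∀ᵐ x ∂(Measure.pi fun _ : Fin n => μ),
      dist (x i) (x j) ≠ dist (x i) (x l) := by
    intro i j l _ hli hjl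
    rw [ae_iff]
    refine measure_pi_eq_zero_of_section (fun _ => μ) l ?_ fun x => ?_
    · simpa using measurableSet_eq_fun
        ((measurable_pi_apply i).dist (measurable_pi_apply j) : Measurable fun x : Fin n → Plane => _)
        ((measurable_pi_apply i).dist (measurable_pi_apply l))
    · refine measure_mono_null (t := Metric.sphere (x i) (dist (x i) (x j))) (fun y hy => ?_)
        (hμ (Measure.addHaar_sphere _ _ _))
      simp only [Set.mem_ofPred_eq, not_not, Function.update_self, Function.update_of_ne hli.symm,
        Function.update_of_ne hjl] at hy
      rw [Metric.mem_sphere, dist_comm]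
      exact hy.symm
  simp only [NoTies, ae_all_iff, eventually_imp_distrib_left]
  exact h

end Region

/-! ### CSR independence -/

lemma csrLaw_eq (n₁ n₂ : ℕ) (D : Set Plane) :
    csrLaw n₁ n₂ D = Measure.pi fun _ : Fin (n₁ + n₂) => cond volume D := by
  simp [csrLaw, locationLaw]

section CSR

variable {n₁ n₂ : ℕ → ℕ} {ν : ℝ} {D : Set Plane}

/-- Under CSR independence, the variance of `T` exceeds that in the row-wise framework. -/
theorem eventually_variance_rowwise_lt_csrLaw (h0 : 0 < ν) (h1 : ν < 1)
    (hn : Tendsto (fun k => n₁ k + n₂ k) atTop atTop)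
    (hlim : Tendsto (fun k => (n₁ k : ℝ) / ((n₁ k : ℝ) + n₂ k)) atTop (𝓝 ν))
    (hD : MeasurableSet D) (hD0 : 0 < volume D) (hfin : volume D < ⊤) :
    ∀ᶠ k in atTop, variance (fun s => (rowwiseTable s).diffT)
        (rowwiseLaw (n₁ k) (n₂ k) ((n₁ k : ℝ) / ((n₁ k : ℝ) + n₂ k))
          ((n₁ k : ℝ) / ((n₁ k : ℝ) + n₂ k))) <
      variance (fun x => (blockTable x).diffT) (csrLaw (n₁ k) (n₂ k) D) := by
  have hprob : IsProbabilityMeasure (cond (volume : Measure Plane) D) :=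
    cond_isProbabilityMeasure_of_finite hD0.ne' hfin.ne
  filter_upwards [eventually_variance_rowwise_lt h0 h1 hn hlim (r := 1 / 32) (by norm_num),
    hn.eventually (eventually_le_integral_reflexiveCount hD hD0 hfin),
    eventually_pos_sizes h0 h1 hlim, hn.eventually_ge_atTop 6] with k hk hRk hpos h6
  rw [csrLaw_eq]
  set Q := Measure.pi fun _ : Fin (n₁ k + n₂ k) => cond (volume : Measure Plane) D with hQ
  have hc : Fintype.card (Fin (n₁ k + n₂ k)) = n₁ k + n₂ k := Fintype.card_fin _
  have hlt : n₁ k < Fintype.card (Fin (n₁ k + n₂ k)) := by omega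
  have hpos' : (0 : ℝ) < (n₁ k : ℝ) + n₂ k := by
    have : 0 < n₁ k + n₂ k := by omega
    exact_mod_cast this
  have hties := ae_noTies (n := n₁ k + n₂ k) (cond volume D) cond_absolutelyContinuous
  have hinj := ae_injective_pi (fun _ : Fin (n₁ k + n₂ k) => cond (volume : Measure Plane) D)
    fun _ y => cond_absolutelyContinuous (measure_singleton y)
  have hgood : ∀ᵐ x ∂Q, GoodMap (nnMap x) := hinj.mono fun x hx => goodMap_nnMap (by omega) hx
  have hT : BddMeas fun x : Fin (n₁ k + n₂ k) → Plane => (blockTable x).diffT :=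
    bddMeas_diffT measurable_blockTable
  -- The conditional mean given the locations is constant, and the lower bound for the conditional
  -- second moment is affine in R, so averaging over the locations only replaces R by its
  -- expectation.
  have hmean : ∫ x, (blockTable x).diffT ∂Q = -1 / ((n₁ k : ℝ) + n₂ k - 1) := by
    rw [integral_exchangeable (by omega) (cond volume D) hties Table.diffT]
    have : ∀ᵐ x ∂Q, ∫ lab, (spatialTable (nnMap x) lab).diffT ∂(rlLaw (n₁ k) (n₂ k)) =
        -1 / ((n₁ k : ℝ) + n₂ k - 1) := by
      filter_upwards [hgood] with x hx
      have := integral_labelUniform_diffT hx hpos.1 hlt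
      rw [hc, Nat.cast_add] at this
      exact this
    rw [integral_congr_ae this]
    simp
  have hsq : (1 + (∫ x, (reflexiveCount (nnMap x) : ℝ) ∂Q) / ((n₁ k : ℝ) + n₂ k) -
      400 / (((n₁ k : ℝ) + n₂ k) * ((n₁ k : ℝ) / ((n₁ k : ℝ) + n₂ k) *
        (1 - (n₁ k : ℝ) / ((n₁ k : ℝ) + n₂ k))) ^ 2)) / ((n₁ k : ℝ) + n₂ k) ≤
      ∫ x, (blockTable x).diffT ^ 2 ∂Q := by
    rw [integral_exchangeable (by omega) (cond volume D) hties fun N => N.diffT ^ 2]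
    have hsqx : ∀ᵐ x ∂Q, (1 + (reflexiveCount (nnMap x) : ℝ) / ((n₁ k : ℝ) + n₂ k) -
      400 / (((n₁ k : ℝ) + n₂ k) * ((n₁ k : ℝ) / ((n₁ k : ℝ) + n₂ k) *
        (1 - (n₁ k : ℝ) / ((n₁ k : ℝ) + n₂ k))) ^ 2)) / ((n₁ k : ℝ) + n₂ k) ≤
        ∫ lab, (spatialTable (nnMap x) lab).diffT ^ 2 ∂(rlLaw (n₁ k) (n₂ k)) := by
      filter_upwards [hgood] with x hx
      have := integral_labelUniform_diffT_sq_ge hx hpos.1 hlt (by omega) rfl rfl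
      rw [hc, Nat.cast_add] at this
      exact this
    generalize 400 / (((n₁ k : ℝ) + n₂ k) * ((n₁ k : ℝ) / ((n₁ k : ℝ) + n₂ k) *
        (1 - (n₁ k : ℝ) / ((n₁ k : ℝ) + n₂ k))) ^ 2) = c at hsqx ⊢
    have hRi : Integrable (fun x => (reflexiveCount (nnMap x) : ℝ)) Q :=
      (bddMeas_nnMap fun f => (reflexiveCount f : ℝ)).integrable Q
    have := integral_mono_ae ((bddMeas_nnMap fun f =>
      (1 + (reflexiveCount f : ℝ) / ((n₁ k : ℝ) + n₂ k) - c) / ((n₁ k : ℝ) + n₂ k)).integrable Q)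
      ((bddMeas_nnMap fun f =>
        ∫ lab, (spatialTable f lab).diffT ^ 2 ∂(rlLaw (n₁ k) (n₂ k))).integrable Q) hsqx
    refine le_trans (le_of_eq ?_) this
    have hRi' : Integrable (fun x => 1 + (reflexiveCount (nnMap x) : ℝ) / ((n₁ k : ℝ) + n₂ k)) Q :=
      (integrable_const _).add (hRi.div_const _)
    rw [integral_div, integral_sub hRi' (integrable_const _),
      integral_add (integrable_const _) (hRi.div_const _), integral_div]
    simp
  have hvar := variance_eq_sub (μ := Q) (hT.memLp Q 2)
  rw [hvar]
  have := hk _ _ ((le_div_iff₀ hpos').2 ?_) hsq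
  · rw [← hmean] at this
    exact this
  · rw [Nat.cast_add] at hRk
    linarith

lemma measureReal_eq_integral_indicator {Ω : Type*} [MeasurableSpace Ω] (P : Measure Ω)
    {g : Ω → Table} (hg : Measurable g) (A : Set Table) :
    P.real {ω | g ω ∈ A} = ∫ ω, A.indicator (fun _ => (1 : ℝ)) (g ω) ∂P := by
  have : (fun ω => A.indicator (fun _ => (1 : ℝ)) (g ω)) = (g ⁻¹' A).indicator 1 := by
    funext ω
    by_cases h : g ω ∈ A <;> simp [h]
  rw [this, integral_indicator_one (hg A.to_countable.measurableSet)]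
  rfl

lemma reflexiveCount_le {n : ℕ} (f : Fin n → Fin n) : reflexiveCount f ≤ n := by
  simpa [reflexiveCount] using Finset.card_le_univ (Finset.univ.filter fun i => f (f i) = i)

/-- A lower bound for a probability under CSR independence from lower bounds under random labelling,
which are stronger for locations with many reflexive pairs. -/
lemma le_csrLaw_real {n₁ n₂ : ℕ} (hn : 2 ≤ n₁ + n₂) (hD0 : 0 < volume D) (hfin : volume D < ⊤)
    (A : Set Table) {a b : ℝ} (hab : a ≤ b)
    (ha : ∀ f : Fin (n₁ + n₂) → Fin (n₁ + n₂), GoodMap f →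
      a ≤ (rlLaw n₁ n₂).real {lab | spatialTable f lab ∈ A})
    (hb : ∀ f : Fin (n₁ + n₂) → Fin (n₁ + n₂), GoodMap f →
      1 / 64 * ((n₁ : ℝ) + n₂) ≤ reflexiveCount f →
      b ≤ (rlLaw n₁ n₂).real {lab | spatialTable f lab ∈ A})
    (hR : ((n₁ + n₂ : ℕ) : ℝ) / 32 ≤ ∫ x, (reflexiveCount (nnMap x) : ℝ)
      ∂(Measure.pi fun _ : Fin (n₁ + n₂) => cond volume D)) :
    a + (b - a) / 64 ≤ (csrLaw n₁ n₂ D).real {x | blockTable x ∈ A} := by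
  have hprob : IsProbabilityMeasure (cond (volume : Measure Plane) D) :=
    cond_isProbabilityMeasure_of_finite hD0.ne' hfin.ne
  rw [csrLaw_eq, measureReal_eq_integral_indicator _ measurable_blockTable,
    integral_exchangeable hn (cond volume D) (ae_noTies _ cond_absolutelyContinuous)]
  set Q := Measure.pi fun _ : Fin (n₁ + n₂) => cond (volume : Measure Plane) D with hQ
  have hpos : (0 : ℝ) < (n₁ : ℝ) + n₂ := by
    have : 0 < n₁ + n₂ := by omega
    exact_mod_cast this
  have hinj := ae_injective_pi (fun _ : Fin (n₁ + n₂) => cond (volume : Measure Plane) D)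
    fun _ y => cond_absolutelyContinuous (measure_singleton y)
  -- The step from a to b at R/n = 1/64 lies above this affine function of R/n in [0, 1]. As the
  -- mean of R/n is at least 1/32, integration gains (b - a)/64.
  have hlow : ∀ᵐ x ∂Q, a + (b - a) * ((reflexiveCount (nnMap x) : ℝ) / ((n₁ : ℝ) + n₂) - 1 / 64) ≤
      ∫ lab, A.indicator (fun _ => (1 : ℝ)) (spatialTable (nnMap x) lab) ∂(rlLaw n₁ n₂) := by
    filter_upwards [hinj] with x hx
    have hg := goodMap_nnMap hn hx
    rw [← measureReal_eq_integral_indicator _ (measurable_of_finite _)]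
    rcases le_total (1 / 64 * ((n₁ : ℝ) + n₂)) (reflexiveCount (nnMap x)) with h | h
    · refine le_trans ?_ (hb _ hg h)
      have h1 : (reflexiveCount (nnMap x) : ℝ) / ((n₁ : ℝ) + n₂) ≤ 1 := by
        rw [div_le_one hpos]
        exact_mod_cast reflexiveCount_le (nnMap x)
      nlinarith
    · refine le_trans ?_ (ha _ hg)
      have h1 : (reflexiveCount (nnMap x) : ℝ) / ((n₁ : ℝ) + n₂) ≤ 1 / 64 := by
        rwa [div_le_iff₀ hpos]
      nlinarith
  have hRi : Integrable (fun x => (reflexiveCount (nnMap x) : ℝ)) Q :=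
    (bddMeas_nnMap fun f => (reflexiveCount f : ℝ)).integrable Q
  have := integral_mono_ae ((bddMeas_nnMap fun f =>
      a + (b - a) * ((reflexiveCount f : ℝ) / ((n₁ : ℝ) + n₂) - 1 / 64)).integrable Q)
    ((bddMeas_nnMap fun f => ∫ lab, A.indicator (fun _ => (1 : ℝ)) (spatialTable f lab)
      ∂(rlLaw n₁ n₂)).integrable Q) hlow
  refine le_trans ?_ this
  have hRi' : Integrable (fun x => (reflexiveCount (nnMap x) : ℝ) / ((n₁ : ℝ) + n₂) - 1 / 64) Q :=
    (hRi.div_const _).sub (integrable_const _)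
  rw [integral_add (integrable_const _) (hRi'.const_mul _),
    integral_const_mul, integral_sub (hRi.div_const _) (integrable_const _), integral_div]
  simp only [integral_const, probReal_univ, one_smul]
  have h2 : 1 / 32 ≤ (∫ x, (reflexiveCount (nnMap x) : ℝ) ∂Q) / ((n₁ : ℝ) + n₂) := by
    rw [le_div_iff₀ hpos]
    rw [Nat.cast_add] at hR
    linarith
  nlinarith

/-- Under CSR independence, the tests are liberal. -/
theorem lt_liminf_csrLaw_reject (h0 : 0 < ν) (h1 : ν < 1)
    (hn : Tendsto (fun k => n₁ k + n₂ k) atTop atTop)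
    (hlim : Tendsto (fun k => (n₁ k : ℝ) / ((n₁ k : ℝ) + n₂ k)) atTop (𝓝 ν))
    (hD : MeasurableSet D) (hD0 : 0 < volume D) (hfin : volume D < ⊤)
    {S : Table → ℝ} (hS : S = Table.pielouZ ∨ S = Table.pielouZtilde) {α : ℝ} (hα0 : 0 < α)
    (hα1 : α < 1 / 2) :
    α < liminf (fun k => (csrLaw (n₁ k) (n₂ k) D).real {x | blockTable x ∈ rejectSeg S α}) atTop ∧
    α < liminf (fun k => (csrLaw (n₁ k) (n₂ k) D).real
      {x | blockTable x ∈ rejectAssoc S α}) atTop := by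
  have hprob : IsProbabilityMeasure (cond (volume : Measure Plane) D) :=
    cond_isProbabilityMeasure_of_finite hD0.ne' hfin.ne
  have hprob' : ∀ k, IsProbabilityMeasure (csrLaw (n₁ k) (n₂ k) D) := fun k => by
    rw [csrLaw_eq]; infer_instance
  have hgap := lt_inflatedSize (r := 1 / 64) (by norm_num) hα0 hα1
  set G := inflatedSize (1 / 64) α
  -- With this δ the lower bound is α - δ + (G - α)/64 = α + δ. The baseline α - δ for arbitrary
  -- locations is the case r = 0 of the random labelling bound.
  have hδ : 0 < (G - α) / 128 := by linarith
  have hev0 := eventually_le_rlLaw_reject h0 h1 hn hlim le_rfl hS hα0 hα1 hδ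
  have hev1 := eventually_le_rlLaw_reject h0 h1 hn hlim (r := 1 / 64) (by norm_num) hS hα0 hα1 hδ
  rw [inflatedSize_zero hα0 (by linarith)] at hev0
  constructor
  · refine lt_liminf_of_eventually_le (fun k => measureReal_le_one)
      (b := α - (G - α) / 128 + (G - (G - α) / 128 - (α - (G - α) / 128)) / 64) (by linarith) ?_
    filter_upwards [hev0, hev1, hn.eventually_ge_atTop 2,
      hn.eventually (eventually_le_integral_reflexiveCount hD hD0 hfin)] with k hk0 hk1 h2 hR
    exact le_csrLaw_real h2 hD0 hfin _ (by linarith)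
      (fun f hf => (hk0 f hf (by simp)).1) (fun f hf hr => (hk1 f hf hr).1) hR
  · refine lt_liminf_of_eventually_le (fun k => measureReal_le_one)
      (b := α - (G - α) / 128 + (G - (G - α) / 128 - (α - (G - α) / 128)) / 64) (by linarith) ?_
    filter_upwards [hev0, hev1, hn.eventually_ge_atTop 2,
      hn.eventually (eventually_le_integral_reflexiveCount hD hD0 hfin)] with k hk0 hk1 h2 hR
    exact le_csrLaw_real h2 hD0 hfin _ (by linarith)
      (fun f hf => (hk0 f hf (by simp)).2) (fun f hf hr => (hk1 f hf hr).2) hR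

end CSR

end

theorem theorem1 :
    -- (I), row-wise binomial framework: asymptotic size and consistency of the tests based on `Z`
    (∀ α : ℝ, 0 < α → α < 1 →
      (∀ p : ℝ, 0 < p → p < 1 →
        Tendsto (fun m : ℕ × ℕ => (rowwiseLaw m.1 m.2 p p).real
          {s | rowwiseTable s ∈ rejectSeg Table.pielouZ α}) atTop (𝓝 α) ∧
        Tendsto (fun m : ℕ × ℕ => (rowwiseLaw m.1 m.2 p p).real
          {s | rowwiseTable s ∈ rejectAssoc Table.pielouZ α}) atTop (𝓝 α)) ∧
      (∀ p₁ p₂ : ℝ, 0 ≤ p₁ → p₁ ≤ 1 → 0 ≤ p₂ → p₂ ≤ 1 →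
        (p₂ < p₁ → Tendsto (fun m : ℕ × ℕ => (rowwiseLaw m.1 m.2 p₁ p₂).real
          {s | rowwiseTable s ∈ rejectSeg Table.pielouZ α}) atTop (𝓝 1)) ∧
        (p₁ < p₂ → Tendsto (fun m : ℕ × ℕ => (rowwiseLaw m.1 m.2 p₁ p₂).real
          {s | rowwiseTable s ∈ rejectAssoc Table.pielouZ α}) atTop (𝓝 1)))) ∧
    -- (I), overall multinomial framework: asymptotic size and consistency of the tests based on
    -- `Z̃`; `ν` is the probability of a class 1 base and `κ` that of a class 1 NN
    (∀ α : ℝ, 0 < α → α < 1 →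
      ∀ (μ : Measure (Fin 2 × Fin 2)) (_ : IsProbabilityMeasure μ) (ν κ : ℝ),
        ν = μ.real {u | u.1 = 0} → κ = μ.real {u | u.2 = 0} →
        (0 < ν → ν < 1 → 0 < κ → κ < 1 → μ.real {(0, 0)} = ν * κ →
          Tendsto (fun n : ℕ => (pairsLaw n μ).real
            {s | pairsTable s ∈ rejectSeg Table.pielouZtilde α}) atTop (𝓝 α) ∧
          Tendsto (fun n : ℕ => (pairsLaw n μ).real
            {s | pairsTable s ∈ rejectAssoc Table.pielouZtilde α}) atTop (𝓝 α)) ∧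
        (ν * κ < μ.real {(0, 0)} →
          Tendsto (fun n : ℕ => (pairsLaw n μ).real
            {s | pairsTable s ∈ rejectSeg Table.pielouZtilde α}) atTop (𝓝 1)) ∧
        (μ.real {(0, 0)} < ν * κ →
          Tendsto (fun n : ℕ => (pairsLaw n μ).real
            {s | pairsTable s ∈ rejectAssoc Table.pielouZtilde α}) atTop (𝓝 1))) ∧
    -- (II), liberality: class sizes with `n₁ + n₂ → ∞` and `n₁ / (n₁ + n₂) → ν ∈ (0, 1)`
    (∀ (n₁ n₂ : ℕ → ℕ) (ν : ℝ), 0 < ν → ν < 1 →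
      Tendsto (fun k => n₁ k + n₂ k) atTop atTop →
      Tendsto (fun k => (n₁ k : ℝ) / ((n₁ k : ℝ) + n₂ k)) atTop (𝓝 ν) →
      -- random labelling of distinct fixed locations with a non-vanishing share of reflexive pairs
      (∀ (x : ∀ k, Fin (n₁ k + n₂ k) → Plane)
          (f : ∀ k, Fin (n₁ k + n₂ k) → Fin (n₁ k + n₂ k)) (r : ℝ),
        (∀ k, Function.Injective (x k)) → (∀ k, IsNNMap (x k) (f k)) → 0 < r →
        (∀ᶠ k in atTop, r * ((n₁ k : ℝ) + n₂ k) ≤ reflexiveCount (f k)) →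
        (∀ᶠ k in atTop,
          variance (fun s => (rowwiseTable s).diffT)
              (rowwiseLaw (n₁ k) (n₂ k) ((n₁ k : ℝ) / ((n₁ k : ℝ) + n₂ k))
                ((n₁ k : ℝ) / ((n₁ k : ℝ) + n₂ k))) <
            variance (fun lab => (spatialTable (f k) lab).diffT) (rlLaw (n₁ k) (n₂ k))) ∧
        ∀ S : Table → ℝ, S = Table.pielouZ ∨ S = Table.pielouZtilde →
          ∀ α : ℝ, 0 < α → α < 1 / 2 →
            α < liminf (fun k => (rlLaw (n₁ k) (n₂ k)).real
              {lab | spatialTable (f k) lab ∈ rejectSeg S α}) atTop ∧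
            α < liminf (fun k => (rlLaw (n₁ k) (n₂ k)).real
              {lab | spatialTable (f k) lab ∈ rejectAssoc S α}) atTop) ∧
      -- CSR independence on a planar region `D`
      (∀ D : Set Plane, MeasurableSet D → 0 < volume D → volume D < ⊤ →
        (∀ᶠ k in atTop,
          variance (fun s => (rowwiseTable s).diffT)
              (rowwiseLaw (n₁ k) (n₂ k) ((n₁ k : ℝ) / ((n₁ k : ℝ) + n₂ k))
                ((n₁ k : ℝ) / ((n₁ k : ℝ) + n₂ k))) <
            variance (fun x => (blockTable x).diffT) (csrLaw (n₁ k) (n₂ k) D)) ∧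
        ∀ S : Table → ℝ, S = Table.pielouZ ∨ S = Table.pielouZtilde →
          ∀ α : ℝ, 0 < α → α < 1 / 2 →
            α < liminf (fun k => (csrLaw (n₁ k) (n₂ k) D).real
              {x | blockTable x ∈ rejectSeg S α}) atTop ∧
            α < liminf (fun k => (csrLaw (n₁ k) (n₂ k) D).real
              {x | blockTable x ∈ rejectAssoc S α}) atTop)) ∧
    -- (II), consistency of the same tests against departures from the spatial null patterns
    (∀ S : Table → ℝ, S = Table.pielouZ ∨ S = Table.pielouZtilde →
      ∀ α ε : ℝ, 0 < α → α < 1 → 0 < ε →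
      -- departures from CSR independence: independent points, the two classes with own laws
      (∀ (n₁ n₂ : ℕ → ℕ), Tendsto n₁ atTop atTop → Tendsto n₂ atTop atTop →
        ∀ (μ₁ μ₂ : ℕ → Measure Plane),
          (∀ k, IsProbabilityMeasure (μ₁ k) ∧ ∀ y, μ₁ k {y} = 0) →
          (∀ k, IsProbabilityMeasure (μ₂ k) ∧ ∀ y, μ₂ k {y} = 0) →
          ((∀ᶠ k in atTop,
              ε ≤ ∫ x, (blockTable x).diffT ∂(locationLaw (n₁ k) (n₂ k) (μ₁ k) (μ₂ k))) →
            Tendsto (fun k => (locationLaw (n₁ k) (n₂ k) (μ₁ k) (μ₂ k)).real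
              {x | blockTable x ∈ rejectSeg S α}) atTop (𝓝 1)) ∧
          ((∀ᶠ k in atTop,
              ∫ x, (blockTable x).diffT ∂(locationLaw (n₁ k) (n₂ k) (μ₁ k) (μ₂ k)) ≤ -ε) →
            Tendsto (fun k => (locationLaw (n₁ k) (n₂ k) (μ₁ k) (μ₂ k)).real
              {x | blockTable x ∈ rejectAssoc S α}) atTop (𝓝 1))) ∧
      -- departures from random labelling: fixed locations, independent labels whose probabilities
      -- depend on the location
      (∀ (n : ℕ → ℕ) (x : ∀ k, Fin (n k) → Plane) (f : ∀ k, Fin (n k) → Fin (n k))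
          (p : ∀ k, Fin (n k) → ℝ),
        (∀ k, Function.Injective (x k)) → (∀ k, IsNNMap (x k) (f k)) →
        (∀ k i, 0 ≤ p k i ∧ p k i ≤ 1) →
        ∀ (e : ℕ → Fin 2 → ℝ) (c : ℕ → Fin 2 → ℝ),
          (∀ k i, e k i =
            ∫ lab, ((spatialTable (f k) lab).rowSum i : ℝ)
              ∂(Measure.pi fun j => labelLaw (p k j))) →
          (∀ k i, c k i =
            ∫ lab, (spatialTable (f k) lab i 0 : ℝ) ∂(Measure.pi fun j => labelLaw (p k j))) →
          (∀ i, Tendsto (fun k => e k i) atTop atTop) →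
          ((∀ᶠ k in atTop, ε ≤ c k 0 / e k 0 - c k 1 / e k 1) →
            Tendsto (fun k => (Measure.pi fun j => labelLaw (p k j)).real
              {lab | spatialTable (f k) lab ∈ rejectSeg S α}) atTop (𝓝 1)) ∧
          ((∀ᶠ k in atTop, c k 0 / e k 0 - c k 1 / e k 1 ≤ -ε) →
            Tendsto (fun k => (Measure.pi fun j => labelLaw (p k j)).real
              {lab | spatialTable (f k) lab ∈ rejectAssoc S α}) atTop (𝓝 1))) ∧
      -- any joint law of locations and labels with given class sizes under which the variance
      -- of `T` vanishes
      (∀ (n₁ n₂ : ℕ → ℕ), Tendsto n₁ atTop atTop → Tendsto n₂ atTop atTop →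
        ∀ P : ∀ k, Measure ((Fin (n₁ k + n₂ k) → Plane) × (Fin (n₁ k + n₂ k) → Fin 2)),
          (∀ k, IsProbabilityMeasure (P k)) →
          (∀ k, ∀ᵐ w ∂(P k), Function.Injective w.1 ∧
            (Finset.univ.filter fun j => w.2 j = 0).card = n₁ k) →
          Tendsto (fun k => variance (fun w => (spatialTable (nnMap w.1) w.2).diffT) (P k))
            atTop (𝓝 0) →
          ((∀ᶠ k in atTop, ε ≤ ∫ w, (spatialTable (nnMap w.1) w.2).diffT ∂(P k)) →
            Tendsto (fun k => (P k).real
              {w | spatialTable (nnMap w.1) w.2 ∈ rejectSeg S α}) atTop (𝓝 1)) ∧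
          ((∀ᶠ k in atTop, ∫ w, (spatialTable (nnMap w.1) w.2).diffT ∂(P k) ≤ -ε) →
            Tendsto (fun k => (P k).real
              {w | spatialTable (nnMap w.1) w.2 ∈ rejectAssoc S α}) atTop (𝓝 1)))) := by
  refine ⟨fun α h0 h1 => ⟨fun p hp0 hp1 => tendsto_rowwise_size h0 h1 hp0 hp1,
      fun p₁ p₂ a b c d => tendsto_rowwise_reject α a b c d⟩,
    fun α h0 h1 μ hμ ν κ hν hκ => ⟨fun a b c d h => tendsto_pairs_size h0 h1 hν hκ a b c d h,
      tendsto_pairs_reject α hν hκ⟩,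
    fun n₁ n₂ ν hν0 hν1 hn hlim => ⟨?_, ?_⟩,
    fun S hS α ε _ _ hε => ⟨fun n₁ n₂ h₁ h₂ μ₁ μ₂ hμ₁ hμ₂ =>
        tendsto_reject_of_independent_locations hS α hε h₁ h₂ hμ₁ hμ₂,
      fun n x f p hx hf hp e c he hc hlim =>
        tendsto_reject_of_independent_labels (fun k => (hf k).goodMap (hx k)) hp hS α hε he hc hlim,
      fun n₁ n₂ h₁ h₂ P hP hc hvar => tendsto_reject_of_joint_law hS α hε h₁ h₂ P hP
        (fun k => (hc k).mono fun w hw => hw.2) hvar⟩⟩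
  · intro x f r hx hf hr hR
    exact ⟨eventually_variance_rowwise_lt_rlLaw hν0 hν1 hn hlim hr (fun k => (hf k).goodMap (hx k)) hR,
      fun S hS α h0 h1 => lt_liminf_rlLaw_reject hν0 hν1 hn hlim hr
        (fun k => (hf k).goodMap (hx k)) hR hS h0 h1⟩
  · intro D hD hD0 hfin
    exact ⟨eventually_variance_rowwise_lt_csrLaw hν0 hν1 hn hlim hD hD0 hfin,
      fun S hS α h0 h1 => lt_liminf_csrLaw_reject hν0 hν1 hn hlim hD hD0 hfin hS h0 h1⟩
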